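/- Let $\mathcal E$ be a Barr-exact category and let $\mathrm{Gpd}(\mathcal E)$ be the category of internal groupoids and internal functors in $\mathcal E$. An internal functor $F\colon\mathbb A\to\mathbb B$ is a discrete fibration if the square $c\cdot F_1=F_0\cdot c$ is a pullback, and it is final if it is left orthogonal to all discrete fibrations; $\mathcal F$ and $\mathcal D$ denote the classes of final functors and of discrete fibrations. An internal distributor $S$ between internal groupoids $\mathbb A$ and $\mathbb B$ is a span $A_0\xleftarrow{L}S_0\xrightarrow{R}B_0$ with a left action $A_1\times_{A_0}S_0\to S_0$ and a right action $S_0\times_{B_0}B_1\to S_0$ that are unital, associative and compatible; morphisms of distributors are the equivariant morphisms of spans. Their category is $\mathrm{Dist}(\mathbb A,\mathbb B)$. The composite $T\otimes S$ of $S$ with a distributor $T$ between $\mathbb B$ and $\mathbb C$ is the coequalizer $Q_0\colon S_0\times_{B_0}T_0\to (T\otimes S)_0$ of the two morphisms $S_0\times_{B_0}B_1\times_{B_0}T_0\rightrightarrows S_0\times_{B_0}T_0$ given by the two actions of $\mathbb B$, with the induced legs and actions of $\mathbb A$ and $\mathbb C$; the identity distributor on $\mathbb A$ is $A_1$ acted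 on by composition. A distributor $S$ determines a span $\mathbb A\leftarrow\mathbb S\to\mathbb B$ in $\mathrm{Gpd}(\mathcal E)$, where $\mathbb S$ has object of objects $S_0$ and as object of arrows the pullback of the two actions $A_1\times_{A_0}S_0\to S_0\leftarrow S_0\times_{B_0}B_1$; this gives a functor $I_{\mathbb A,\mathbb B}\colon \mathrm{Dist}(\mathbb A,\mathbb B)\to\mathrm{Span}(\mathbb A,\mathbb B)$ to the category of spans in $\mathrm{Gpd}(\mathcal E)$. A relation relative to $(\mathcal F,\mathcal D)$ is a span $\mathbb A\leftarrow\mathbb X\to\mathbb B$ with $\mathbb X\to\mathbb A\times\mathbb B$ in $\mathcal D$; relations form a full subcategory of $\mathrm{Span}(\mathbb A,\mathbb B)$. The relation associated with a span is obtained by factoring $\mathbb X\to\mathbb A\times\mathbb B$ as a morphism in $\mathcal F$ followed by one in $\mathcal D$, and identities and composites of relations are the relations associated with the identity spans and with the composites (by pullback) $T\diamond S$ of spans. Then the following hold. 1. $(\mathcal F,\mathcal D)$ is an orthogonal factorization system on $\mathrm{Gpd}(\mathcal E)$. 2. For all $\mathbb A,\mathbb B$, the functor $I_{\mathbb A,\mathbb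 B}$ is fully faithful and has a left adjoint $R_{\mathbb A,\mathbb B}$, with $R_{\mathbb A,\mathbb B}\cdot I_{\mathbb A,\mathbb B}\cong \mathrm{id}$, such that the components of the unit are final functors. 3. For all composable distributors $S,T$ the quotient $Q_0$ is the object part of a morphism of spans $Q\colon T\diamond S\to I(T\otimes S)$ whose underlying functor is final, and $Q$ induces an isomorphism $R(T\diamond S)\cong T\otimes S$, where $T\diamond S$ denotes the composite of the spans associated with $S$ and $T$. 4. Internal distributors between internal groupoids, with the identities and composition above and with the canonical coherence isomorphisms, form a bicategory $\mathrm{Dist}\,\mathrm{Gpd}(\mathcal E)$. The relations relative to $(\mathcal F,\mathcal D)$, with the coherence isomorphisms for which the inclusion into the bicategory of spans is a lax functor with the final parts of the factorizations as constraints, form a bicategory $\mathrm{Rel}(\mathrm{Gpd}(\mathcal E))$. The two bicategories are the same: $I_{\mathbb A,\mathbb B}$ takes values in relations, and it gives an equivalence from $\mathrm{Dist}(\mathbb A,\mathbb B)$ to the category of relations between $\mathbb A$ and $\mathbb B$, for all $\mathbb A,\mathbb B$. These equivalences are the local functors of an identity-on-objects pseudofunctor $\mathrm{Dist}\,\mathrm{Gpd}(\mathcal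 E)\to\mathrm{Rel}(\mathrm{Gpd}(\mathcal E))$. Its constraints, precomposed with the final parts $T\diamond S\to R(T\diamond S)$ and $\mathbb A\to R(\mathbb A)$, have object parts $Q_0$ and the identity map $e\colon A_0\to A_1$ of $\mathbb A$. -/

import Mathlib

open CategoryTheory CategoryTheory.Limits

universe v u w

attribute [local simp] pullback.lift_fst pullback.lift_snd pullback.lift_fst_assoc
  pullback.lift_snd_assoc

/-- A Barr-exact category: a regular category in which every internal equivalence relation is
effective (the kernel pair of its coequalizer). -/
class BarrExact (E : Type u) [Category.{v} E] : Prop extends Regular E where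
  effective : ∀ {R X : E} (p₁ p₂ : R ⟶ X) [IsEquivalenceRelation p₁ p₂],
    IsEffectiveEquivalenceRelation p₁ p₂

/-! ### Internal groupoids -/

/-- An internal groupoid in `E`. The composition `m` sends a composable pair `(f, g)`, with the
codomain of `f` equal to the domain of `g`, to the composite first `f`, then `g`. Associativity
is stated on generalized elements. -/
structure IntGpd (E : Type u) [Category.{v} E] [HasFiniteLimits E] where
  /-- the object of objects -/
  obj : E
  /-- the object of arrows -/
  arr : E
  /-- domain -/
  d : arr ⟶ obj
  /-- codomain -/
  c : arr ⟶ obj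
  /-- identities -/
  e : obj ⟶ arr
  /-- composition of composable pairs -/
  m : pullback c d ⟶ arr
  /-- inversion -/
  inv : arr ⟶ arr
  e_d : e ≫ d = 𝟙 obj
  e_c : e ≫ c = 𝟙 obj
  m_d : m ≫ d = pullback.fst c d ≫ d
  m_c : m ≫ c = pullback.snd c d ≫ c
  id_m : pullback.lift (d ≫ e) (𝟙 arr) (by simp [e_c]) ≫ m = 𝟙 arr
  m_id : pullback.lift (𝟙 arr) (c ≫ e) (by simp [e_d]) ≫ m = 𝟙 arr
  assoc : ∀ {X : E} (f g h : X ⟶ arr) (hfg : f ≫ c = g ≫ d) (hgh : g ≫ c = h ≫ d),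
    pullback.lift (pullback.lift f g hfg ≫ m) h (by simp [m_c, hgh]) ≫ m =
      pullback.lift f (pullback.lift g h hgh ≫ m) (by simp [m_d, hfg]) ≫ m
  inv_d : inv ≫ d = c
  inv_c : inv ≫ c = d
  inv_m : pullback.lift inv (𝟙 arr) (by simp [inv_c]) ≫ m = c ≫ e
  m_inv : pullback.lift (𝟙 arr) inv (by simp [inv_d]) ≫ m = d ≫ e

namespace IntGpd

variable {E : Type u} [Category.{v} E] [HasFiniteLimits E]

theorem comp_lift {A B C X Y : E} {f : A ⟶ C} {g : B ⟶ C} (k : Y ⟶ X) (a : X ⟶ A) (b : X ⟶ B)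
    (h : a ≫ f = b ≫ g) :
    k ≫ pullback.lift a b h = pullback.lift (k ≫ a) (k ≫ b) (by simp [h]) := by
  apply pullback.hom_ext <;> simp

theorem lift_congr {A B C X : E} {f : A ⟶ C} {g : B ⟶ C} {a a' : X ⟶ A} {b b' : X ⟶ B}
    (ha : a = a') (hb : b = b') (h : a ≫ f = b ≫ g) :
    (pullback.lift a b h : X ⟶ pullback f g) = pullback.lift a' b' (by rw [← ha, ← hb, h]) := by
  subst ha hb; rfl

section

variable (G : IntGpd E)

/-- Composition of generalized arrows of an internal groupoid: first `f`, then `g`. -/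
noncomputable def mul {X : E} (f g : X ⟶ G.arr) (h : f ≫ G.c = g ≫ G.d) : X ⟶ G.arr :=
  pullback.lift f g h ≫ G.m

variable {G}

theorem mul_d {X : E} (f g : X ⟶ G.arr) (h : f ≫ G.c = g ≫ G.d) :
    G.mul f g h ≫ G.d = f ≫ G.d := by simp [mul, G.m_d]

theorem mul_c {X : E} (f g : X ⟶ G.arr) (h : f ≫ G.c = g ≫ G.d) :
    G.mul f g h ≫ G.c = g ≫ G.c := by simp [mul, G.m_c]

theorem comp_mul {X Y : E} (k : Y ⟶ X) (f g : X ⟶ G.arr) (h : f ≫ G.c = g ≫ G.d) :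
    k ≫ G.mul f g h = G.mul (k ≫ f) (k ≫ g) (by simp [h]) := by
  rw [mul, mul, ← Category.assoc, comp_lift]

theorem mul_assoc {X : E} (f g h : X ⟶ G.arr) (hfg : f ≫ G.c = g ≫ G.d)
    (hgh : g ≫ G.c = h ≫ G.d) :
    G.mul (G.mul f g hfg) h (by rw [mul_c, hgh]) =
      G.mul f (G.mul g h hgh) (by rw [mul_d, hfg]) :=
  G.assoc f g h hfg hgh

theorem mul_congr {X : E} {f f' g g' : X ⟶ G.arr} (hf : f = f') (hg : g = g')
    (h : f ≫ G.c = g ≫ G.d) :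
    G.mul f g h = G.mul f' g' (by rw [← hf, ← hg, h]) := by
  subst hf hg; rfl

theorem id_mul {X : E} (f : X ⟶ G.arr) (x : X ⟶ G.obj) (hx : x = f ≫ G.d) :
    G.mul (x ≫ G.e) f (by simp [G.e_c, hx]) = f := by
  subst hx
  have := congrArg (fun k => f ≫ k) G.id_m
  simp only [Category.comp_id] at this
  refine Eq.trans ?_ this
  rw [← Category.assoc f (pullback.lift _ _ _), comp_lift, mul]
  congr 1
  apply lift_congr <;> simp

theorem mul_id {X : E} (f : X ⟶ G.arr) (x : X ⟶ G.obj) (hx : f ≫ G.c = x) :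
    G.mul f (x ≫ G.e) (by simp [G.e_d, hx]) = f := by
  subst hx
  have := congrArg (fun k => f ≫ k) G.m_id
  simp only [Category.comp_id] at this
  refine Eq.trans ?_ this
  rw [← Category.assoc f (pullback.lift _ _ _), comp_lift, mul]
  congr 1
  apply lift_congr <;> simp

theorem inv_mul {X : E} (f : X ⟶ G.arr) :
    G.mul (f ≫ G.inv) f (by simp [G.inv_c]) = f ≫ G.c ≫ G.e := by
  rw [← G.inv_m, ← Category.assoc f (pullback.lift _ _ _), comp_lift, mul]
  congr 1
  apply lift_congr <;> simp

theorem mul_inv {X : E} (f : X ⟶ G.arr) :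
    G.mul f (f ≫ G.inv) (by simp [G.inv_d]) = f ≫ G.d ≫ G.e := by
  rw [← G.m_inv, ← Category.assoc f (pullback.lift _ _ _), comp_lift, mul]
  congr 1
  apply lift_congr <;> simp

end

/-- An internal functor between internal groupoids. -/
@[ext]
structure Hom (A B : IntGpd E) where
  /-- the action on objects -/
  f₀ : A.obj ⟶ B.obj
  /-- the action on arrows -/
  f₁ : A.arr ⟶ B.arr
  map_d : f₁ ≫ B.d = A.d ≫ f₀
  map_c : f₁ ≫ B.c = A.c ≫ f₀
  map_e : A.e ≫ f₁ = f₀ ≫ B.e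
  map_m : A.m ≫ f₁ =
    B.mul (pullback.fst A.c A.d ≫ f₁) (pullback.snd A.c A.d ≫ f₁)
      (by simp only [Category.assoc, map_d, map_c, pullback.condition_assoc])

theorem Hom.map_mul {A B : IntGpd E} (F : Hom A B) {X : E} (f g : X ⟶ A.arr)
    (h : f ≫ A.c = g ≫ A.d) :
    A.mul f g h ≫ F.f₁ = B.mul (f ≫ F.f₁) (g ≫ F.f₁)
      (by simp only [Category.assoc, F.map_d, F.map_c, reassoc_of% h]) := by
  rw [mul, Category.assoc, F.map_m, comp_mul]
  apply mul_congr <;> simp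

theorem Hom.map_inv {A B : IntGpd E} (F : Hom A B) : A.inv ≫ F.f₁ = F.f₁ ≫ B.inv := by
  have hd : A.inv ≫ F.f₁ ≫ B.d = F.f₁ ≫ B.c := by rw [F.map_d, F.map_c, reassoc_of% A.inv_d]
  have hc : A.inv ≫ F.f₁ ≫ B.c = F.f₁ ≫ B.d := by rw [F.map_c, F.map_d, reassoc_of% A.inv_c]
  have h1 : B.mul (A.inv ≫ F.f₁) F.f₁ (by simpa using hc) = F.f₁ ≫ B.c ≫ B.e := by
    have := F.map_mul A.inv (𝟙 _) (by simp [A.inv_c])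
    refine (mul_congr rfl (by simp) _).trans (this.symm.trans ?_)
    have h2 := A.inv_mul (𝟙 _)
    simp only [Category.id_comp] at h2
    rw [h2, Category.assoc, F.map_e, reassoc_of% F.map_c]
  rw [← mul_id (A.inv ≫ F.f₁) (F.f₁ ≫ B.d) (by simpa using hc)]
  refine (mul_congr rfl (by rw [Category.assoc, ← mul_inv F.f₁]) _).trans ?_
  · rw [← mul_assoc _ _ _ (by simpa using hc) (by simp [B.inv_d])]
    refine (mul_congr h1 rfl _).trans ?_
    refine (mul_congr (Category.assoc _ _ _).symm rfl _).trans ?_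
    exact id_mul _ _ (by simp [B.inv_d])

/-- The category `Gpd(E)` of internal groupoids and internal functors. -/
instance : Category (IntGpd E) where
  Hom := Hom
  id A :=
    { f₀ := 𝟙 _
      f₁ := 𝟙 _
      map_d := by simp
      map_c := by simp
      map_e := by simp
      map_m := by
        rw [Category.comp_id, mul]
        refine (Category.id_comp A.m).symm.trans ?_
        congr 1
        apply pullback.hom_ext <;> simp }
  comp F G :=
    { f₀ := F.f₀ ≫ G.f₀
      f₁ := F.f₁ ≫ G.f₁
      map_d := by rw [Category.assoc, G.map_d, reassoc_of% F.map_d]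
      map_c := by rw [Category.assoc, G.map_c, reassoc_of% F.map_c]
      map_e := by rw [Category.assoc, ← G.map_e, reassoc_of% F.map_e]
      map_m := by
        rw [← Category.assoc, F.map_m, G.map_mul]
        apply mul_congr <;> simp }
  id_comp F := by apply Hom.ext <;> simp
  comp_id F := by apply Hom.ext <;> simp
  assoc F G H := by apply Hom.ext <;> simp

@[simp] theorem id_f₀ (A : IntGpd E) : Hom.f₀ (𝟙 A) = 𝟙 A.obj := rfl
@[simp] theorem id_f₁ (A : IntGpd E) : Hom.f₁ (𝟙 A) = 𝟙 A.arr := rfl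
@[simp] theorem comp_f₀ {A B C : IntGpd E} (F : A ⟶ B) (G : B ⟶ C) :
    Hom.f₀ (F ≫ G) = Hom.f₀ F ≫ Hom.f₀ G := rfl
@[simp] theorem comp_f₁ {A B C : IntGpd E} (F : A ⟶ B) (G : B ⟶ C) :
    Hom.f₁ (F ≫ G) = Hom.f₁ F ≫ Hom.f₁ G := rfl

theorem hom_ext {A B : IntGpd E} {F G : A ⟶ B} (h₀ : Hom.f₀ F = Hom.f₀ G)
    (h₁ : Hom.f₁ F = Hom.f₁ G) : F = G :=
  Hom.ext h₀ h₁

/-! Finite limits of internal groupoids, computed levelwise. -/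

/-- The terminal internal groupoid. -/
noncomputable def terminalGpd : IntGpd E where
  obj := ⊤_ E
  arr := ⊤_ E
  d := 𝟙 _
  c := 𝟙 _
  e := 𝟙 _
  m := terminal.from _
  inv := 𝟙 _
  e_d := by simp
  e_c := by simp
  m_d := Subsingleton.elim _ _
  m_c := Subsingleton.elim _ _
  id_m := Subsingleton.elim _ _
  m_id := Subsingleton.elim _ _
  assoc _ _ _ _ _ := Subsingleton.elim _ _
  inv_d := by simp
  inv_c := by simp
  inv_m := Subsingleton.elim _ _
  m_inv := Subsingleton.elim _ _

instance : HasTerminal (IntGpd E) := by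
  have : ∀ A : IntGpd E, Nonempty (A ⟶ terminalGpd) := fun A =>
    ⟨{ f₀ := terminal.from _
       f₁ := terminal.from _
       map_d := Subsingleton.elim (α := _ ⟶ ⊤_ E) _ _
       map_c := Subsingleton.elim (α := _ ⟶ ⊤_ E) _ _
       map_e := Subsingleton.elim (α := _ ⟶ ⊤_ E) _ _
       map_m := Subsingleton.elim (α := _ ⟶ ⊤_ E) _ _ }⟩
  have : ∀ A : IntGpd E, Subsingleton (A ⟶ terminalGpd) := fun A =>
    ⟨fun F G => hom_ext (Subsingleton.elim (α := _ ⟶ ⊤_ E) _ _)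
      (Subsingleton.elim (α := _ ⟶ ⊤_ E) _ _)⟩
  exact hasTerminal_of_unique (terminalGpd : IntGpd E)

section Pullback

variable {A B C : IntGpd E} (F : A ⟶ C) (G : B ⟶ C)

theorem fst_condition {X : E} {k l : X ⟶ pullback (Hom.f₁ F) (Hom.f₁ G)}
    {p q : pullback (Hom.f₁ F) (Hom.f₁ G) ⟶ pullback (Hom.f₀ F) (Hom.f₀ G)}
    (hp : p ≫ pullback.fst _ _ = pullback.fst _ _ ≫ A.c)
    (hq : q ≫ pullback.fst _ _ = pullback.fst _ _ ≫ A.d) (h : k ≫ p = l ≫ q) :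
    (k ≫ pullback.fst _ _) ≫ A.c = (l ≫ pullback.fst _ _) ≫ A.d := by
  rw [Category.assoc, Category.assoc, ← hp, ← hq, reassoc_of% h]

theorem snd_condition {X : E} {k l : X ⟶ pullback (Hom.f₁ F) (Hom.f₁ G)}
    {p q : pullback (Hom.f₁ F) (Hom.f₁ G) ⟶ pullback (Hom.f₀ F) (Hom.f₀ G)}
    (hp : p ≫ pullback.snd _ _ = pullback.snd _ _ ≫ B.c)
    (hq : q ≫ pullback.snd _ _ = pullback.snd _ _ ≫ B.d) (h : k ≫ p = l ≫ q) :
    (k ≫ pullback.snd _ _) ≫ B.c = (l ≫ pullback.snd _ _) ≫ B.d := by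
  rw [Category.assoc, Category.assoc, ← hp, ← hq, reassoc_of% h]

/-- The levelwise pullback of internal groupoids. -/
noncomputable def pullbackGpd : IntGpd E where
  obj := pullback (Hom.f₀ F) (Hom.f₀ G)
  arr := pullback (Hom.f₁ F) (Hom.f₁ G)
  d := pullback.lift (pullback.fst _ _ ≫ A.d) (pullback.snd _ _ ≫ B.d)
    (by simp only [Category.assoc, ← F.map_d, ← G.map_d, pullback.condition_assoc])
  c := pullback.lift (pullback.fst _ _ ≫ A.c) (pullback.snd _ _ ≫ B.c)
    (by simp only [Category.assoc, ← F.map_c, ← G.map_c, pullback.condition_assoc])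
  e := pullback.lift (pullback.fst _ _ ≫ A.e) (pullback.snd _ _ ≫ B.e)
    (by simp only [Category.assoc, F.map_e, G.map_e, pullback.condition_assoc])
  m := pullback.lift
    (A.mul (pullback.fst _ _ ≫ pullback.fst _ _) (pullback.snd _ _ ≫ pullback.fst _ _)
      (fst_condition F G (by simp) (by simp) pullback.condition))
    (B.mul (pullback.fst _ _ ≫ pullback.snd _ _) (pullback.snd _ _ ≫ pullback.snd _ _)
      (snd_condition F G (by simp) (by simp) pullback.condition))
    (by
      rw [F.map_mul, G.map_mul]
      apply mul_congr <;> simp [pullback.condition])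
  inv := pullback.lift (pullback.fst _ _ ≫ A.inv) (pullback.snd _ _ ≫ B.inv)
    (by simp only [Category.assoc, F.map_inv, G.map_inv, pullback.condition_assoc])
  e_d := by apply pullback.hom_ext <;> simp [A.e_d, B.e_d]
  e_c := by apply pullback.hom_ext <;> simp [A.e_c, B.e_c]
  m_d := by apply pullback.hom_ext <;> simp [mul_d]
  m_c := by apply pullback.hom_ext <;> simp [mul_c]
  id_m := by
    apply pullback.hom_ext
    · simp only [Category.assoc, pullback.lift_fst, comp_mul, Category.id_comp]
      refine (mul_congr ?_ ?_ _).trans (A.id_mul _ _ rfl) <;> simp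
    · simp only [Category.assoc, pullback.lift_snd, comp_mul, Category.id_comp]
      refine (mul_congr ?_ ?_ _).trans (B.id_mul _ _ rfl) <;> simp
  m_id := by
    apply pullback.hom_ext
    · simp only [Category.assoc, pullback.lift_fst, comp_mul, Category.id_comp]
      refine (mul_congr ?_ ?_ _).trans (A.mul_id _ _ rfl) <;> simp
    · simp only [Category.assoc, pullback.lift_snd, comp_mul, Category.id_comp]
      refine (mul_congr ?_ ?_ _).trans (B.mul_id _ _ rfl) <;> simp
  assoc f g h hfg hgh := by
    have h1 := hfg =≫ pullback.fst _ _
    have h2 := hgh =≫ pullback.fst _ _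
    have h3 := hfg =≫ pullback.snd _ _
    have h4 := hgh =≫ pullback.snd _ _
    simp only [Category.assoc, pullback.lift_fst, pullback.lift_snd] at h1 h2 h3 h4
    apply pullback.hom_ext
    · simp only [Category.assoc, pullback.lift_fst, comp_mul]
      refine (mul_congr ?_ ?_ _).trans ((A.mul_assoc (f ≫ pullback.fst _ _)
        (g ≫ pullback.fst _ _) (h ≫ pullback.fst _ _) (by simpa using h1)
        (by simpa using h2)).trans (mul_congr ?_ ?_ _)) <;>
      simp [comp_mul]
    · simp only [Category.assoc, pullback.lift_snd, comp_mul]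
      refine (mul_congr ?_ ?_ _).trans ((B.mul_assoc (f ≫ pullback.snd _ _)
        (g ≫ pullback.snd _ _) (h ≫ pullback.snd _ _) (by simpa using h3)
        (by simpa using h4)).trans (mul_congr ?_ ?_ _)) <;>
      simp [comp_mul]
  inv_d := by apply pullback.hom_ext <;> simp [A.inv_d, B.inv_d]
  inv_c := by apply pullback.hom_ext <;> simp [A.inv_c, B.inv_c]
  inv_m := by
    apply pullback.hom_ext
    · simp only [Category.assoc, pullback.lift_fst, comp_mul]
      refine (mul_congr ?_ ?_ _).trans ((A.inv_mul (pullback.fst _ _)).trans ?_) <;> simp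
    · simp only [Category.assoc, pullback.lift_snd, comp_mul]
      refine (mul_congr ?_ ?_ _).trans ((B.inv_mul (pullback.snd _ _)).trans ?_) <;> simp
  m_inv := by
    apply pullback.hom_ext
    · simp only [Category.assoc, pullback.lift_fst, comp_mul]
      refine (mul_congr ?_ ?_ _).trans ((A.mul_inv (pullback.fst _ _)).trans ?_) <;> simp
    · simp only [Category.assoc, pullback.lift_snd, comp_mul]
      refine (mul_congr ?_ ?_ _).trans ((B.mul_inv (pullback.snd _ _)).trans ?_) <;> simp

/-- The first projection of the levelwise pullback. -/
noncomputable def pullbackFst : pullbackGpd F G ⟶ A where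
  f₀ := pullback.fst _ _
  f₁ := pullback.fst _ _
  map_d := by simp [pullbackGpd]
  map_c := by simp [pullbackGpd]
  map_e := by simp [pullbackGpd]
  map_m := by simp [pullbackGpd]

/-- The second projection of the levelwise pullback. -/
noncomputable def pullbackSnd : pullbackGpd F G ⟶ B where
  f₀ := pullback.snd _ _
  f₁ := pullback.snd _ _
  map_d := by simp [pullbackGpd]
  map_c := by simp [pullbackGpd]
  map_e := by simp [pullbackGpd]
  map_m := by simp [pullbackGpd]

theorem pullback_w : pullbackFst F G ≫ F = pullbackSnd F G ≫ G :=
  hom_ext pullback.condition pullback.condition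

variable {F G} in
/-- The universal property of the levelwise pullback. -/
noncomputable def pullbackLift {X : IntGpd E} (H : X ⟶ A) (K : X ⟶ B) (h : H ≫ F = K ≫ G) :
    X ⟶ pullbackGpd F G where
  f₀ := pullback.lift (Hom.f₀ H) (Hom.f₀ K) (congrArg Hom.f₀ h)
  f₁ := pullback.lift (Hom.f₁ H) (Hom.f₁ K) (congrArg Hom.f₁ h)
  map_d := by apply pullback.hom_ext <;> simp [pullbackGpd, H.map_d, K.map_d]
  map_c := by apply pullback.hom_ext <;> simp [pullbackGpd, H.map_c, K.map_c]
  map_e := by apply pullback.hom_ext <;> simp [pullbackGpd, H.map_e, K.map_e]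
  map_m := by
    apply pullback.hom_ext
    · refine Eq.trans ?_ (((pullbackFst F G).map_mul _ _ _).trans
        (mul_congr (f' := pullback.fst X.c X.d ≫ Hom.f₁ H)
          (g' := pullback.snd X.c X.d ≫ Hom.f₁ H) ?_ ?_ _)).symm
      · exact (Category.assoc _ _ _).trans
          ((congrArg (X.m ≫ ·) (pullback.lift_fst _ _ _)).trans H.map_m)
      · exact (Category.assoc _ _ _).trans (congrArg (_ ≫ ·) (pullback.lift_fst _ _ _))
      · exact (Category.assoc _ _ _).trans (congrArg (_ ≫ ·) (pullback.lift_fst _ _ _))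
    · refine Eq.trans ?_ (((pullbackSnd F G).map_mul _ _ _).trans
        (mul_congr (f' := pullback.fst X.c X.d ≫ Hom.f₁ K)
          (g' := pullback.snd X.c X.d ≫ Hom.f₁ K) ?_ ?_ _)).symm
      · exact (Category.assoc _ _ _).trans
          ((congrArg (X.m ≫ ·) (pullback.lift_snd _ _ _)).trans K.map_m)
      · exact (Category.assoc _ _ _).trans (congrArg (_ ≫ ·) (pullback.lift_snd _ _ _))
      · exact (Category.assoc _ _ _).trans (congrArg (_ ≫ ·) (pullback.lift_snd _ _ _))

theorem pullbackGpd_isPullback : IsPullback (pullbackFst F G) (pullbackSnd F G) F G where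
  w := pullback_w F G
  isLimit' := ⟨PullbackCone.IsLimit.mk _ (fun s => pullbackLift s.fst s.snd s.condition)
    (fun _ => hom_ext (pullback.lift_fst _ _ _) (pullback.lift_fst _ _ _))
    (fun _ => hom_ext (pullback.lift_snd _ _ _) (pullback.lift_snd _ _ _))
    (fun _ _ h₁ h₂ => hom_ext
      (pullback.hom_ext
        ((congrArg Hom.f₀ h₁).trans (pullback.lift_fst _ _ _).symm)
        ((congrArg Hom.f₀ h₂).trans (pullback.lift_snd _ _ _).symm))
      (pullback.hom_ext
        ((congrArg Hom.f₁ h₁).trans (pullback.lift_fst _ _ _).symm)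
        ((congrArg Hom.f₁ h₂).trans (pullback.lift_snd _ _ _).symm)))⟩

end Pullback

instance : HasPullbacks (IntGpd E) :=
  have : ∀ {A B C : IntGpd E} {F : A ⟶ C} {G : B ⟶ C}, HasLimit (cospan F G) :=
    fun {_ _ _ F G} => (pullbackGpd_isPullback F G).hasPullback
  hasPullbacks_of_hasLimit_cospan (IntGpd E)

instance : HasFiniteLimits (IntGpd E) :=
  hasFiniteLimits_of_hasTerminal_and_pullbacks

end IntGpd
/-! ### Bicategories with prescribed homs, identities and composition -/

section HomBicategory

universe u₁ u₂ v₂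

/-- The remaining structure of a bicategory with objects `O`, when the hom categories `H a b`, the
identity 1-cells `one a` and the composition `comp f g` of 1-cells (first `f`, then `g`) are
given. The fields are those of `CategoryTheory.Bicategory`. -/
structure HomBicategory (O : Type u₁) (H : O → O → Type u₂) [∀ a b, Category.{v₂} (H a b)]
    (one : ∀ a, H a a) (comp : ∀ {a b c : O}, H a b → H b c → H a c) where
  /-- left whiskering -/
  whiskerLeft : ∀ {a b c : O} (f : H a b) {g h : H b c} (_ : g ⟶ h), comp f g ⟶ comp f h
  /-- right whiskering -/
  whiskerRight : ∀ {a b c : O} {f g : H a b} (_ : f ⟶ g) (h : H b c), comp f h ⟶ comp g h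
  /-- associator -/
  associator : ∀ {a b c d : O} (f : H a b) (g : H b c) (h : H c d),
    comp (comp f g) h ≅ comp f (comp g h)
  /-- left unitor -/
  leftUnitor : ∀ {a b : O} (f : H a b), comp (one a) f ≅ f
  /-- right unitor -/
  rightUnitor : ∀ {a b : O} (f : H a b), comp f (one b) ≅ f
  whiskerLeft_id : ∀ {a b c : O} (f : H a b) (g : H b c), whiskerLeft f (𝟙 g) = 𝟙 (comp f g)
  whiskerLeft_comp : ∀ {a b c : O} (f : H a b) {g h i : H b c} (η : g ⟶ h) (θ : h ⟶ i),
    whiskerLeft f (η ≫ θ) = whiskerLeft f η ≫ whiskerLeft f θ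
  id_whiskerLeft : ∀ {a b : O} {f g : H a b} (η : f ⟶ g),
    whiskerLeft (one a) η = (leftUnitor f).hom ≫ η ≫ (leftUnitor g).inv
  comp_whiskerLeft : ∀ {a b c d : O} (f : H a b) (g : H b c) {h h' : H c d} (η : h ⟶ h'),
    whiskerLeft (comp f g) η =
      (associator f g h).hom ≫ whiskerLeft f (whiskerLeft g η) ≫ (associator f g h').inv
  id_whiskerRight : ∀ {a b c : O} (f : H a b) (g : H b c), whiskerRight (𝟙 f) g = 𝟙 (comp f g)
  comp_whiskerRight : ∀ {a b c : O} {f g h : H a b} (η : f ⟶ g) (θ : g ⟶ h) (i : H b c),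
    whiskerRight (η ≫ θ) i = whiskerRight η i ≫ whiskerRight θ i
  whiskerRight_id : ∀ {a b : O} {f g : H a b} (η : f ⟶ g),
    whiskerRight η (one b) = (rightUnitor f).hom ≫ η ≫ (rightUnitor g).inv
  whiskerRight_comp : ∀ {a b c d : O} {f f' : H a b} (η : f ⟶ f') (g : H b c) (h : H c d),
    whiskerRight η (comp g h) =
      (associator f g h).inv ≫ whiskerRight (whiskerRight η g) h ≫ (associator f' g h).hom
  whisker_assoc : ∀ {a b c d : O} (f : H a b) {g g' : H b c} (η : g ⟶ g') (h : H c d),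
    whiskerRight (whiskerLeft f η) h =
      (associator f g h).hom ≫ whiskerLeft f (whiskerRight η h) ≫ (associator f g' h).inv
  whisker_exchange : ∀ {a b c : O} {f g : H a b} {h i : H b c} (η : f ⟶ g) (θ : h ⟶ i),
    whiskerLeft f θ ≫ whiskerRight η i = whiskerRight η h ≫ whiskerLeft g θ
  pentagon : ∀ {a b c d e : O} (f : H a b) (g : H b c) (h : H c d) (i : H d e),
    whiskerRight (associator f g h).hom i ≫
        (associator f (comp g h) i).hom ≫ whiskerLeft f (associator g h i).hom =
      (associator (comp f g) h i).hom ≫ (associator f g (comp h i)).hom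
  triangle : ∀ {a b c : O} (f : H a b) (g : H b c),
    (associator f (one b) g).hom ≫ whiskerLeft f (leftUnitor g).hom =
      whiskerRight (rightUnitor f).hom g

variable {O : Type u₁} {H : O → O → Type u₂} [∀ a b, Category.{v₂} (H a b)]
  {one : ∀ a, H a a} {comp : ∀ {a b c : O}, H a b → H b c → H a c}

/-- The objects of a bicategory with prescribed homs. -/
def HomBicategory.Obj (_ : HomBicategory O H one comp) : Type u₁ := O

/-- The bicategory with prescribed homs, as a bicategory in the sense of Mathlib. -/
instance HomBicategory.bicategory (𝓑 : HomBicategory O H one comp) : Bicategory 𝓑.Obj where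
  Hom := H
  id := one
  comp := comp
  homCategory := fun (a b : O) => (inferInstance : Category.{v₂} (H a b))
  whiskerLeft := @HomBicategory.whiskerLeft O H _ one comp 𝓑
  whiskerRight := @HomBicategory.whiskerRight O H _ one comp 𝓑
  associator := @HomBicategory.associator O H _ one comp 𝓑
  leftUnitor := @HomBicategory.leftUnitor O H _ one comp 𝓑
  rightUnitor := @HomBicategory.rightUnitor O H _ one comp 𝓑
  whiskerLeft_id := 𝓑.whiskerLeft_id
  whiskerLeft_comp := 𝓑.whiskerLeft_comp
  id_whiskerLeft := 𝓑.id_whiskerLeft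
  comp_whiskerLeft := 𝓑.comp_whiskerLeft
  id_whiskerRight := 𝓑.id_whiskerRight
  comp_whiskerRight := 𝓑.comp_whiskerRight
  whiskerRight_id := 𝓑.whiskerRight_id
  whiskerRight_comp := 𝓑.whiskerRight_comp
  whisker_assoc := 𝓑.whisker_assoc
  whisker_exchange := 𝓑.whisker_exchange
  pentagon := 𝓑.pentagon
  triangle := 𝓑.triangle

universe u₃ v₃

variable {H' : O → O → Type u₃} [∀ a b, Category.{v₃} (H' a b)]
  {one' : ∀ a, H' a a} {comp' : ∀ {a b c : O}, H' a b → H' b c → H' a c}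

/-- A lax functor between bicategories with the same objects that is the identity on objects and
whose action on the hom categories is the given family of functors `F`. The fields are those of
`CategoryTheory.LaxFunctor`. -/
structure HomLaxFunctor (𝓑 : HomBicategory O H one comp) (𝓑' : HomBicategory O H' one' comp')
    (F : ∀ a b, H a b ⥤ H' a b) where
  /-- the lax unity constraint -/
  mapId : ∀ a : O, one' a ⟶ (F a a).obj (one a)
  /-- the lax functoriality constraint -/
  mapComp : ∀ {a b c : O} (f : H a b) (g : H b c),
    comp' ((F a b).obj f) ((F b c).obj g) ⟶ (F a c).obj (comp f g)
  mapComp_naturality_left : ∀ {a b c : O} {f f' : H a b} (η : f ⟶ f') (g : H b c),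
    mapComp f g ≫ (F a c).map (𝓑.whiskerRight η g) =
      𝓑'.whiskerRight ((F a b).map η) ((F b c).obj g) ≫ mapComp f' g
  mapComp_naturality_right : ∀ {a b c : O} (f : H a b) {g g' : H b c} (η : g ⟶ g'),
    mapComp f g ≫ (F a c).map (𝓑.whiskerLeft f η) =
      𝓑'.whiskerLeft ((F a b).obj f) ((F b c).map η) ≫ mapComp f g'
  map₂_associator : ∀ {a b c d : O} (f : H a b) (g : H b c) (h : H c d),
    𝓑'.whiskerRight (mapComp f g) ((F c d).obj h) ≫ mapComp (comp f g) h ≫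
        (F a d).map (𝓑.associator f g h).hom =
      (𝓑'.associator ((F a b).obj f) ((F b c).obj g) ((F c d).obj h)).hom ≫
        𝓑'.whiskerLeft ((F a b).obj f) (mapComp g h) ≫ mapComp f (comp g h)
  map₂_leftUnitor : ∀ {a b : O} (f : H a b),
    (F a b).map (𝓑.leftUnitor f).inv =
      (𝓑'.leftUnitor ((F a b).obj f)).inv ≫
        𝓑'.whiskerRight (mapId a) ((F a b).obj f) ≫ mapComp (one a) f
  map₂_rightUnitor : ∀ {a b : O} (f : H a b),
    (F a b).map (𝓑.rightUnitor f).inv =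
      (𝓑'.rightUnitor ((F a b).obj f)).inv ≫
        𝓑'.whiskerLeft ((F a b).obj f) (mapId b) ≫ mapComp f (one b)

/-- The associated lax functor in the sense of Mathlib. -/
def HomLaxFunctor.toLaxFunctor {𝓑 : HomBicategory O H one comp}
    {𝓑' : HomBicategory O H' one' comp'} {F : ∀ a b, H a b ⥤ H' a b}
    (Φ : HomLaxFunctor 𝓑 𝓑' F) : LaxFunctor 𝓑.Obj 𝓑'.Obj where
  obj := fun (a : O) => (a : O)
  map := @fun (a b : O) (f : H a b) => (F a b).obj f
  map₂ := @fun (a b : O) (f g : H a b) (η : f ⟶ g) => (F a b).map η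
  map₂_id := @fun (a b : O) (f : H a b) => (F a b).map_id f
  map₂_comp := @fun (a b : O) (f g h : H a b) (η : f ⟶ g) (θ : g ⟶ h) => (F a b).map_comp η θ
  mapId := Φ.mapId
  mapComp := Φ.mapComp
  mapComp_naturality_left := Φ.mapComp_naturality_left
  mapComp_naturality_right := Φ.mapComp_naturality_right
  map₂_associator := Φ.map₂_associator
  map₂_leftUnitor := Φ.map₂_leftUnitor
  map₂_rightUnitor := Φ.map₂_rightUnitor

/-- A lax functor with invertible constraints, i.e. a pseudofunctor. -/
structure HomLaxFunctor.IsPseudo {𝓑 : HomBicategory O H one comp}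
    {𝓑' : HomBicategory O H' one' comp'} {F : ∀ a b, H a b ⥤ H' a b}
    (Φ : HomLaxFunctor 𝓑 𝓑' F) : Prop where
  isIso_mapId : ∀ a : O, IsIso (Φ.mapId a)
  isIso_mapComp : ∀ {a b c : O} (f : H a b) (g : H b c), IsIso (Φ.mapComp f g)

/-- A pseudofunctor in the sense of Mathlib from invertible constraints. -/
noncomputable def HomLaxFunctor.toPseudofunctor {𝓑 : HomBicategory O H one comp}
    {𝓑' : HomBicategory O H' one' comp'} {F : ∀ a b, H a b ⥤ H' a b}
    (Φ : HomLaxFunctor 𝓑 𝓑' F) (h : Φ.IsPseudo) : Pseudofunctor 𝓑.Obj 𝓑'.Obj :=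
  haveI : ∀ a, IsIso (Φ.toLaxFunctor.mapId a) := h.isIso_mapId
  haveI : ∀ {a b c : 𝓑.Obj} (f : a ⟶ b) (g : b ⟶ c), IsIso (Φ.toLaxFunctor.mapComp f g) :=
    h.isIso_mapComp
  Pseudofunctor.mkOfLax' Φ.toLaxFunctor

end HomBicategory

/-! ### Spans and relations relative to a factorization system -/

section Relations

variable {C : Type u} [Category.{v} C]

/-- `e` is left orthogonal to `m`: every commutative square from `e` to `m` has a unique diagonal
filler. -/
def IsLeftOrthogonal {A B X Y : C} (e : A ⟶ B) (m : X ⟶ Y) : Prop :=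
  ∀ (f : A ⟶ X) (g : B ⟶ Y), f ≫ m = e ≫ g → ∃! k : B ⟶ X, e ≫ k = f ∧ k ≫ m = g

/-- An orthogonal factorization system `(L, R)` on a category. -/
structure IsOrthogonalFactorizationSystem (L R : MorphismProperty C) : Prop where
  iso_left : MorphismProperty.isomorphisms C ≤ L
  iso_right : MorphismProperty.isomorphisms C ≤ R
  comp_left : ∀ {X Y Z : C} (f : X ⟶ Y) (g : Y ⟶ Z), L f → L g → L (f ≫ g)
  comp_right : ∀ {X Y Z : C} (f : X ⟶ Y) (g : Y ⟶ Z), R f → R g → R (f ≫ g)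
  factorization : L.HasFactorization R
  orthogonal : ∀ {A B X Y : C} (e : A ⟶ B) (m : X ⟶ Y), L e → R m → IsLeftOrthogonal e m

/-- The category of spans from `A` to `B` in `C`. -/
abbrev Spans (A B : C) : Type (max u v) :=
  Span (⊤ : MorphismProperty C) (⊤ : MorphismProperty C) A B

namespace Spans

variable [HasPullbacks C] {A B D A' : C}

/-- The identity span. -/
def one (A : C) : Spans A A := Span.id A

/-- The composite of two spans, through the pullback. -/
noncomputable def comp (S : Spans A B) (T : Spans B D) : Spans A D := Span.comp S T

/-! Composites of spans are computed by pullback; `p₁` and `p₂` are the pullback projections. -/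

/-- First projection from the apex of a composite span. -/
noncomputable def p₁ (S : Spans A B) (T : Spans B D) : (comp S T).apex ⟶ S.apex :=
  pullback.fst S.r T.l

/-- Second projection from the apex of a composite span. -/
noncomputable def p₂ (S : Spans A B) (T : Spans B D) : (comp S T).apex ⟶ T.apex :=
  pullback.snd S.r T.l

theorem p_condition (S : Spans A B) (T : Spans B D) : p₁ S T ≫ S.r = p₂ S T ≫ T.l :=
  pullback.condition

/-- The morphism into the apex of a composite span determined by a compatible pair. -/
noncomputable def pair {S : Spans A B} {T : Spans B D} {X : C} (a : X ⟶ S.apex) (b : X ⟶ T.apex)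
    (h : a ≫ S.r = b ≫ T.l) : X ⟶ (comp S T).apex :=
  pullback.lift a b h

@[simp] theorem pair_p₁ {S : Spans A B} {T : Spans B D} {X : C} (a : X ⟶ S.apex) (b : X ⟶ T.apex)
    (h : a ≫ S.r = b ≫ T.l) : pair a b h ≫ p₁ S T = a :=
  pullback.lift_fst _ _ _

@[simp] theorem pair_p₂ {S : Spans A B} {T : Spans B D} {X : C} (a : X ⟶ S.apex) (b : X ⟶ T.apex)
    (h : a ≫ S.r = b ≫ T.l) : pair a b h ≫ p₂ S T = b :=
  pullback.lift_snd _ _ _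

@[simp] theorem pair_p₁_assoc {S : Spans A B} {T : Spans B D} {X Y : C} (a : X ⟶ S.apex)
    (b : X ⟶ T.apex) (h : a ≫ S.r = b ≫ T.l) (k : S.apex ⟶ Y) :
    pair a b h ≫ p₁ S T ≫ k = a ≫ k := by
  rw [← Category.assoc, pair_p₁]

@[simp] theorem pair_p₂_assoc {S : Spans A B} {T : Spans B D} {X Y : C} (a : X ⟶ S.apex)
    (b : X ⟶ T.apex) (h : a ≫ S.r = b ≫ T.l) (k : T.apex ⟶ Y) :
    pair a b h ≫ p₂ S T ≫ k = b ≫ k := by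
  rw [← Category.assoc, pair_p₂]

theorem apex_hom_ext {S : Spans A B} {T : Spans B D} {X : C} {f g : X ⟶ (comp S T).apex}
    (h₁ : f ≫ p₁ S T = g ≫ p₁ S T) (h₂ : f ≫ p₂ S T = g ≫ p₂ S T) : f = g :=
  pullback.hom_ext h₁ h₂

theorem comp_l (S : Spans A B) (T : Spans B D) : (comp S T).l = p₁ S T ≫ S.l := rfl

theorem comp_r (S : Spans A B) (T : Spans B D) : (comp S T).r = p₂ S T ≫ T.r := rfl

/-- The action of span composition on a morphism in the right variable. -/
noncomputable def whiskerL (S : Spans A B) {T T' : Spans B D} (η : T ⟶ T') :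
    comp S T ⟶ comp S T' where
  hom := pair (p₁ S T) (p₂ S T ≫ η.hom) (by rw [Category.assoc, η.hom_l, p_condition])
  hom_l := by simp [comp_l]
  hom_r := by simp [comp_r]

/-- The action of span composition on a morphism in the left variable. -/
noncomputable def whiskerR {S S' : Spans A B} (η : S ⟶ S') (T : Spans B D) :
    comp S T ⟶ comp S' T where
  hom := pair (p₁ S T ≫ η.hom) (p₂ S T) (by rw [Category.assoc, η.hom_r, p_condition])
  hom_l := by simp [comp_l]
  hom_r := by simp [comp_r]

/-- The canonical comparison `(S ◇ T) ◇ U ≅ S ◇ (T ◇ U)`. -/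
noncomputable def assoc (S : Spans A B) (T : Spans B D) (U : Spans D A') :
    comp (comp S T) U ≅ comp S (T.comp U) where
  hom :=
    { hom := pair (p₁ (comp S T) U ≫ p₁ S T)
        (pair (p₁ (comp S T) U ≫ p₂ S T) (p₂ (comp S T) U)
          (by rw [Category.assoc, ← comp_r, p_condition]))
        (by simp [comp_l, p_condition])
      hom_l := by simp [comp_l]
      hom_r := by simp [comp_r] }
  inv :=
    { hom := pair
        (pair (p₁ S (comp T U)) (p₂ S (comp T U) ≫ p₁ T U)
          (by rw [Category.assoc, ← comp_l, p_condition]))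
        (p₂ S (comp T U) ≫ p₂ T U)
        (by simp [comp_r, p_condition])
      hom_l := by simp [comp_l]
      hom_r := by simp [comp_r] }
  hom_inv_id := by
    ext1
    apply apex_hom_ext
    · apply apex_hom_ext <;> simp
    · simp
  inv_hom_id := by
    ext1
    apply apex_hom_ext
    · simp
    · apply apex_hom_ext <;> simp

theorem one_condition (S : Spans A B) : p₁ (one A) S = p₂ (one A) S ≫ S.l :=
  (Category.comp_id _).symm.trans (p_condition (one A) S)

theorem condition_one (S : Spans A B) : p₁ S (one B) ≫ S.r = p₂ S (one B) :=
  (p_condition S (one B)).trans (Category.comp_id _)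

/-- The canonical comparison `1 ◇ S ≅ S`. -/
noncomputable def leftUnitor (S : Spans A B) : comp (one A) S ≅ S where
  hom :=
    { hom := p₂ (one A) S
      hom_l := (one_condition S).symm.trans (Category.comp_id _).symm
      hom_r := rfl }
  inv :=
    { hom := pair (S := one A) S.l (𝟙 _) ((Category.comp_id _).trans (Category.id_comp _).symm)
      hom_l := (pair_p₁_assoc _ _ _ _).trans (Category.comp_id _)
      hom_r := (pair_p₂_assoc _ _ _ _).trans (Category.id_comp _) }
  hom_inv_id := by
    ext1
    apply apex_hom_ext
    · exact (Category.assoc _ _ _).trans ((congrArg (p₂ (one A) S ≫ ·) (pair_p₁ _ _ _)).trans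
        ((one_condition S).symm.trans (Category.id_comp _).symm))
    · exact (Category.assoc _ _ _).trans ((congrArg (p₂ (one A) S ≫ ·) (pair_p₂ _ _ _)).trans
        ((Category.comp_id _).trans (Category.id_comp _).symm))
  inv_hom_id := by
    ext1
    exact pair_p₂ _ _ _

/-- The canonical comparison `S ◇ 1 ≅ S`. -/
noncomputable def rightUnitor (S : Spans A B) : comp S (one B) ≅ S where
  hom :=
    { hom := p₁ S (one B)
      hom_l := rfl
      hom_r := (condition_one S).trans (Category.comp_id _).symm }
  inv :=
    { hom := pair (T := one B) (𝟙 _) S.r ((Category.id_comp _).trans (Category.comp_id _).symm)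
      hom_l := (pair_p₁_assoc _ _ _ _).trans (Category.id_comp _)
      hom_r := (pair_p₂_assoc _ _ _ _).trans (Category.comp_id _) }
  hom_inv_id := by
    ext1
    apply apex_hom_ext
    · exact (Category.assoc _ _ _).trans ((congrArg (p₁ S (one B) ≫ ·) (pair_p₁ _ _ _)).trans
        ((Category.comp_id _).trans (Category.id_comp _).symm))
    · exact (Category.assoc _ _ _).trans ((congrArg (p₁ S (one B) ≫ ·) (pair_p₂ _ _ _)).trans
        ((condition_one S).trans (Category.id_comp _).symm))
  inv_hom_id := by
    ext1
    exact pair_p₁ _ _ _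

end Spans

variable (C) in
/-- The bicategory of spans in `C`. -/
noncomputable def spanBicategory [HasPullbacks C] :
    HomBicategory C (fun A B => Spans A B) Spans.one Spans.comp where
  whiskerLeft S _ _ η := Spans.whiskerL S η
  whiskerRight η T := Spans.whiskerR η T
  associator S T U := Spans.assoc S T U
  leftUnitor S := Spans.leftUnitor S
  rightUnitor S := Spans.rightUnitor S
  whiskerLeft_id S T := by
    ext1; apply Spans.apex_hom_ext <;> simp [Spans.whiskerL]
  whiskerLeft_comp S _ _ _ η θ := by
    ext1; apply Spans.apex_hom_ext <;> simp [Spans.whiskerL]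
  id_whiskerLeft η := by
    rw [← Category.assoc, Iso.eq_comp_inv]
    ext1; simp [Spans.whiskerL, Spans.leftUnitor]
  comp_whiskerLeft S T _ _ η := by
    ext1
    apply Spans.apex_hom_ext
    · apply Spans.apex_hom_ext <;> simp [Spans.whiskerL, Spans.assoc]
    · simp [Spans.whiskerL, Spans.assoc]
  id_whiskerRight S T := by
    ext1; apply Spans.apex_hom_ext <;> simp [Spans.whiskerR]
  comp_whiskerRight η θ T := by
    ext1; apply Spans.apex_hom_ext <;> simp [Spans.whiskerR]
  whiskerRight_id η := by
    rw [← Category.assoc, Iso.eq_comp_inv]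
    ext1; simp [Spans.whiskerR, Spans.rightUnitor]
  whiskerRight_comp η T U := by
    ext1
    apply Spans.apex_hom_ext
    · simp [Spans.whiskerR, Spans.assoc]
    · apply Spans.apex_hom_ext <;> simp [Spans.whiskerR, Spans.assoc]
  whisker_assoc S _ _ η U := by
    ext1
    apply Spans.apex_hom_ext
    · apply Spans.apex_hom_ext <;> simp [Spans.whiskerL, Spans.whiskerR, Spans.assoc]
    · simp [Spans.whiskerL, Spans.whiskerR, Spans.assoc]
  whisker_exchange η θ := by
    ext1; apply Spans.apex_hom_ext <;> simp [Spans.whiskerL, Spans.whiskerR]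
  pentagon S T U V := by
    ext1
    apply Spans.apex_hom_ext
    · simp [Spans.whiskerL, Spans.whiskerR, Spans.assoc]
    · apply Spans.apex_hom_ext
      · simp [Spans.whiskerL, Spans.whiskerR, Spans.assoc]
      · apply Spans.apex_hom_ext <;> simp [Spans.whiskerL, Spans.whiskerR, Spans.assoc]
  triangle S T := by
    ext1
    apply Spans.apex_hom_ext <;>
      simp [Spans.whiskerL, Spans.whiskerR, Spans.assoc, Spans.leftUnitor, Spans.rightUnitor]

variable [HasPullbacks C] [HasBinaryProducts C] (L R : MorphismProperty C)

/-- A span `A ← X → B` is a relation relative to the class `R` if the induced morphism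
`X ⟶ A ⨯ B` belongs to `R`. -/
def isRelation (A B : C) : ObjectProperty (Spans A B) := fun X => R (prod.lift X.l X.r)

/-- The category of relations from `A` to `B` relative to the class `R`: a full subcategory of the
category of spans. -/
abbrev RelSpan (A B : C) : Type (max u v) := (isRelation R A B).FullSubcategory

/-- The relation associated with a span `X` by factoring `X ⟶ A ⨯ B` as a morphism in `L` followed
by a morphism in `R`. -/
structure SpanReflection {A B : C} (X : Spans A B) where
  /-- the associated relation -/
  rel : RelSpan R A B
  /-- the first part of the factorization -/
  unit : X ⟶ rel.obj
  unit_mem : L unit.hom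

/-- A bicategory of relations in `C` relative to `(L, R)`. Its objects are those of `C`, its hom
categories are the categories of relations, and the identities and the composites are the relations
associated with the identity spans and with the composites of the underlying spans. Its coherence
isomorphisms are induced from those of spans: with the morphisms `X ⟶ r X` as constraints, the
inclusion of relations in spans is a lax functor. -/
structure RelBicategory where
  /-- the relation associated with a span -/
  refl : ∀ {A B : C} (X : Spans A B), SpanReflection L R X
  /-- the bicategory structure -/
  bicat : HomBicategory C (RelSpan R) (fun A => (refl (Spans.one A)).rel)
    (fun S T => (refl (Spans.comp S.obj T.obj)).rel)
  /-- the inclusion in the bicategory of spans -/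
  incl : HomLaxFunctor bicat (spanBicategory C) (fun A B => (isRelation R A B).ι)
  incl_mapId : ∀ A : C, incl.mapId A = (refl (Spans.one A)).unit
  incl_mapComp : ∀ {A B D : C} (S : RelSpan R A B) (T : RelSpan R B D),
    incl.mapComp S T = (refl (Spans.comp S.obj T.obj)).unit

end Relations

/-! ### Internal distributors -/

section Distributors

variable {E : Type u} [Category.{v} E] [HasFiniteLimits E]

/-- An internal distributor between internal groupoids, from `A` to `B`. A generalized element of
`S₀` is thought of as an arrow from an object of `B` (its image under `R`) to an object of `A` (its
image under `L`), on which the arrows of `A` act by postcomposition and those of `B` by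
precomposition. Associativity and compatibility are stated on generalized elements. -/
structure IntDist (A B : IntGpd E) where
  /-- the apex of the underlying span -/
  S₀ : E
  /-- the left leg -/
  L : S₀ ⟶ A.obj
  /-- the right leg -/
  R : S₀ ⟶ B.obj
  /-- the left action `(α, s) ↦ α · s` -/
  lam : pullback A.d L ⟶ S₀
  /-- the right action `(s, β) ↦ s · β` -/
  rho : pullback R B.c ⟶ S₀
  lam_L : lam ≫ L = pullback.fst A.d L ≫ A.c
  lam_R : lam ≫ R = pullback.snd A.d L ≫ R
  rho_L : rho ≫ L = pullback.fst R B.c ≫ L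
  rho_R : rho ≫ R = pullback.snd R B.c ≫ B.d
  lam_one : pullback.lift (L ≫ A.e) (𝟙 S₀) (by simp [A.e_d]) ≫ lam = 𝟙 S₀
  rho_one : pullback.lift (𝟙 S₀) (R ≫ B.e) (by simp [B.e_c]) ≫ rho = 𝟙 S₀
  lam_mul : ∀ {X : E} (α α' : X ⟶ A.arr) (s : X ⟶ S₀) (h : α ≫ A.c = α' ≫ A.d)
    (hs : α ≫ A.d = s ≫ L),
    pullback.lift (A.mul α α' h) s (by rw [IntGpd.mul_d, hs]) ≫ lam =
      pullback.lift α' (pullback.lift α s hs ≫ lam) (by simp [lam_L, h]) ≫ lam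
  rho_mul : ∀ {X : E} (s : X ⟶ S₀) (β' β : X ⟶ B.arr) (h : β' ≫ B.c = β ≫ B.d)
    (hs : s ≫ R = β ≫ B.c),
    pullback.lift s (B.mul β' β h) (by rw [IntGpd.mul_c, hs]) ≫ rho =
      pullback.lift (pullback.lift s β hs ≫ rho) β' (by simp [rho_R, h]) ≫ rho
  lam_rho : ∀ {X : E} (α : X ⟶ A.arr) (s : X ⟶ S₀) (β : X ⟶ B.arr) (hα : α ≫ A.d = s ≫ L)
    (hβ : s ≫ R = β ≫ B.c),
    pullback.lift (pullback.lift α s hα ≫ lam) β (by simp [lam_R, hβ]) ≫ rho =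
      pullback.lift α (pullback.lift s β hβ ≫ rho) (by simp [rho_L, hα]) ≫ lam

namespace IntDist

variable {A B C D : IntGpd E}

/-- The left action on generalized elements. -/
noncomputable def lact (S : IntDist A B) {X : E} (α : X ⟶ A.arr) (s : X ⟶ S.S₀)
    (h : α ≫ A.d = s ≫ S.L) : X ⟶ S.S₀ :=
  pullback.lift α s h ≫ S.lam

/-- The right action on generalized elements. -/
noncomputable def ract (S : IntDist A B) {X : E} (s : X ⟶ S.S₀) (β : X ⟶ B.arr)
    (h : s ≫ S.R = β ≫ B.c) : X ⟶ S.S₀ :=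
  pullback.lift s β h ≫ S.rho

section Actions

variable {S : IntDist A B} {X : E}

theorem lact_L {α : X ⟶ A.arr} {s : X ⟶ S.S₀} (h : α ≫ A.d = s ≫ S.L) :
    S.lact α s h ≫ S.L = α ≫ A.c := by simp [lact, S.lam_L]

theorem lact_R {α : X ⟶ A.arr} {s : X ⟶ S.S₀} (h : α ≫ A.d = s ≫ S.L) :
    S.lact α s h ≫ S.R = s ≫ S.R := by simp [lact, S.lam_R]

theorem ract_L {s : X ⟶ S.S₀} {β : X ⟶ B.arr} (h : s ≫ S.R = β ≫ B.c) :
    S.ract s β h ≫ S.L = s ≫ S.L := by simp [ract, S.rho_L]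

theorem ract_R {s : X ⟶ S.S₀} {β : X ⟶ B.arr} (h : s ≫ S.R = β ≫ B.c) :
    S.ract s β h ≫ S.R = β ≫ B.d := by simp [ract, S.rho_R]

theorem comp_lact {Y : E} (k : Y ⟶ X) {α : X ⟶ A.arr} {s : X ⟶ S.S₀}
    (h : α ≫ A.d = s ≫ S.L) :
    k ≫ S.lact α s h = S.lact (k ≫ α) (k ≫ s) (by simp [h]) := by
  rw [lact, lact, ← Category.assoc, IntGpd.comp_lift]

theorem comp_ract {Y : E} (k : Y ⟶ X) {s : X ⟶ S.S₀} {β : X ⟶ B.arr}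
    (h : s ≫ S.R = β ≫ B.c) :
    k ≫ S.ract s β h = S.ract (k ≫ s) (k ≫ β) (by simp [h]) := by
  rw [ract, ract, ← Category.assoc, IntGpd.comp_lift]

theorem lact_congr {α α' : X ⟶ A.arr} {s s' : X ⟶ S.S₀} (hα : α = α') (hs : s = s')
    (h : α ≫ A.d = s ≫ S.L) : S.lact α s h = S.lact α' s' (by rw [← hα, ← hs, h]) := by
  subst hα hs; rfl

theorem ract_congr {s s' : X ⟶ S.S₀} {β β' : X ⟶ B.arr} (hs : s = s') (hβ : β = β')
    (h : s ≫ S.R = β ≫ B.c) : S.ract s β h = S.ract s' β' (by rw [← hβ, ← hs, h]) := by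
  subst hβ hs; rfl

theorem one_lact (s : X ⟶ S.S₀) (x : X ⟶ A.obj) (hx : x = s ≫ S.L) :
    S.lact (x ≫ A.e) s (by simp [A.e_d, hx]) = s := by
  subst hx
  have := congrArg (fun k => s ≫ k) S.lam_one
  simp only [Category.comp_id] at this
  refine Eq.trans ?_ this
  rw [← Category.assoc s (pullback.lift _ _ _), IntGpd.comp_lift, lact]
  congr 1
  apply IntGpd.lift_congr <;> simp

theorem ract_one (s : X ⟶ S.S₀) (x : X ⟶ B.obj) (hx : x = s ≫ S.R) :
    S.ract s (x ≫ B.e) (by simp [B.e_c, hx]) = s := by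
  subst hx
  have := congrArg (fun k => s ≫ k) S.rho_one
  simp only [Category.comp_id] at this
  refine Eq.trans ?_ this
  rw [← Category.assoc s (pullback.lift _ _ _), IntGpd.comp_lift, ract]
  congr 1
  apply IntGpd.lift_congr <;> simp

theorem mul_lact (α α' : X ⟶ A.arr) (s : X ⟶ S.S₀) (h : α ≫ A.c = α' ≫ A.d)
    (hs : α ≫ A.d = s ≫ S.L) :
    S.lact (A.mul α α' h) s (by rw [IntGpd.mul_d, hs]) =
      S.lact α' (S.lact α s hs) (by rw [lact_L, h]) :=
  S.lam_mul α α' s h hs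

theorem ract_mul (s : X ⟶ S.S₀) (β' β : X ⟶ B.arr) (h : β' ≫ B.c = β ≫ B.d)
    (hs : s ≫ S.R = β ≫ B.c) :
    S.ract s (B.mul β' β h) (by rw [IntGpd.mul_c, hs]) =
      S.ract (S.ract s β hs) β' (by rw [ract_R, h]) :=
  S.rho_mul s β' β h hs

theorem lact_ract (α : X ⟶ A.arr) (s : X ⟶ S.S₀) (β : X ⟶ B.arr) (hα : α ≫ A.d = s ≫ S.L)
    (hβ : s ≫ S.R = β ≫ B.c) :
    S.ract (S.lact α s hα) β (by rw [lact_R, hβ]) =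
      S.lact α (S.ract s β hβ) (by rw [ract_L, hα]) :=
  S.lam_rho α s β hα hβ

end Actions

/-- A morphism of internal distributors: an equivariant morphism of spans. -/
@[ext]
structure Hom (S T : IntDist A B) where
  /-- the underlying morphism -/
  f : S.S₀ ⟶ T.S₀
  f_L : f ≫ T.L = S.L
  f_R : f ≫ T.R = S.R
  map_lam : S.lam ≫ f = T.lact (pullback.fst A.d S.L) (pullback.snd A.d S.L ≫ f)
    (by rw [Category.assoc, f_L, pullback.condition])
  map_rho : S.rho ≫ f = T.ract (pullback.fst S.R B.c ≫ f) (pullback.snd S.R B.c)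
    (by rw [Category.assoc, f_R, pullback.condition])

theorem Hom.map_lact {S T : IntDist A B} (F : Hom S T) {X : E} (α : X ⟶ A.arr) (s : X ⟶ S.S₀)
    (h : α ≫ A.d = s ≫ S.L) :
    S.lact α s h ≫ F.f = T.lact α (s ≫ F.f) (by rw [Category.assoc, F.f_L, h]) := by
  rw [lact, Category.assoc, F.map_lam, comp_lact]
  apply lact_congr <;> simp

theorem Hom.map_ract {S T : IntDist A B} (F : Hom S T) {X : E} (s : X ⟶ S.S₀) (β : X ⟶ B.arr)
    (h : s ≫ S.R = β ≫ B.c) :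
    S.ract s β h ≫ F.f = T.ract (s ≫ F.f) β (by rw [Category.assoc, F.f_R, h]) := by
  rw [ract, Category.assoc, F.map_rho, comp_ract]
  apply ract_congr <;> simp

/-- The category `Dist(A, B)` of internal distributors from `A` to `B`. -/
instance : Category (IntDist A B) where
  Hom := Hom
  id S :=
    { f := 𝟙 _
      f_L := by simp
      f_R := by simp
      map_lam := by
        rw [Category.comp_id, lact]
        refine (Category.id_comp S.lam).symm.trans ?_
        congr 1
        apply pullback.hom_ext <;> simp
      map_rho := by
        rw [Category.comp_id, ract]
        refine (Category.id_comp S.rho).symm.trans ?_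
        congr 1
        apply pullback.hom_ext <;> simp }
  comp F G :=
    { f := F.f ≫ G.f
      f_L := by rw [Category.assoc, G.f_L, F.f_L]
      f_R := by rw [Category.assoc, G.f_R, F.f_R]
      map_lam := by
        rw [← Category.assoc, F.map_lam, G.map_lact]
        apply lact_congr <;> simp
      map_rho := by
        rw [← Category.assoc, F.map_rho, G.map_ract]
        apply ract_congr <;> simp }
  id_comp F := by apply Hom.ext; simp
  comp_id F := by apply Hom.ext; simp
  assoc F G H := by apply Hom.ext; simp

@[simp] theorem id_f (S : IntDist A B) : Hom.f (𝟙 S) = 𝟙 S.S₀ := rfl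
@[simp] theorem comp_f {S T U : IntDist A B} (F : S ⟶ T) (G : T ⟶ U) :
    Hom.f (F ≫ G) = Hom.f F ≫ Hom.f G := rfl

/-- The identity distributor of `A`: the object of arrows of `A`, on which `A` acts by composition
on both sides. -/
noncomputable def one (A : IntGpd E) : IntDist A A where
  S₀ := A.arr
  L := A.c
  R := A.d
  lam := A.mul (pullback.snd A.d A.c) (pullback.fst A.d A.c) pullback.condition.symm
  rho := A.mul (pullback.snd A.d A.c) (pullback.fst A.d A.c) pullback.condition.symm
  lam_L := A.mul_c _ _ _
  lam_R := A.mul_d _ _ _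
  rho_L := A.mul_c _ _ _
  rho_R := A.mul_d _ _ _
  lam_one := by
    rw [IntGpd.comp_mul]
    refine (IntGpd.mul_congr ?_ ?_ _).trans (A.mul_id (𝟙 _) A.c (Category.id_comp _)) <;> simp
  rho_one := by
    rw [IntGpd.comp_mul]
    refine (IntGpd.mul_congr ?_ ?_ _).trans (A.id_mul (𝟙 _) A.d (Category.id_comp _).symm) <;> simp
  lam_mul α α' s h hs := by
    simp only [IntGpd.comp_mul]
    refine (IntGpd.mul_congr ?_ ?_ _).trans ((A.mul_assoc s α α' hs.symm h).symm.trans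
      (IntGpd.mul_congr ?_ ?_ _)) <;> simp
  rho_mul s β' β h hs := by
    simp only [IntGpd.comp_mul]
    refine (IntGpd.mul_congr ?_ ?_ _).trans ((A.mul_assoc β' β s h hs.symm).trans
      (IntGpd.mul_congr ?_ ?_ _)) <;> simp
  lam_rho α s β hα hβ := by
    simp only [IntGpd.comp_mul]
    refine (IntGpd.mul_congr ?_ ?_ _).trans ((A.mul_assoc β s α hβ.symm hα.symm).symm.trans
      (IntGpd.mul_congr ?_ ?_ _)) <;> simp

/-! The internal groupoid determined by a distributor. Its object of arrows is the pullback of the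
two actions: a generalized arrow from `s` to `s'` is given by `α` and `β` with `α · s = s' · β`. -/

section Elements

variable (S : IntDist A B)

/-- The object of arrows of the groupoid determined by a distributor. -/
noncomputable abbrev elArr : E := pullback S.lam S.rho

/-- The component `α` of an arrow. -/
noncomputable def elA : S.elArr ⟶ A.arr := pullback.fst S.lam S.rho ≫ pullback.fst A.d S.L

/-- The domain `s` of an arrow. -/
noncomputable def elDom : S.elArr ⟶ S.S₀ := pullback.fst S.lam S.rho ≫ pullback.snd A.d S.L

/-- The codomain `s'` of an arrow. -/
noncomputable def elCod : S.elArr ⟶ S.S₀ := pullback.snd S.lam S.rho ≫ pullback.fst S.R B.c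

/-- The component `β` of an arrow. -/
noncomputable def elB : S.elArr ⟶ B.arr := pullback.snd S.lam S.rho ≫ pullback.snd S.R B.c

variable {S}

/-- The generalized arrow with given components. -/
noncomputable def elMk {X : E} (α : X ⟶ A.arr) (s s' : X ⟶ S.S₀) (β : X ⟶ B.arr)
    (hα : α ≫ A.d = s ≫ S.L) (hβ : s' ≫ S.R = β ≫ B.c)
    (h : S.lact α s hα = S.ract s' β hβ) : X ⟶ S.elArr :=
  pullback.lift (pullback.lift α s hα) (pullback.lift s' β hβ) h

section

variable {X : E} {α : X ⟶ A.arr} {s s' : X ⟶ S.S₀} {β : X ⟶ B.arr}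
    {hα : α ≫ A.d = s ≫ S.L} {hβ : s' ≫ S.R = β ≫ B.c}
    {h : S.lact α s hα = S.ract s' β hβ}

@[simp] theorem elMk_elA : elMk α s s' β hα hβ h ≫ S.elA = α :=
  (pullback.lift_fst_assoc _ _ _ _).trans (pullback.lift_fst _ _ _)
@[simp] theorem elMk_elDom : elMk α s s' β hα hβ h ≫ S.elDom = s :=
  (pullback.lift_fst_assoc _ _ _ _).trans (pullback.lift_snd _ _ _)
@[simp] theorem elMk_elCod : elMk α s s' β hα hβ h ≫ S.elCod = s' :=
  (pullback.lift_snd_assoc _ _ _ _).trans (pullback.lift_fst _ _ _)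
@[simp] theorem elMk_elB : elMk α s s' β hα hβ h ≫ S.elB = β :=
  (pullback.lift_snd_assoc _ _ _ _).trans (pullback.lift_snd _ _ _)
@[simp] theorem elMk_elA_assoc {Y : E} (k : A.arr ⟶ Y) :
    elMk α s s' β hα hβ h ≫ S.elA ≫ k = α ≫ k := by
  rw [← Category.assoc, elMk_elA]
@[simp] theorem elMk_elDom_assoc {Y : E} (k : S.S₀ ⟶ Y) :
    elMk α s s' β hα hβ h ≫ S.elDom ≫ k = s ≫ k := by
  rw [← Category.assoc, elMk_elDom]
@[simp] theorem elMk_elCod_assoc {Y : E} (k : S.S₀ ⟶ Y) :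
    elMk α s s' β hα hβ h ≫ S.elCod ≫ k = s' ≫ k := by
  rw [← Category.assoc, elMk_elCod]
@[simp] theorem elMk_elB_assoc {Y : E} (k : B.arr ⟶ Y) :
    elMk α s s' β hα hβ h ≫ S.elB ≫ k = β ≫ k := by
  rw [← Category.assoc, elMk_elB]

end

theorem el_hom_ext {X : E} {f g : X ⟶ S.elArr} (h₁ : f ≫ S.elA = g ≫ S.elA)
    (h₂ : f ≫ S.elDom = g ≫ S.elDom) (h₃ : f ≫ S.elCod = g ≫ S.elCod)
    (h₄ : f ≫ S.elB = g ≫ S.elB) : f = g := by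
  apply pullback.hom_ext <;> apply pullback.hom_ext <;>
    simpa [elA, elB, elDom, elCod] using ‹_›

theorem elA_d : S.elA ≫ A.d = S.elDom ≫ S.L := by simp [elA, elDom, pullback.condition]

theorem elCod_R : S.elCod ≫ S.R = S.elB ≫ B.c := by simp [elB, elCod, pullback.condition]

theorem el_lact : S.lact S.elA S.elDom elA_d = S.ract S.elCod S.elB elCod_R := by
  have h₁ : pullback.lift S.elA S.elDom elA_d = pullback.fst S.lam S.rho := by
    apply pullback.hom_ext <;> simp [elA, elDom]
  have h₂ : pullback.lift S.elCod S.elB elCod_R = pullback.snd S.lam S.rho := by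
    apply pullback.hom_ext <;> simp [elB, elCod]
  rw [lact, ract, h₁, h₂, pullback.condition]

theorem elA_c : S.elA ≫ A.c = S.elCod ≫ S.L := by
  rw [← lact_L elA_d, el_lact, ract_L]

theorem elB_d : S.elB ≫ B.d = S.elDom ≫ S.R := by
  rw [← ract_R elCod_R, ← el_lact, lact_R]

theorem el_lact' {X : E} (f : X ⟶ S.elArr) :
    S.lact (f ≫ S.elA) (f ≫ S.elDom) (by rw [Category.assoc, Category.assoc, elA_d]) =
      S.ract (f ≫ S.elCod) (f ≫ S.elB) (by rw [Category.assoc, Category.assoc, elCod_R]) := by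
  rw [← comp_lact f elA_d, ← comp_ract f elCod_R, el_lact]

/-- Composition of generalized arrows. -/
noncomputable def elMul {X : E} (f g : X ⟶ S.elArr) (h : f ≫ S.elCod = g ≫ S.elDom) :
    X ⟶ S.elArr :=
  elMk (A.mul (f ≫ S.elA) (g ≫ S.elA) (by simp [elA_c, elA_d, reassoc_of% h]))
    (f ≫ S.elDom) (g ≫ S.elCod)
    (B.mul (f ≫ S.elB) (g ≫ S.elB)
      (by rw [Category.assoc, Category.assoc, ← elCod_R, elB_d, reassoc_of% h]))
    (by rw [IntGpd.mul_d, Category.assoc, Category.assoc, elA_d])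
    (by rw [IntGpd.mul_c, Category.assoc, Category.assoc, elCod_R])
    (by
      have hf := el_lact' f
      have hg := el_lact' g
      rw [mul_lact (hs := by simp [elA_d]), ract_mul (hs := by simp [elCod_R])]
      refine (lact_congr rfl hf _).trans ?_
      rw [← lact_ract (hα := by simp [elA_d, reassoc_of% h]) (hβ := by simp [elCod_R])]
      refine ract_congr ?_ rfl _
      rw [← hg]
      exact lact_congr rfl h _)

/-- Inversion of generalized arrows. -/
noncomputable def elInv {X : E} (f : X ⟶ S.elArr) : X ⟶ S.elArr :=
  elMk (f ≫ S.elA ≫ A.inv) (f ≫ S.elCod) (f ≫ S.elDom) (f ≫ S.elB ≫ B.inv)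
    (by simp [A.inv_d, elA_c]) (by simp [B.inv_c, elB_d])
    (by
      have h₁ : S.ract (S.lact (f ≫ S.elA ≫ A.inv) (f ≫ S.elCod) (by simp [A.inv_d, elA_c]))
          (f ≫ S.elB) (by rw [lact_R]; simp [elCod_R]) = f ≫ S.elDom := by
        rw [lact_ract (hβ := by simp [elCod_R])]
        refine (lact_congr rfl (el_lact' f).symm _).trans ?_
        rw [← mul_lact (h := by simp [A.inv_d])]
        refine (lact_congr (α' := (f ≫ S.elDom ≫ S.L) ≫ A.e) ?_ rfl _).trans
          (one_lact _ _ (by simp))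
        refine (IntGpd.mul_congr rfl (Category.assoc _ _ _).symm _).trans
          ((A.mul_inv (f ≫ S.elA)).trans ?_)
        simp only [Category.assoc]
        rw [reassoc_of% (elA_d (S := S))]
      refine Eq.trans ?_ (ract_congr h₁ rfl (by rw [ract_R]; simp [B.inv_c]))
      rw [← ract_mul (h := by simp [B.inv_c])]
      refine ((ract_congr (β' := (f ≫ S.elCod ≫ S.R) ≫ B.e) rfl ?_ _).trans
        (ract_one _ _ (by rw [lact_R]; simp))).symm
      refine (IntGpd.mul_congr (Category.assoc _ _ _).symm rfl _).trans
        ((B.inv_mul (f ≫ S.elB)).trans ?_)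
      simp only [Category.assoc]
      rw [reassoc_of% (elCod_R (S := S))])

section

variable {X : E} {f g : X ⟶ S.elArr} {h : f ≫ S.elCod = g ≫ S.elDom}

@[simp] theorem elMul_elA : elMul f g h ≫ S.elA =
    A.mul (f ≫ S.elA) (g ≫ S.elA) (by simp [elA_c, elA_d, reassoc_of% h]) := elMk_elA
@[simp] theorem elMul_elDom : elMul f g h ≫ S.elDom = f ≫ S.elDom := elMk_elDom
@[simp] theorem elMul_elCod : elMul f g h ≫ S.elCod = g ≫ S.elCod := elMk_elCod
@[simp] theorem elMul_elB : elMul f g h ≫ S.elB = B.mul (f ≫ S.elB) (g ≫ S.elB)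
    (by rw [Category.assoc, Category.assoc, ← elCod_R, elB_d, reassoc_of% h]) := elMk_elB
@[simp] theorem elInv_elA : elInv f ≫ S.elA = f ≫ S.elA ≫ A.inv := elMk_elA
@[simp] theorem elInv_elDom : elInv f ≫ S.elDom = f ≫ S.elCod := elMk_elDom
@[simp] theorem elInv_elCod : elInv f ≫ S.elCod = f ≫ S.elDom := elMk_elCod
@[simp] theorem elInv_elB : elInv f ≫ S.elB = f ≫ S.elB ≫ B.inv := elMk_elB

theorem comp_elMul {Y : E} (k : Y ⟶ X) :
    k ≫ elMul f g h = elMul (k ≫ f) (k ≫ g) (by simp [h]) := by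
  apply el_hom_ext <;> simp [IntGpd.comp_mul]

end

variable (S)

/-- The internal groupoid determined by a distributor. -/
noncomputable def elGpd : IntGpd E where
  obj := S.S₀
  arr := S.elArr
  d := S.elDom
  c := S.elCod
  e := elMk (S.L ≫ A.e) (𝟙 _) (𝟙 _) (S.R ≫ B.e) (by simp [A.e_d]) (by simp [B.e_c])
    ((one_lact (𝟙 S.S₀) S.L (by simp)).trans (ract_one (𝟙 S.S₀) S.R (by simp)).symm)
  m := elMul (pullback.fst S.elCod S.elDom) (pullback.snd S.elCod S.elDom) pullback.condition
  inv := elInv (𝟙 _)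
  e_d := by simp
  e_c := by simp
  m_d := by simp
  m_c := by simp
  id_m := by
    rw [comp_elMul]
    apply el_hom_ext
    · rw [elMul_elA]
      refine (IntGpd.mul_congr ?_ ?_ _).trans ((A.id_mul S.elA (S.elDom ≫ S.L) elA_d.symm).trans
        (Category.id_comp _).symm) <;> simp
    · simp
    · simp
    · rw [elMul_elB]
      refine (IntGpd.mul_congr ?_ ?_ _).trans ((B.id_mul S.elB (S.elDom ≫ S.R) elB_d.symm).trans
        (Category.id_comp _).symm) <;> simp
  m_id := by
    rw [comp_elMul]
    apply el_hom_ext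
    · rw [elMul_elA]
      refine (IntGpd.mul_congr ?_ ?_ _).trans ((A.mul_id S.elA (S.elCod ≫ S.L) elA_c).trans
        (Category.id_comp _).symm) <;> simp
    · simp
    · simp
    · rw [elMul_elB]
      refine (IntGpd.mul_congr ?_ ?_ _).trans ((B.mul_id S.elB (S.elCod ≫ S.R) elCod_R.symm).trans
        (Category.id_comp _).symm) <;> simp
  assoc f g h hfg hgh := by
    simp only [comp_elMul]
    apply el_hom_ext
    · simp only [elMul_elA]
      refine (IntGpd.mul_congr ?_ ?_ _).trans ((A.mul_assoc (f ≫ S.elA) (g ≫ S.elA) (h ≫ S.elA)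
        (by simp [elA_c, elA_d, reassoc_of% hfg]) (by simp [elA_c, elA_d, reassoc_of% hgh])).trans
        (IntGpd.mul_congr ?_ ?_ _)) <;> simp
    · simp
    · simp
    · simp only [elMul_elB]
      refine (IntGpd.mul_congr ?_ ?_ _).trans ((B.mul_assoc (f ≫ S.elB) (g ≫ S.elB) (h ≫ S.elB)
        (by simp [← elCod_R, elB_d, reassoc_of% hfg])
        (by simp [← elCod_R, elB_d, reassoc_of% hgh])).trans
        (IntGpd.mul_congr ?_ ?_ _)) <;> simp
  inv_d := by simp
  inv_c := by simp
  inv_m := by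
    rw [comp_elMul]
    apply el_hom_ext
    · rw [elMul_elA]
      refine (IntGpd.mul_congr ?_ ?_ _).trans ((A.inv_mul S.elA).trans ?_)
      · simp
      · simp
      · rw [reassoc_of% (elA_c (S := S))]; simp
    · simp
    · simp
    · rw [elMul_elB]
      refine (IntGpd.mul_congr ?_ ?_ _).trans ((B.inv_mul S.elB).trans ?_)
      · simp
      · simp
      · rw [← reassoc_of% (elCod_R (S := S))]; simp
  m_inv := by
    rw [comp_elMul]
    apply el_hom_ext
    · rw [elMul_elA]
      refine (IntGpd.mul_congr ?_ ?_ _).trans ((A.mul_inv S.elA).trans ?_)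
      · simp
      · simp
      · rw [reassoc_of% (elA_d (S := S))]; simp
    · simp
    · simp
    · rw [elMul_elB]
      refine (IntGpd.mul_congr ?_ ?_ _).trans ((B.mul_inv S.elB).trans ?_)
      · simp
      · simp
      · rw [reassoc_of% (elB_d (S := S))]; simp

/-- The span of internal groupoids determined by a distributor. -/
noncomputable def elSpan : Spans A B where
  apex := S.elGpd
  l :=
    { f₀ := S.L
      f₁ := S.elA
      map_d := elA_d
      map_c := elA_c
      map_e := elMk_elA
      map_m := elMul_elA (h := pullback.condition) }
  r :=
    { f₀ := S.R
      f₁ := S.elB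
      map_d := elB_d
      map_c := elCod_R.symm
      map_e := elMk_elB
      map_m := elMul_elB (h := pullback.condition) }
  wl := trivial
  wr := trivial

end Elements

/-- The action of a morphism of distributors on the object of arrows. -/
noncomputable def elMap {S T : IntDist A B} (F : Hom S T) : S.elArr ⟶ T.elArr :=
  elMk S.elA (S.elDom ≫ F.f) (S.elCod ≫ F.f) S.elB
    (by rw [Category.assoc, F.f_L, elA_d]) (by rw [Category.assoc, F.f_R, elCod_R])
    (by rw [← F.map_lact _ _ elA_d, el_lact, F.map_ract])

section

variable {S T : IntDist A B} (F : Hom S T)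

theorem elMap_elA : elMap F ≫ T.elA = S.elA := elMk_elA
theorem elMap_elDom : elMap F ≫ T.elDom = S.elDom ≫ F.f := elMk_elDom
theorem elMap_elCod : elMap F ≫ T.elCod = S.elCod ≫ F.f := elMk_elCod
theorem elMap_elB : elMap F ≫ T.elB = S.elB := elMk_elB

theorem elMul_elMap {X : E} (f g : X ⟶ S.elArr) (h : f ≫ S.elCod = g ≫ S.elDom) :
    elMul f g h ≫ elMap F = elMul (f ≫ elMap F) (g ≫ elMap F)
      (by simp [elMap_elDom, elMap_elCod, reassoc_of% h]) := by
  apply el_hom_ext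
  · rw [Category.assoc, elMap_elA, elMul_elA, elMul_elA]
    apply IntGpd.mul_congr <;> simp [elMap_elA]
  · refine Eq.trans ?_ elMul_elDom.symm
    rw [Category.assoc, Category.assoc, elMap_elDom, ← Category.assoc, elMul_elDom, Category.assoc]
  · refine Eq.trans ?_ elMul_elCod.symm
    rw [Category.assoc, Category.assoc, elMap_elCod, ← Category.assoc, elMul_elCod, Category.assoc]
  · rw [Category.assoc, elMap_elB, elMul_elB, elMul_elB]
    apply IntGpd.mul_congr <;> simp [elMap_elB]

end

/-- The functor `Dist(A, B) ⥤ Span(A, B)` sending a distributor to the associated span of internal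
groupoids. -/
noncomputable def elements (A B : IntGpd E) : IntDist A B ⥤ Spans A B where
  obj S := S.elSpan
  map {S T} F :=
    { hom :=
        { f₀ := F.f
          f₁ := elMap F
          map_d := elMk_elDom
          map_c := elMk_elCod
          map_e := by
            apply el_hom_ext <;> simp [elGpd, elSpan, elMap, reassoc_of% F.f_L, reassoc_of% F.f_R]
          map_m := by
            refine (elMul_elMap F _ _ pullback.condition).trans ?_
            refine Eq.trans ?_ (comp_elMul (h := pullback.condition) _).symm
            congr 1
            · exact (pullback.lift_fst _ _ _).symm
            · exact (pullback.lift_snd _ _ _).symm }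
      hom_l := IntGpd.hom_ext F.f_L elMk_elA
      hom_r := IntGpd.hom_ext F.f_R elMk_elB }
  map_id S := by
    ext1
    refine IntGpd.hom_ext rfl ?_
    apply el_hom_ext
    · exact (elMap_elA _).trans (Category.id_comp _).symm
    · exact (elMap_elDom _).trans ((Category.comp_id _).trans (Category.id_comp _).symm)
    · exact (elMap_elCod _).trans ((Category.comp_id _).trans (Category.id_comp _).symm)
    · exact (elMap_elB _).trans (Category.id_comp _).symm
  map_comp F G := by
    ext1
    refine IntGpd.hom_ext rfl ?_
    change elMap (F ≫ G) = elMap F ≫ elMap G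
    apply el_hom_ext
    · rw [Category.assoc, elMap_elA, elMap_elA, elMap_elA]
    · rw [Category.assoc, elMap_elDom, elMap_elDom, ← Category.assoc, elMap_elDom, comp_f,
        Category.assoc]
    · rw [Category.assoc, elMap_elCod, elMap_elCod, ← Category.assoc, elMap_elCod, comp_f,
        Category.assoc]
    · rw [Category.assoc, elMap_elB, elMap_elB, elMap_elB]

end IntDist

end Distributors

/-! ### The comprehensive factorization system -/

section Comprehensive

variable (E : Type u) [Category.{v} E] [HasFiniteLimits E]

/-- The class of discrete fibrations: the square of codomain maps is a pullback. -/
def discreteFibration : MorphismProperty (IntGpd E) := fun A B F =>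
  IsPullback (IntGpd.Hom.f₁ F) A.c B.c (IntGpd.Hom.f₀ F)

/-- The class of final functors: those left orthogonal to all discrete fibrations. -/
def final : MorphismProperty (IntGpd E) := fun _ _ F =>
  ∀ ⦃X Y : IntGpd E⦄ (p : X ⟶ Y), discreteFibration E p → IsLeftOrthogonal F p

end Comprehensive

/-! ### Composition of distributors -/

section Composition

variable {E : Type u} [Category.{v} E] [HasFiniteLimits E]

namespace IntDist

variable {A B C D : IntGpd E}

/-- The object of generalized triples `((s, β), t)` such that both `s · β` and `β · t` make
sense. -/
noncomputable abbrev triples (S : IntDist A B) (T : IntDist B C) : E :=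
  pullback (pullback.snd S.R B.c ≫ B.d) T.L

/-- The morphism `((s, β), t) ↦ (s · β, t)`. -/
noncomputable def triplesLeft (S : IntDist A B) (T : IntDist B C) :
    triples S T ⟶ pullback S.R T.L :=
  pullback.lift (pullback.fst _ _ ≫ S.rho) (pullback.snd _ _)
    (by rw [Category.assoc, S.rho_R, pullback.condition])

/-- The morphism `((s, β), t) ↦ (s, β · t)`. -/
noncomputable def triplesRight (S : IntDist A B) (T : IntDist B C) :
    triples S T ⟶ pullback S.R T.L :=
  pullback.lift (pullback.fst _ _ ≫ pullback.fst _ _)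
    (T.lact (pullback.fst _ _ ≫ pullback.snd _ _) (pullback.snd _ _)
      (by rw [Category.assoc, pullback.condition]))
    (by rw [lact_L, Category.assoc, Category.assoc, pullback.condition])

/-- A composite (tensor product) of the distributors `S` from `A` to `B` and `T` from `B` to `C`:
the coequalizer of the two morphisms `((s, β), t) ↦ (s · β, t)` and `((s, β), t) ↦ (s, β · t)`,
with the legs and the actions induced from those of `S` and of `T`. -/
structure Tensor (S : IntDist A B) (T : IntDist B C) where
  /-- the composite distributor -/
  obj : IntDist A C
  /-- the quotient morphism `(s, t) ↦ s ⊗ t` -/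
  q : pullback S.R T.L ⟶ obj.S₀
  w : triplesLeft S T ≫ q = triplesRight S T ≫ q
  /-- the quotient morphism is a coequalizer -/
  isColimit : IsColimit (Cofork.ofπ q w)
  q_L : q ≫ obj.L = pullback.fst S.R T.L ≫ S.L
  q_R : q ≫ obj.R = pullback.snd S.R T.L ≫ T.R
  lact_q : ∀ {X : E} (α : X ⟶ A.arr) (s : X ⟶ S.S₀) (t : X ⟶ T.S₀)
    (h : α ≫ A.d = s ≫ S.L) (hst : s ≫ S.R = t ≫ T.L),
    pullback.lift (S.lact α s h) t (by rw [lact_R, hst]) ≫ q =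
      obj.lact α (pullback.lift s t hst ≫ q) (by simp [q_L, h])
  ract_q : ∀ {X : E} (s : X ⟶ S.S₀) (t : X ⟶ T.S₀) (γ : X ⟶ C.arr)
    (hst : s ≫ S.R = t ≫ T.L) (h : t ≫ T.R = γ ≫ C.c),
    pullback.lift s (T.ract t γ h) (by rw [ract_L, hst]) ≫ q =
      obj.ract (pullback.lift s t hst ≫ q) γ (by simp [q_R, h])

namespace Tensor

variable {S : IntDist A B} {T : IntDist B C}

/-- The generalized element `s ⊗ t` of a composite distributor. -/
noncomputable def tmul (τ : Tensor S T) {X : E} (s : X ⟶ S.S₀) (t : X ⟶ T.S₀)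
    (h : s ≫ S.R = t ≫ T.L) : X ⟶ τ.obj.S₀ :=
  pullback.lift s t h ≫ τ.q

theorem tmul_L (τ : Tensor S T) {X : E} (s : X ⟶ S.S₀) (t : X ⟶ T.S₀)
    (h : s ≫ S.R = t ≫ T.L) : τ.tmul s t h ≫ τ.obj.L = s ≫ S.L := by
  simp [tmul, τ.q_L]

theorem tmul_R (τ : Tensor S T) {X : E} (s : X ⟶ S.S₀) (t : X ⟶ T.S₀)
    (h : s ≫ S.R = t ≫ T.L) : τ.tmul s t h ≫ τ.obj.R = t ≫ T.R := by
  simp [tmul, τ.q_R]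

/-- The morphism `(s, t) ↦ s ⊗ t` on the object of objects of the composite of the spans associated
with `S` and `T`. -/
noncomputable def spanObj (τ : Tensor S T) :
    (Spans.comp S.elSpan T.elSpan).apex.obj ⟶ τ.obj.S₀ :=
  τ.tmul (IntGpd.Hom.f₀ (Spans.p₁ S.elSpan T.elSpan)) (IntGpd.Hom.f₀ (Spans.p₂ S.elSpan T.elSpan))
    (congrArg IntGpd.Hom.f₀ (Spans.p_condition S.elSpan T.elSpan))

end Tensor

end IntDist

variable (E) in
/-- A bicategory of internal distributors between internal groupoids in `E`. The composites of
1-cells are tensor products, and on generalized elements horizontal composition, the associators and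
the unitors are given by `s ⊗ t ↦ η s ⊗ θ t`, `(s ⊗ t) ⊗ u ↦ s ⊗ (t ⊗ u)`, `α ⊗ s ↦ α · s` and
`s ⊗ β ↦ s · β`. -/
structure DistBicategory where
  /-- composites of distributors -/
  tensor : ∀ {A B C : IntGpd E} (S : IntDist A B) (T : IntDist B C), IntDist.Tensor S T
  /-- the bicategory structure -/
  bicat : HomBicategory (IntGpd E) (fun A B => IntDist A B) IntDist.one
    (fun S T => (tensor S T).obj)
  whiskerLeft_tmul : ∀ {A B C : IntGpd E} (S : IntDist A B) {T T' : IntDist B C} (η : T ⟶ T')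
    {X : E} (s : X ⟶ S.S₀) (t : X ⟶ T.S₀) (h : s ≫ S.R = t ≫ T.L),
    (tensor S T).tmul s t h ≫ IntDist.Hom.f (bicat.whiskerLeft S η) =
      (tensor S T').tmul s (t ≫ IntDist.Hom.f η) (by rw [Category.assoc, η.f_L, h])
  whiskerRight_tmul : ∀ {A B C : IntGpd E} {S S' : IntDist A B} (η : S ⟶ S') (T : IntDist B C)
    {X : E} (s : X ⟶ S.S₀) (t : X ⟶ T.S₀) (h : s ≫ S.R = t ≫ T.L),
    (tensor S T).tmul s t h ≫ IntDist.Hom.f (bicat.whiskerRight η T) =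
      (tensor S' T).tmul (s ≫ IntDist.Hom.f η) t (by rw [Category.assoc, η.f_R, h])
  associator_tmul : ∀ {A B C D : IntGpd E} (S : IntDist A B) (T : IntDist B C) (U : IntDist C D)
    {X : E} (s : X ⟶ S.S₀) (t : X ⟶ T.S₀) (u : X ⟶ U.S₀) (hst : s ≫ S.R = t ≫ T.L)
    (htu : t ≫ T.R = u ≫ U.L),
    (tensor (tensor S T).obj U).tmul ((tensor S T).tmul s t hst) u
        (by rw [IntDist.Tensor.tmul_R, htu]) ≫ IntDist.Hom.f (bicat.associator S T U).hom =
      (tensor S (tensor T U).obj).tmul s ((tensor T U).tmul t u htu)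
        (by rw [IntDist.Tensor.tmul_L, hst])
  leftUnitor_tmul : ∀ {A B : IntGpd E} (S : IntDist A B) {X : E} (α : X ⟶ A.arr) (s : X ⟶ S.S₀)
    (h : α ≫ A.d = s ≫ S.L),
    (tensor (IntDist.one A) S).tmul α s h ≫ IntDist.Hom.f (bicat.leftUnitor S).hom =
      S.lact α s h
  rightUnitor_tmul : ∀ {A B : IntGpd E} (S : IntDist A B) {X : E} (s : X ⟶ S.S₀) (β : X ⟶ B.arr)
    (h : s ≫ S.R = β ≫ B.c),
    (tensor S (IntDist.one B)).tmul s β h ≫ IntDist.Hom.f (bicat.rightUnitor S).hom =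
      S.ract s β h

/-- The functor from distributors to relations relative to discrete fibrations, given that the spans
associated with distributors are such relations. -/
noncomputable def toRel
    (h : ∀ (A B : IntGpd E) (S : IntDist A B), isRelation (discreteFibration E) A B S.elSpan)
    (A B : IntGpd E) : IntDist A B ⥤ RelSpan (discreteFibration E) A B :=
  (isRelation (discreteFibration E) A B).lift (IntDist.elements A B) (h A B)

end Composition

/-! ### Regular epimorphisms as covers -/

section Covers

variable {E : Type u} [Category.{v} E]

/-! Regular epimorphisms are treated as covers, so that internal groupoids can be handled by
generalized elements, passing to a cover whenever something exists only locally. Two facts make this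
possible: regular epimorphisms are stable under pullback and composition, and exactness turns the
quotient by the domain and codomain maps of a groupoid into one where identified elements are
locally joined by an arrow (`IsPregroupoid.exists_isQuotient`).

The central point is a local description of final functors. A functor is `IsLocallyFullEso` if,
after a cover, every object of its target is reached by an arrow from an image, and every arrow
between images comes from an arrow. Such functors are orthogonal to discrete fibrations: lifts of
arrows along a discrete fibration are unique, so a diagonal chosen locally is independent of the
choices and descends.

The reflection of a span `X` from `A` to `B` in distributors is the tensor product over `X` of the
two distributors represented by its legs. Its elements are locally `(α, x) ⊗ (x, β)`, and exactness
shows that the unit is locally full and essentially surjective (`isLocallyFullEso_reflMap`). The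
spans of distributors are precisely, up to isomorphism, those whose functor to `A ⨯ B` is a discrete
fibration. With `A` terminal the reflection becomes a factorization of an arbitrary functor, and
since a final discrete fibration is invertible, every final functor is `IsLocallyFullEso`. This
converse (`isLocallyFullEso_of_final`) gives the stability of final morphisms of spans under
composition with relations. The comparison from a composite of spans to the span of the tensor
product is final by the same kind of argument (`isLocallyFullEso_spanMap`).

The bicategorical part is then formal. Distributors and relations both sit in spans as local
reflections, along a class of 2-cells that is stable under whiskering and allows unique extension.
The coherence cells are the unique ones making the inclusion lax, and each axiom follows from the
one for spans by cancelling constraints (`LaxConstraints.Mem.bicategory`). The formulas on elements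
`s ⊗ t` required of a bicategory of distributors are equivalent to this laxness for the constraints
`spanMap` and `oneMap`. Hence any bicategory of distributors and any bicategory of relations have
lax inclusions in spans with final constraints, and factoring one family of constraints through the
other gives the pseudofunctor. -/

theorem exists_desc {P Q Z : E} (q : P ⟶ Q) [IsRegularEpi q] (f : P ⟶ Z)
    (h : ∀ {T : E} (a b : T ⟶ P), a ≫ q = b ≫ q →
      ∃ (T' : E) (e : T' ⟶ T), IsRegularEpi e ∧ e ≫ a ≫ f = e ≫ b ≫ f) :
    ∃ g : Q ⟶ Z, q ≫ g = f := by
  -- The pair that `q` coequalizes is itself a pair identified by `q`. Local equality is enough for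
  -- it because covers are epimorphisms.
  have hw : IsRegularEpi.left q ≫ f = IsRegularEpi.right q ≫ f := by
    obtain ⟨T', e, he, h'⟩ := h _ _ (IsRegularEpi.w q)
    exact (cancel_epi e).1 h'
  exact ⟨IsRegularEpi.desc q f hw, IsRegularEpi.fac q f hw⟩

/-- Membership in a subobject is a local property: a lift through a monomorphism is unique, so lifts
over a cover agree on overlaps and descend. -/
theorem exists_lift_mono {T' T Y Z : E} (e : T' ⟶ T) [IsRegularEpi e] (x : T ⟶ Z) (m : Y ⟶ Z)
    [Mono m] (g : T' ⟶ Y) (h : g ≫ m = e ≫ x) : ∃ y : T ⟶ Y, y ≫ m = x := by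
  obtain ⟨y, hy⟩ := exists_desc e g fun a b hab => ⟨_, 𝟙 _, inferInstance, by
    rw [← cancel_mono m]
    simp only [Category.assoc, h, reassoc_of% hab]⟩
  exact ⟨y, by rw [← cancel_epi e, reassoc_of% hy, h]⟩

/-- A pair of parallel morphisms whose image is an equivalence relation, for instance the pair of
the domain and the codomain morphism of an internal groupoid. -/
structure IsPregroupoid {G₁ G₀ : E} (d c : G₁ ⟶ G₀) : Prop where
  refl : ∃ e : G₀ ⟶ G₁, e ≫ d = 𝟙 _ ∧ e ≫ c = 𝟙 _
  symm : ∃ i : G₁ ⟶ G₁, i ≫ d = c ∧ i ≫ c = d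
  trans : ∀ {T : E} (f g : T ⟶ G₁), f ≫ c = g ≫ d → ∃ h : T ⟶ G₁, h ≫ d = f ≫ d ∧ h ≫ c = g ≫ c

/-- A morphism `q` is a quotient of the pair `(d, c)` if it is a regular epimorphism that
coequalizes the pair, and if elements identified by `q` are locally related by the pair. -/
structure IsQuotient {G₁ G₀ Q : E} (d c : G₁ ⟶ G₀) (q : G₀ ⟶ Q) : Prop where
  isRegularEpi : IsRegularEpi q
  w : d ≫ q = c ≫ q
  exact : ∀ {T : E} (a b : T ⟶ G₀), a ≫ q = b ≫ q →
    ∃ (T' : E) (e : T' ⟶ T) (g : T' ⟶ G₁), IsRegularEpi e ∧ g ≫ d = e ≫ a ∧ g ≫ c = e ≫ b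

theorem IsQuotient.exists_desc {G₁ G₀ Q Z : E} {d c : G₁ ⟶ G₀} {q : G₀ ⟶ Q}
    (h : IsQuotient d c q) (k : G₀ ⟶ Z) (hk : d ≫ k = c ≫ k) : ∃ l : Q ⟶ Z, q ≫ l = k := by
  have := h.isRegularEpi
  refine _root_.exists_desc q k fun a b hab => ?_
  obtain ⟨T', e, g, he, h₁, h₂⟩ := h.exact a b hab
  exact ⟨T', e, he, by rw [← reassoc_of% h₁, ← reassoc_of% h₂, hk]⟩

theorem IsQuotient.nonempty_isColimit {G₁ G₀ Q : E} {d c : G₁ ⟶ G₀} {q : G₀ ⟶ Q}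
    (h : IsQuotient d c q) : Nonempty (IsColimit (Cofork.ofπ q h.w)) := by
  have := h.isRegularEpi
  refine ⟨Cofork.IsColimit.mk _ (fun s => (h.exists_desc s.π s.condition).choose)
    (fun s => (h.exists_desc s.π s.condition).choose_spec) fun s m hm => ?_⟩
  rw [← cancel_epi q]
  exact hm.trans (h.exists_desc s.π s.condition).choose_spec.symm

/-- The given quotient `q` factors through the coequalizer `q'`, so elements identified by `q'` are
already identified by `q`, where they are known to be locally related. -/
theorem IsQuotient.of_isColimit {G₁ G₀ Q Q' : E} {d c : G₁ ⟶ G₀} {q : G₀ ⟶ Q}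
    (h : IsQuotient d c q) {q' : G₀ ⟶ Q'} (w : d ≫ q' = c ≫ q')
    (hq' : IsColimit (Cofork.ofπ q' w)) : IsQuotient d c q' where
  isRegularEpi := ⟨⟨Cofork.IsColimit.regularEpi hq'⟩⟩
  w := w
  exact a b hab := by
    obtain ⟨l, hl⟩ := Cofork.IsColimit.desc' hq' q h.w
    refine h.exact a b ?_
    rw [← hl]
    exact (reassoc_of% hab) l

end Covers

/-! ### Covers in a regular category -/

section Regular

variable {E : Type u} [Category.{v} E] [Regular E]

/-- Strong epimorphisms compose without any hypothesis, and in a regular category they coincide with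
the regular ones. -/
theorem isRegularEpi_comp {X Y Z : E} (f : X ⟶ Y) (g : Y ⟶ Z) [IsRegularEpi f] [IsRegularEpi g] :
    IsRegularEpi (f ≫ g) := by
  have := strongEpi_comp f g
  infer_instance

theorem exists_cover_lift {P Q T : E} (q : P ⟶ Q) [IsRegularEpi q] (y : T ⟶ Q) :
    ∃ (T' : E) (e : T' ⟶ T) (x : T' ⟶ P), IsRegularEpi e ∧ x ≫ q = e ≫ y :=
  ⟨_, pullback.snd q y, pullback.fst q y, inferInstance, pullback.condition⟩

end Regular

/-! ### Exact quotients of pregroupoids -/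

section Exact

variable {E : Type u} [Category.{v} E] [BarrExact E]

/-- The pair `(d, c)` need not be jointly monic, so effectiveness is applied to its image `I` in `G₀
⨯ G₀`. The image is an equivalence relation because each of its axioms asks for membership in a
subobject and can be checked locally. -/
theorem IsPregroupoid.exists_isQuotient {G₁ G₀ : E} {d c : G₁ ⟶ G₀} (h : IsPregroupoid d c) :
    ∃ (Q : E) (q : G₀ ⟶ Q), IsQuotient d c q := by
  obtain ⟨I, ε, m, hε, hm', hfac⟩ : ∃ (I : E) (ε : G₁ ⟶ I) (m : I ⟶ G₀ ⨯ G₀), IsRegularEpi ε ∧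
      Mono m ∧ ε ≫ m = prod.lift d c :=
    ⟨_, (Regular.strongEpiMonoFactorisation (prod.lift d c)).e, _, inferInstance, inferInstance,
      MonoFactorisation.fac _⟩
  let p₁ : I ⟶ G₀ := m ≫ prod.fst
  let p₂ : I ⟶ G₀ := m ≫ prod.snd
  have e₁ : ε ≫ p₁ = d := by simp [p₁, reassoc_of% hfac, prod.lift_fst]
  have e₂ : ε ≫ p₂ = c := by simp [p₂, reassoc_of% hfac, prod.lift_snd]
  have hm : ∀ {T : E} (f g : T ⟶ I), f ≫ p₁ = g ≫ p₁ → f ≫ p₂ = g ≫ p₂ → f = g := by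
    intro T f g h₁ h₂
    rw [← cancel_mono m]
    apply Limits.prod.hom_ext <;> simpa using ‹_›
  -- Two elements are related by the image as soon as an arrow joins them over a cover.
  have hlift : ∀ {T T' : E} (e : T' ⟶ T) [IsRegularEpi e] (g : T' ⟶ G₁) (x y : T ⟶ G₀),
      g ≫ d = e ≫ x → g ≫ c = e ≫ y → ∃ r : T ⟶ I, r ≫ p₁ = x ∧ r ≫ p₂ = y := by
    intro T T' e _ g x y h₁ h₂
    obtain ⟨r, hr⟩ := exists_lift_mono e (prod.lift x y) m (g ≫ ε) (by
      apply Limits.prod.hom_ext <;> simp [hfac, h₁, h₂, prod.lift_fst, prod.lift_snd])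
    exact ⟨r, by simp [p₁, reassoc_of% hr, prod.lift_fst],
      by simp [p₂, reassoc_of% hr, prod.lift_snd]⟩
  obtain ⟨e, he₁, he₂⟩ := h.refl
  obtain ⟨i, hi₁, hi₂⟩ := h.symm
  obtain ⟨s, hs₁, hs₂⟩ := hlift ε i p₂ p₁ (by rw [hi₁, e₂]) (by rw [hi₂, e₁])
  -- Transitivity: composable elements of `I` are lifted one after the other to arrows of `G₁`, at
  -- the price of two successive covers, and composed there.
  obtain ⟨t, ht₁, ht₂⟩ : ∃ t : pullback p₂ p₁ ⟶ I,
      t ≫ p₁ = pullback.fst _ _ ≫ p₁ ∧ t ≫ p₂ = pullback.snd _ _ ≫ p₂ := by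
    obtain ⟨T', e', f, he', hf⟩ := exists_cover_lift ε (pullback.fst p₂ p₁)
    obtain ⟨T'', e'', g, he'', hg⟩ := exists_cover_lift ε (e' ≫ pullback.snd p₂ p₁)
    obtain ⟨k, hk₁, hk₂⟩ := h.trans (e'' ≫ f) g (by
      rw [← e₁, ← e₂, Category.assoc, reassoc_of% hf, reassoc_of% hg, pullback.condition])
    have := isRegularEpi_comp e'' e'
    refine hlift (e'' ≫ e') k _ _ ?_ ?_
    · rw [hk₁, ← e₁]; simp [reassoc_of% hf]
    · rw [hk₂, ← e₂]; simp [reassoc_of% hg]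
  have : IsEquivalenceRelation p₁ p₂ :=
    ⟨⟨{ right_cancellation := fun _ f g h₁ h₂ => hm f g h₁ h₂
        r := e ≫ ε
        reflexivity₁ := by simp [e₁, he₁]
        reflexivity₂ := by simp [e₂, he₂]
        s := s
        symmetry₁ := hs₁
        symmetry₂ := hs₂
        c := _
        isLimit := pullback.isLimit p₂ p₁
        t := t
        transitivity₁ := ht₁
        transitivity₂ := ht₂ }⟩⟩
  obtain ⟨⟨Q⟩⟩ := BarrExact.effective p₁ p₂
  refine ⟨Q.B, Q.π, inferInstance, ?_, fun a b hab => ?_⟩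
  · simp only [← e₁, ← e₂, Category.assoc ε, Q.isPushout.w]
  -- Effectiveness makes `I` the kernel pair of the quotient, so `(a, b)` factors through `I`.
  -- Lifting this along the cover `ε` gives the local arrow.
  · obtain ⟨T', e', g, he', hg⟩ := exists_cover_lift ε (Q.isKernelPair.lift a b hab)
    exact ⟨T', e', g, he', by rw [← e₁, reassoc_of% hg, IsKernelPair.lift_fst],
      by rw [← e₂, reassoc_of% hg, IsKernelPair.lift_snd]⟩

theorem IsPregroupoid.isQuotient {G₁ G₀ Q : E} {d c : G₁ ⟶ G₀} (h : IsPregroupoid d c)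
    {q : G₀ ⟶ Q} (w : d ≫ q = c ≫ q) (hq : IsColimit (Cofork.ofπ q w)) : IsQuotient d c q :=
  h.exists_isQuotient.choose_spec.choose_spec.of_isColimit w hq

end Exact

/-! ### Existence of composites of distributors -/

section PartialActions

variable {E : Type u} [Category.{v} E] [HasFiniteLimits E]

theorem comp_lift_comp {A B C X Y Z : E} {f : A ⟶ C} {g : B ⟶ C} (k : Y ⟶ X)
    (a : X ⟶ A) (b : X ⟶ B) (h : a ≫ f = b ≫ g) (q : pullback f g ⟶ Z) :
    k ≫ pullback.lift a b h ≫ q = pullback.lift (k ≫ a) (k ≫ b) (by simp [h]) ≫ q := by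
  rw [← IntGpd.comp_lift, Category.assoc]

/-- The value of a morphism defined on a pullback at a pair of generalized elements. -/
noncomputable def act {A B Q Z : E} {a : A ⟶ B} {l : Q ⟶ B} (g : pullback a l ⟶ Z) {X : E}
    (α : X ⟶ A) (x : X ⟶ Q) (h : α ≫ a = x ≫ l) : X ⟶ Z :=
  pullback.lift α x h ≫ g

theorem comp_act {A B Q Z : E} {a : A ⟶ B} {l : Q ⟶ B} (g : pullback a l ⟶ Z) {X Y : E}
    (k : Y ⟶ X) (α : X ⟶ A) (x : X ⟶ Q) (h : α ≫ a = x ≫ l) :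
    k ≫ act g α x h = act g (k ≫ α) (k ≫ x) (by simp [h]) := by
  rw [act, act, ← Category.assoc, IntGpd.comp_lift]

theorem act_congr {A B Q Z : E} {a : A ⟶ B} {l : Q ⟶ B} {g : pullback a l ⟶ Z} {X : E}
    {α α' : X ⟶ A} {x x' : X ⟶ Q} (hα : α = α') (hx : x = x') (h : α ≫ a = x ≫ l) :
    act g α x h = act g α' x' (by rw [← hα, ← hx, h]) := by
  subst hα hx; rfl

end PartialActions

/-! ### Descent for morphisms defined on a pullback -/

section Descent

variable {E : Type u} [Category.{v} E] [Regular E]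

/-- This serves to define actions on a quotient `Q` by a formula on representatives in `P`. A family
natural in `X` amounts to one morphism on the object of pairs `(α, p)`, which covers `pullback a l`
because it is a pullback of `q`. -/
theorem exists_desc_right {P Q A B Z : E} (q : P ⟶ Q) [IsRegularEpi q] (a : A ⟶ B) (l : Q ⟶ B)
    (f : ∀ {X : E} (α : X ⟶ A) (p : X ⟶ P), α ≫ a = p ≫ q ≫ l → (X ⟶ Z))
    (hf : ∀ {X Y : E} (k : Y ⟶ X) (α : X ⟶ A) (p : X ⟶ P) (h : α ≫ a = p ≫ q ≫ l),
      k ≫ f α p h = f (k ≫ α) (k ≫ p) (by simp [h]))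
    (hq : ∀ {X : E} (α : X ⟶ A) (p p' : X ⟶ P) (h : α ≫ a = p ≫ q ≫ l)
      (h' : α ≫ a = p' ≫ q ≫ l), p ≫ q = p' ≫ q →
      ∃ (X' : E) (e : X' ⟶ X), IsRegularEpi e ∧ e ≫ f α p h = e ≫ f α p' h') :
    ∃ g : pullback a l ⟶ Z, ∀ {X : E} (α : X ⟶ A) (p : X ⟶ P) (h : α ≫ a = p ≫ q ≫ l),
      act g α (p ≫ q) (by simp [h]) = f α p h := by
  -- Compatibility of the universal pair `(α, p)`, which lives on the pullback of `q` along the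
  -- second projection.
  have hY : (pullback.snd q (pullback.snd a l) ≫ pullback.fst a l) ≫ a =
      pullback.fst q (pullback.snd a l) ≫ q ≫ l := by
    rw [Category.assoc, pullback.condition, ← pullback.condition_assoc]
  obtain ⟨g, hg⟩ := exists_desc (pullback.snd q (pullback.snd a l)) (f _ _ hY) (by
    intro T x y hxy
    obtain ⟨T', e, he, h⟩ := hq (x ≫ pullback.snd q (pullback.snd a l) ≫ pullback.fst a l)
      (x ≫ pullback.fst q (pullback.snd a l)) (y ≫ pullback.fst q (pullback.snd a l))
      (by simp only [Category.assoc, ← hY])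
      (by rw [reassoc_of% hxy]; simp only [Category.assoc, ← hY])
      (by simp only [Category.assoc, pullback.condition]; rw [reassoc_of% hxy])
    refine ⟨T', e, he, ?_⟩
    rw [hf x, hf y]
    simpa only [reassoc_of% hxy] using h)
  refine ⟨g, fun α p h => ?_⟩
  have h₁ : act g α (p ≫ q) (by simp [h]) =
      pullback.lift p (pullback.lift α (p ≫ q) (by simp [h])) (by simp) ≫
        pullback.snd q (pullback.snd a l) ≫ g := by simp [act]
  rw [h₁, hg, hf]
  congr 1 <;> simp

theorem exists_desc_left {P Q A B Z : E} (q : P ⟶ Q) [IsRegularEpi q] (l : Q ⟶ B) (a : A ⟶ B)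
    (f : ∀ {X : E} (p : X ⟶ P) (α : X ⟶ A), p ≫ q ≫ l = α ≫ a → (X ⟶ Z))
    (hf : ∀ {X Y : E} (k : Y ⟶ X) (p : X ⟶ P) (α : X ⟶ A) (h : p ≫ q ≫ l = α ≫ a),
      k ≫ f p α h = f (k ≫ p) (k ≫ α) (by simp [h]))
    (hq : ∀ {X : E} (p p' : X ⟶ P) (α : X ⟶ A) (h : p ≫ q ≫ l = α ≫ a)
      (h' : p' ≫ q ≫ l = α ≫ a), p ≫ q = p' ≫ q →
      ∃ (X' : E) (e : X' ⟶ X), IsRegularEpi e ∧ e ≫ f p α h = e ≫ f p' α h') :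
    ∃ g : pullback l a ⟶ Z, ∀ {X : E} (p : X ⟶ P) (α : X ⟶ A) (h : p ≫ q ≫ l = α ≫ a),
      act g (p ≫ q) α (by simp [h]) = f p α h := by
  obtain ⟨g, hg⟩ := exists_desc_right q a l (fun α p h => f p α h.symm)
    (fun k α p h => hf k p α h.symm) (fun α p p' h h' => hq p p' α h.symm h'.symm)
  refine ⟨pullback.lift (pullback.snd _ _) (pullback.fst _ _) pullback.condition.symm ≫ g,
    fun p α h => ?_⟩
  rw [← hg α p h.symm, act, act, ← Category.assoc, IntGpd.comp_lift]
  congr 1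
  apply IntGpd.lift_congr <;> simp

end Descent

/-! ### The groupoid of triples underlying a tensor product -/

namespace IntDist

section

variable {E : Type u} [Category.{v} E] [HasFiniteLimits E] {A B C : IntGpd E}
  (S : IntDist A B) (T : IntDist B C)

variable {S T} in
/-- The generalized triple with given components. -/
noncomputable def triplesMk {X : E} (s : X ⟶ S.S₀) (β : X ⟶ B.arr) (t : X ⟶ T.S₀)
    (h : s ≫ S.R = β ≫ B.c) (h' : β ≫ B.d = t ≫ T.L) : X ⟶ triples S T :=
  pullback.lift (pullback.lift s β h) t (by simp [h'])

theorem triplesMk_left {X : E} (s : X ⟶ S.S₀) (β : X ⟶ B.arr) (t : X ⟶ T.S₀)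
    (h : s ≫ S.R = β ≫ B.c) (h' : β ≫ B.d = t ≫ T.L) :
    triplesMk s β t h h' ≫ triplesLeft S T =
      pullback.lift (S.ract s β h) t (by rw [ract_R, h']) := by
  apply pullback.hom_ext <;> simp [triplesMk, triplesLeft, ract]

theorem triplesMk_right {X : E} (s : X ⟶ S.S₀) (β : X ⟶ B.arr) (t : X ⟶ T.S₀)
    (h : s ≫ S.R = β ≫ B.c) (h' : β ≫ B.d = t ≫ T.L) :
    triplesMk s β t h h' ≫ triplesRight S T =
      pullback.lift s (T.lact β t h') (by rw [lact_L, h]) := by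
  apply pullback.hom_ext
  · simp [triplesMk, triplesRight]
  · simp only [triplesRight, pullback.lift_snd, Category.assoc, comp_lact]
    apply lact_congr <;> simp [triplesMk]

theorem exists_triplesMk {X : E} (x : X ⟶ triples S T) :
    ∃ (s : X ⟶ S.S₀) (β : X ⟶ B.arr) (t : X ⟶ T.S₀) (h : s ≫ S.R = β ≫ B.c)
      (h' : β ≫ B.d = t ≫ T.L), x = triplesMk s β t h h' := by
  refine ⟨x ≫ pullback.fst _ _ ≫ pullback.fst _ _, x ≫ pullback.fst _ _ ≫ pullback.snd _ _,
    x ≫ pullback.snd _ _, ?_, ?_, ?_⟩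
  · simp [pullback.condition]
  · simp [← pullback.condition]
  · apply pullback.hom_ext
    · apply pullback.hom_ext <;> simp [triplesMk]
    · simp [triplesMk]

theorem lift_ext_iff {A B C X : E} {f : A ⟶ C} {g : B ⟶ C} {a a' : X ⟶ A} {b b' : X ⟶ B}
    {h : a ≫ f = b ≫ g} {h' : a' ≫ f = b' ≫ g} :
    (pullback.lift a b h : X ⟶ pullback f g) = pullback.lift a' b' h' ↔ a = a' ∧ b = b' := by
  refine ⟨fun e => ⟨?_, ?_⟩, fun e => IntGpd.lift_congr e.1 e.2 h⟩
  · simpa using e =≫ pullback.fst _ _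
  · simpa using e =≫ pullback.snd _ _

/-- A triple `((s, β), t)` is an arrow from `(s · β, t)` to `(s, β · t)`. Its inverse is `((s · β,
β⁻¹), β · t)`, and composition multiplies the arrows of `B`. -/
theorem triples_isPregroupoid : IsPregroupoid (triplesLeft S T) (triplesRight S T) where
  refl := by
    refine ⟨triplesMk (pullback.fst _ _) ((pullback.fst S.R T.L ≫ S.R) ≫ B.e) (pullback.snd _ _)
      (by simp [B.e_c]) (by simp [B.e_d, pullback.condition]), ?_, ?_⟩
    · rw [triplesMk_left]
      apply pullback.hom_ext
      · simpa using ract_one _ _ rfl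
      · simp
    · rw [triplesMk_right]
      apply pullback.hom_ext
      · simp
      · simpa using one_lact _ _ pullback.condition
  symm := by
    obtain ⟨s, β, t, h, h', hx⟩ := exists_triplesMk S T (𝟙 _)
    refine ⟨triplesMk (S.ract s β h) (β ≫ B.inv) (T.lact β t h')
      (by rw [ract_R, Category.assoc, B.inv_c]) (by rw [lact_L, Category.assoc, B.inv_d]), ?_, ?_⟩
    · rw [triplesMk_left, ← Category.id_comp (triplesRight S T), hx, triplesMk_right, lift_ext_iff]
      refine ⟨?_, rfl⟩
      rw [← ract_mul (h := by rw [Category.assoc, B.inv_c])]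
      refine (ract_congr rfl (IntGpd.inv_mul β) _).trans ?_
      exact (ract_congr rfl (Category.assoc _ _ _).symm _).trans (ract_one _ _ h.symm)
    · rw [triplesMk_right, ← Category.id_comp (triplesLeft S T), hx, triplesMk_left, lift_ext_iff]
      refine ⟨rfl, ?_⟩
      rw [← mul_lact (h := by rw [Category.assoc, B.inv_d])]
      refine (lact_congr (IntGpd.mul_inv β) rfl _).trans ?_
      exact (lact_congr (Category.assoc _ _ _).symm rfl _).trans (one_lact _ _ h')
  trans f g hfg := by
    obtain ⟨s, β, t, h, h', rfl⟩ := exists_triplesMk S T f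
    obtain ⟨s', β', t', k, k', rfl⟩ := exists_triplesMk S T g
    rw [triplesMk_right, triplesMk_left, lift_ext_iff] at hfg
    obtain ⟨h₁, h₂⟩ := hfg
    have hβ : β ≫ B.c = β' ≫ B.d := by rw [← h, h₁, ract_R]
    refine ⟨triplesMk s' (B.mul β β' hβ) t (by rw [IntGpd.mul_c, k]) (by rw [IntGpd.mul_d, h']),
      ?_, ?_⟩
    · rw [triplesMk_left, triplesMk_left, lift_ext_iff]
      exact ⟨(ract_mul _ _ _ hβ k).trans (ract_congr h₁.symm rfl _), rfl⟩
    · rw [triplesMk_right, triplesMk_right, lift_ext_iff]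
      exact ⟨rfl, (mul_lact _ _ _ hβ h').trans (lact_congr rfl h₂ _)⟩

end

end IntDist

/-! ### The tensor product as an exact quotient -/

namespace IntDist

variable {E : Type u} [Category.{v} E] [BarrExact E] {A B C : IntGpd E}

section

variable (S : IntDist A B) (T : IntDist B C)

/-- A quotient of the object of pairs `(s, t)` by the action of `B`. -/
structure TensorQuotient where
  /-- the quotient -/
  Q : E
  /-- the projection -/
  q : pullback S.R T.L ⟶ Q
  isQuotient : IsQuotient (triplesLeft S T) (triplesRight S T) q

theorem nonempty_tensorQuotient : Nonempty (TensorQuotient S T) := by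
  obtain ⟨Q, q, h⟩ := (triples_isPregroupoid S T).exists_isQuotient
  exact ⟨⟨Q, q, h⟩⟩

end

variable {S : IntDist A B} {T : IntDist B C}

theorem _root_.IsQuotient.balanced {Q : E} {q : pullback S.R T.L ⟶ Q}
    (h : IsQuotient (triplesLeft S T) (triplesRight S T) q) {X : E} (s : X ⟶ S.S₀)
    (β : X ⟶ B.arr) (t : X ⟶ T.S₀) (h₁ : s ≫ S.R = β ≫ B.c) (h₂ : β ≫ B.d = t ≫ T.L) :
    pullback.lift (S.ract s β h₁) t (by rw [ract_R, h₂]) ≫ q =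
      pullback.lift s (T.lact β t h₂) (by rw [lact_L, h₁]) ≫ q := by
  rw [← triplesMk_left S T s β t h₁ h₂, ← triplesMk_right S T s β t h₁ h₂, Category.assoc,
    Category.assoc,
    h.w]

/-- Exactness on elements: an equality of two tensors is witnessed, after a cover, by a single arrow
`β` of `B` rather than by a zigzag. All fullness statements about tensor products come from this. -/
theorem _root_.IsQuotient.exists_arrow {Q : E} {q : pullback S.R T.L ⟶ Q}
    (h : IsQuotient (triplesLeft S T) (triplesRight S T) q) {X : E} (p p' : X ⟶ pullback S.R T.L)
    (hp : p ≫ q = p' ≫ q) : ∃ (X' : E) (e : X' ⟶ X) (β : X' ⟶ B.arr)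
      (h₁ : (e ≫ p' ≫ pullback.fst _ _) ≫ S.R = β ≫ B.c)
      (h₂ : β ≫ B.d = (e ≫ p ≫ pullback.snd _ _) ≫ T.L), IsRegularEpi e ∧
      e ≫ p ≫ pullback.fst _ _ = S.ract (e ≫ p' ≫ pullback.fst _ _) β h₁ ∧
      e ≫ p' ≫ pullback.snd _ _ = T.lact β (e ≫ p ≫ pullback.snd _ _) h₂ := by
  obtain ⟨X', e, g, he, hg, hg'⟩ := h.exact p p' hp
  obtain ⟨s, β, t, k, k', rfl⟩ := exists_triplesMk S T g
  rw [triplesMk_left] at hg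
  rw [triplesMk_right] at hg'
  have e₁ := hg =≫ pullback.fst _ _
  have e₂ := hg =≫ pullback.snd _ _
  have e₃ := hg' =≫ pullback.fst _ _
  have e₄ := hg' =≫ pullback.snd _ _
  simp only [pullback.lift_fst, pullback.lift_snd, Category.assoc] at e₁ e₂ e₃ e₄
  refine ⟨X', e, β, by rw [← e₃, k], by rw [← e₂, k'], he, ?_, ?_⟩
  · rw [← e₁]; exact ract_congr e₃ rfl _
  · rw [← e₄]; exact lact_congr rfl e₂ _

namespace TensorQuotient

variable (τ : TensorQuotient S T)

theorem exists_legs : ∃ (L : τ.Q ⟶ A.obj) (R : τ.Q ⟶ C.obj),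
    τ.q ≫ L = pullback.fst _ _ ≫ S.L ∧ τ.q ≫ R = pullback.snd _ _ ≫ T.R := by
  obtain ⟨L, hL⟩ := τ.isQuotient.exists_desc (pullback.fst _ _ ≫ S.L)
    (by simp [triplesLeft, triplesRight, S.rho_L])
  obtain ⟨R, hR⟩ := τ.isQuotient.exists_desc (pullback.snd _ _ ≫ T.R)
    (by simp [triplesLeft, triplesRight, lact_R])
  exact ⟨L, R, hL, hR⟩

/-- The left leg of the composite. -/
noncomputable def L : τ.Q ⟶ A.obj := τ.exists_legs.choose

/-- The right leg of the composite. -/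
noncomputable def R : τ.Q ⟶ C.obj := τ.exists_legs.choose_spec.choose

theorem q_L : τ.q ≫ τ.L = pullback.fst _ _ ≫ S.L := τ.exists_legs.choose_spec.choose_spec.1

theorem q_R : τ.q ≫ τ.R = pullback.snd _ _ ≫ T.R := τ.exists_legs.choose_spec.choose_spec.2

/-- The formula `α · (s ⊗ t) = (α · s) ⊗ t` does not depend on the representative because the left
action of `A` on `S` commutes with the right action of `B`. -/
theorem exists_lact : ∃ g : pullback A.d τ.L ⟶ τ.Q, ∀ {X : E} (α : X ⟶ A.arr)
    (p : X ⟶ pullback S.R T.L) (h : α ≫ A.d = p ≫ τ.q ≫ τ.L),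
    act g α (p ≫ τ.q) (by simp [h]) =
      pullback.lift (S.lact α (p ≫ pullback.fst _ _) (by rw [h, τ.q_L, Category.assoc]))
        (p ≫ pullback.snd _ _) (by rw [lact_R, Category.assoc, Category.assoc,
          pullback.condition]) ≫ τ.q := by
  have := τ.isQuotient.isRegularEpi
  refine exists_desc_right τ.q A.d τ.L (fun α p h => pullback.lift (S.lact α (p ≫ pullback.fst _ _)
    (by rw [h, τ.q_L, Category.assoc])) (p ≫ pullback.snd _ _)
    (by rw [lact_R, Category.assoc, Category.assoc, pullback.condition]) ≫ τ.q) ?_ ?_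
  · intro X Y k α p h
    rw [← Category.assoc, IntGpd.comp_lift]
    congr 1
    exact IntGpd.lift_congr ((comp_lact k _).trans (lact_congr rfl (Category.assoc _ _ _).symm _))
      (Category.assoc _ _ _).symm _
  · intro X α p p' h h' hp
    -- With `p = (s' · β, t)` and `p' = (s', β · t)` over the cover, both values are the two sides
    -- of `balanced` at `α · s'`, `β`, `t`.
    obtain ⟨X', e, β, h₁, h₂, he, h₃, h₄⟩ := τ.isQuotient.exists_arrow p p' hp
    refine ⟨X', e, he, ?_⟩
    have h'' : (e ≫ α) ≫ A.d = (e ≫ p' ≫ pullback.fst _ _) ≫ S.L := by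
      simp only [Category.assoc, h', τ.q_L]
    have := τ.isQuotient.balanced (S.lact (e ≫ α) (e ≫ p' ≫ pullback.fst _ _) h'') β
      (e ≫ p ≫ pullback.snd _ _) (by rw [lact_R, h₁]) h₂
    rw [comp_lift_comp, comp_lift_comp]
    refine Eq.trans ?_ (this.trans ?_)
    · congr 1
      refine IntGpd.lift_congr ?_ rfl _
      rw [comp_lact, lact_ract _ _ _ h'' h₁]
      exact lact_congr rfl h₃ _
    · congr 1
      exact IntGpd.lift_congr (comp_lact _ _).symm h₄.symm _

theorem exists_ract : ∃ g : pullback τ.R C.c ⟶ τ.Q, ∀ {X : E} (p : X ⟶ pullback S.R T.L)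
    (γ : X ⟶ C.arr) (h : p ≫ τ.q ≫ τ.R = γ ≫ C.c),
    act g (p ≫ τ.q) γ (by simp [h]) =
      pullback.lift (p ≫ pullback.fst _ _)
        (T.ract (p ≫ pullback.snd _ _) γ (by rw [← h, τ.q_R, Category.assoc]))
        (by rw [ract_L, Category.assoc, Category.assoc, pullback.condition]) ≫ τ.q := by
  have := τ.isQuotient.isRegularEpi
  refine exists_desc_left τ.q τ.R C.c (fun p γ h => pullback.lift (p ≫ pullback.fst _ _)
    (T.ract (p ≫ pullback.snd _ _) γ (by rw [← h, τ.q_R, Category.assoc]))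
    (by rw [ract_L, Category.assoc, Category.assoc, pullback.condition]) ≫ τ.q) ?_ ?_
  · intro X Y k p γ h
    rw [← Category.assoc, IntGpd.comp_lift]
    congr 1
    exact IntGpd.lift_congr (Category.assoc _ _ _).symm
      ((comp_ract k _).trans (ract_congr (Category.assoc _ _ _).symm rfl _)) _
  · intro X p p' γ h h' hp
    obtain ⟨X', e, β, h₁, h₂, he, h₃, h₄⟩ := τ.isQuotient.exists_arrow p p' hp
    refine ⟨X', e, he, ?_⟩
    have h'' : (e ≫ p ≫ pullback.snd _ _) ≫ T.R = (e ≫ γ) ≫ C.c := by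
      simp only [Category.assoc, ← h, τ.q_R]
    have := τ.isQuotient.balanced (e ≫ p' ≫ pullback.fst _ _) β
      (T.ract (e ≫ p ≫ pullback.snd _ _) (e ≫ γ) h'') h₁ (by rw [ract_L, h₂])
    rw [comp_lift_comp, comp_lift_comp]
    refine Eq.trans ?_ (this.trans ?_)
    · congr 1
      exact IntGpd.lift_congr h₃ (comp_ract _ _) _
    · congr 1
      refine IntGpd.lift_congr rfl ?_ _
      rw [comp_ract, ← lact_ract _ _ _ h₂ h'']
      exact ract_congr h₄.symm rfl _

/-- The left action on the composite. -/
noncomputable def lam : pullback A.d τ.L ⟶ τ.Q := τ.exists_lact.choose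

/-- The right action on the composite. -/
noncomputable def rho : pullback τ.R C.c ⟶ τ.Q := τ.exists_ract.choose

variable {X : E}

/-- The generalized element `s ⊗ t`. -/
noncomputable def tmul (s : X ⟶ S.S₀) (t : X ⟶ T.S₀) (h : s ≫ S.R = t ≫ T.L) : X ⟶ τ.Q :=
  pullback.lift s t h ≫ τ.q

theorem tmul_L (s : X ⟶ S.S₀) (t : X ⟶ T.S₀) (h : s ≫ S.R = t ≫ T.L) :
    τ.tmul s t h ≫ τ.L = s ≫ S.L := by simp [tmul, τ.q_L]

theorem tmul_R (s : X ⟶ S.S₀) (t : X ⟶ T.S₀) (h : s ≫ S.R = t ≫ T.L) :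
    τ.tmul s t h ≫ τ.R = t ≫ T.R := by simp [tmul, τ.q_R]

theorem tmul_congr {s s' : X ⟶ S.S₀} {t t' : X ⟶ T.S₀} (hs : s = s') (ht : t = t')
    (h : s ≫ S.R = t ≫ T.L) : τ.tmul s t h = τ.tmul s' t' (by rw [← hs, ← ht, h]) := by
  subst hs ht; rfl

theorem act_lam (α : X ⟶ A.arr) (s : X ⟶ S.S₀) (t : X ⟶ T.S₀) (hst : s ≫ S.R = t ≫ T.L)
    (h : α ≫ A.d = s ≫ S.L) :
    act τ.lam α (τ.tmul s t hst) (by rw [tmul_L, h]) =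
      τ.tmul (S.lact α s h) t (by rw [lact_R, hst]) := by
  refine (τ.exists_lact.choose_spec α (pullback.lift s t hst) (by simp [τ.q_L, h])).trans ?_
  exact τ.tmul_congr (lact_congr rfl (by simp) _) (by simp) _

theorem act_rho (s : X ⟶ S.S₀) (t : X ⟶ T.S₀) (γ : X ⟶ C.arr) (hst : s ≫ S.R = t ≫ T.L)
    (h : t ≫ T.R = γ ≫ C.c) :
    act τ.rho (τ.tmul s t hst) γ (by rw [tmul_R, h]) =
      τ.tmul s (T.ract t γ h) (by rw [ract_L, hst]) := by
  refine (τ.exists_ract.choose_spec (pullback.lift s t hst) γ (by simp [τ.q_R, h])).trans ?_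
  exact τ.tmul_congr (by simp) (ract_congr (by simp) rfl _) _

/-- Every generalized element is locally a pure tensor. The axioms of the composite distributor are
therefore checked on pure tensors, where they reduce to those of `S` and `T`. -/
theorem exists_cover_eq_tmul (x : X ⟶ τ.Q) : ∃ (X' : E) (e : X' ⟶ X) (s : X' ⟶ S.S₀)
    (t : X' ⟶ T.S₀) (h : s ≫ S.R = t ≫ T.L), IsRegularEpi e ∧ e ≫ x = τ.tmul s t h := by
  have := τ.isQuotient.isRegularEpi
  obtain ⟨X', e, p, he, hp⟩ := exists_cover_lift τ.q x
  refine ⟨X', e, p ≫ pullback.fst _ _, p ≫ pullback.snd _ _,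
    by simp [pullback.condition], he, ?_⟩
  rw [← hp, tmul]
  congr 1
  apply pullback.hom_ext <;> simp

theorem lam_L : τ.lam ≫ τ.L = pullback.fst A.d τ.L ≫ A.c := by
  obtain ⟨X', e, s, t, hst, he, h⟩ := τ.exists_cover_eq_tmul (pullback.snd A.d τ.L)
  rw [← cancel_epi e]
  have h' : (e ≫ pullback.fst A.d τ.L) ≫ A.d = s ≫ S.L := by
    rw [Category.assoc, pullback.condition, reassoc_of% h, tmul_L]
  have h₁ : e ≫ τ.lam = act τ.lam (e ≫ pullback.fst A.d τ.L) (τ.tmul s t hst)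
      (by rw [tmul_L, h']) := by
    rw [act]; congr 1; apply pullback.hom_ext <;> simp [h]
  rw [reassoc_of% h₁, act_lam (h := h'), tmul_L, lact_L, Category.assoc]

theorem lam_R : τ.lam ≫ τ.R = pullback.snd A.d τ.L ≫ τ.R := by
  obtain ⟨X', e, s, t, hst, he, h⟩ := τ.exists_cover_eq_tmul (pullback.snd A.d τ.L)
  rw [← cancel_epi e]
  have h' : (e ≫ pullback.fst A.d τ.L) ≫ A.d = s ≫ S.L := by
    rw [Category.assoc, pullback.condition, reassoc_of% h, tmul_L]
  have h₁ : e ≫ τ.lam = act τ.lam (e ≫ pullback.fst A.d τ.L) (τ.tmul s t hst)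
      (by rw [tmul_L, h']) := by
    rw [act]; congr 1; apply pullback.hom_ext <;> simp [h]
  rw [reassoc_of% h₁, act_lam (h := h'), tmul_R, reassoc_of% h, tmul_R]

theorem rho_L : τ.rho ≫ τ.L = pullback.fst τ.R C.c ≫ τ.L := by
  obtain ⟨X', e, s, t, hst, he, h⟩ := τ.exists_cover_eq_tmul (pullback.fst τ.R C.c)
  rw [← cancel_epi e]
  have h' : t ≫ T.R = (e ≫ pullback.snd τ.R C.c) ≫ C.c := by
    rw [Category.assoc, ← pullback.condition, reassoc_of% h, tmul_R]
  have h₁ : e ≫ τ.rho = act τ.rho (τ.tmul s t hst) (e ≫ pullback.snd τ.R C.c)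
      (by rw [tmul_R, h']) := by
    rw [act]; congr 1; apply pullback.hom_ext <;> simp [h]
  rw [reassoc_of% h₁, act_rho (h := h'), tmul_L, reassoc_of% h, tmul_L]

theorem rho_R : τ.rho ≫ τ.R = pullback.snd τ.R C.c ≫ C.d := by
  obtain ⟨X', e, s, t, hst, he, h⟩ := τ.exists_cover_eq_tmul (pullback.fst τ.R C.c)
  rw [← cancel_epi e]
  have h' : t ≫ T.R = (e ≫ pullback.snd τ.R C.c) ≫ C.c := by
    rw [Category.assoc, ← pullback.condition, reassoc_of% h, tmul_R]
  have h₁ : e ≫ τ.rho = act τ.rho (τ.tmul s t hst) (e ≫ pullback.snd τ.R C.c)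
      (by rw [tmul_R, h']) := by
    rw [act]; congr 1; apply pullback.hom_ext <;> simp [h]
  rw [reassoc_of% h₁, act_rho (h := h'), tmul_R, ract_R, Category.assoc]

theorem act_lam_L (α : X ⟶ A.arr) (x : X ⟶ τ.Q) (h : α ≫ A.d = x ≫ τ.L) :
    act τ.lam α x h ≫ τ.L = α ≫ A.c := by simp [act, lam_L]

theorem act_lam_R (α : X ⟶ A.arr) (x : X ⟶ τ.Q) (h : α ≫ A.d = x ≫ τ.L) :
    act τ.lam α x h ≫ τ.R = x ≫ τ.R := by simp [act, lam_R]

theorem act_rho_L (x : X ⟶ τ.Q) (γ : X ⟶ C.arr) (h : x ≫ τ.R = γ ≫ C.c) :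
    act τ.rho x γ h ≫ τ.L = x ≫ τ.L := by simp [act, rho_L]

theorem act_rho_R (x : X ⟶ τ.Q) (γ : X ⟶ C.arr) (h : x ≫ τ.R = γ ≫ C.c) :
    act τ.rho x γ h ≫ τ.R = γ ≫ C.d := by simp [act, rho_R]

theorem one_act_lam (x : X ⟶ τ.Q) :
    act τ.lam ((x ≫ τ.L) ≫ A.e) x (by simp [A.e_d]) = x := by
  obtain ⟨X', e, s, t, hst, he, h⟩ := τ.exists_cover_eq_tmul x
  rw [← cancel_epi e, comp_act]
  refine (act_congr (α' := (s ≫ S.L) ≫ A.e) (by rw [← τ.tmul_L s t hst, ← h]; simp) h _).trans ?_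
  rw [act_lam (h := by simp [A.e_d]), h]
  exact τ.tmul_congr (one_lact _ _ rfl) rfl _

theorem act_rho_one (x : X ⟶ τ.Q) :
    act τ.rho x ((x ≫ τ.R) ≫ C.e) (by simp [C.e_c]) = x := by
  obtain ⟨X', e, s, t, hst, he, h⟩ := τ.exists_cover_eq_tmul x
  rw [← cancel_epi e, comp_act]
  refine (act_congr (x' := (t ≫ T.R) ≫ C.e) h (by rw [← τ.tmul_R s t hst, ← h]; simp) _).trans ?_
  rw [act_rho (h := by simp [C.e_c]), h]
  exact τ.tmul_congr rfl (ract_one _ _ rfl) _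

theorem mul_act_lam (α α' : X ⟶ A.arr) (x : X ⟶ τ.Q) (h : α ≫ A.c = α' ≫ A.d)
    (hx : α ≫ A.d = x ≫ τ.L) :
    act τ.lam (A.mul α α' h) x (by rw [IntGpd.mul_d, hx]) =
      act τ.lam α' (act τ.lam α x hx) (by rw [act_lam_L, h]) := by
  obtain ⟨X', e, s, t, hst, he, hs⟩ := τ.exists_cover_eq_tmul x
  have h₁ : (e ≫ α) ≫ A.d = s ≫ S.L := by
    rw [Category.assoc, hx, reassoc_of% hs, tmul_L]
  have h₂ : (e ≫ α) ≫ A.c = (e ≫ α') ≫ A.d := by simp [h]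
  rw [← cancel_epi e, comp_act, comp_act]
  refine (act_congr (IntGpd.comp_mul _ _ _ _) hs _).trans ?_
  refine ((τ.act_lam _ _ _ hst (by rw [IntGpd.mul_d, h₁])).trans ?_).trans
    (act_congr rfl ((comp_act _ _ _ _ _).trans ((act_congr rfl hs _).trans
      (τ.act_lam _ _ _ hst h₁))) _).symm
  rw [act_lam (h := by rw [lact_L, h₂])]
  exact τ.tmul_congr (mul_lact _ _ _ h₂ h₁) rfl _

theorem act_rho_mul (x : X ⟶ τ.Q) (γ' γ : X ⟶ C.arr) (h : γ' ≫ C.c = γ ≫ C.d)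
    (hx : x ≫ τ.R = γ ≫ C.c) :
    act τ.rho x (C.mul γ' γ h) (by rw [IntGpd.mul_c, hx]) =
      act τ.rho (act τ.rho x γ hx) γ' (by rw [act_rho_R, h]) := by
  obtain ⟨X', e, s, t, hst, he, hs⟩ := τ.exists_cover_eq_tmul x
  have h₁ : t ≫ T.R = (e ≫ γ) ≫ C.c := by
    rw [Category.assoc, ← hx, reassoc_of% hs, tmul_R]
  have h₂ : (e ≫ γ') ≫ C.c = (e ≫ γ) ≫ C.d := by simp [h]
  rw [← cancel_epi e, comp_act, comp_act]
  refine (act_congr hs (IntGpd.comp_mul _ _ _ _) _).trans ?_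
  refine ((τ.act_rho _ _ _ hst (by rw [IntGpd.mul_c, h₁])).trans ?_).trans
    (act_congr ((comp_act _ _ _ _ _).trans ((act_congr hs rfl _).trans
      (τ.act_rho _ _ _ hst h₁))) rfl _).symm
  rw [act_rho (h := by rw [ract_R, h₂])]
  exact τ.tmul_congr rfl (ract_mul _ _ _ h₂ h₁) _

theorem act_lam_act_rho (α : X ⟶ A.arr) (x : X ⟶ τ.Q) (γ : X ⟶ C.arr)
    (hα : α ≫ A.d = x ≫ τ.L) (hγ : x ≫ τ.R = γ ≫ C.c) :
    act τ.rho (act τ.lam α x hα) γ (by rw [act_lam_R, hγ]) =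
      act τ.lam α (act τ.rho x γ hγ) (by rw [act_rho_L, hα]) := by
  obtain ⟨X', e, s, t, hst, he, hs⟩ := τ.exists_cover_eq_tmul x
  have h₁ : (e ≫ α) ≫ A.d = s ≫ S.L := by
    rw [Category.assoc, hα, reassoc_of% hs, tmul_L]
  have h₂ : t ≫ T.R = (e ≫ γ) ≫ C.c := by
    rw [Category.assoc, ← hγ, reassoc_of% hs, tmul_R]
  rw [← cancel_epi e, comp_act τ.rho e, comp_act τ.lam e α (act τ.rho x γ hγ)]
  refine (act_congr ((comp_act _ _ _ _ _).trans ((act_congr rfl hs _).trans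
    (τ.act_lam _ _ _ hst h₁))) rfl _).trans (Eq.trans ?_ (act_congr rfl ((comp_act _ _ _ _ _).trans
    ((act_congr hs rfl _).trans (τ.act_rho _ _ _ hst h₂))) _).symm)
  rw [act_rho (h := h₂), act_lam (h := h₁)]

/-- The composite distributor. -/
noncomputable def dist : IntDist A C where
  S₀ := τ.Q
  L := τ.L
  R := τ.R
  lam := τ.lam
  rho := τ.rho
  lam_L := τ.lam_L
  lam_R := τ.lam_R
  rho_L := τ.rho_L
  rho_R := τ.rho_R
  lam_one := (act_congr (by simp) rfl _).trans (τ.one_act_lam (𝟙 _))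
  rho_one := (act_congr rfl (by simp) _).trans (τ.act_rho_one (𝟙 _))
  lam_mul := τ.mul_act_lam
  rho_mul := τ.act_rho_mul
  lam_rho := τ.act_lam_act_rho

/-- The composite distributor as a tensor product. -/
noncomputable def tensor : Tensor S T where
  obj := τ.dist
  q := τ.q
  w := τ.isQuotient.w
  isColimit := τ.isQuotient.nonempty_isColimit.some
  q_L := τ.q_L
  q_R := τ.q_R
  lact_q α s t h hst := (τ.act_lam α s t hst h).symm
  ract_q s t γ hst h := (τ.act_rho s t γ hst h).symm

end TensorQuotient

variable (S T) in
/-- A chosen composite of two distributors. -/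
noncomputable def tensor : Tensor S T := (nonempty_tensorQuotient S T).some.tensor

end IntDist

/-! ### Discrete fibrations and final functors -/

namespace IntGpd

section

variable {E : Type u} [Category.{v} E] [HasFiniteLimits E] {A B C : IntGpd E}

theorem discreteFibration_of_isIso (F : A ⟶ B) [IsIso F] : discreteFibration E F := by
  have h₀ : IsIso F.f₀ := ⟨Hom.f₀ (CategoryTheory.inv F), congrArg Hom.f₀ (IsIso.hom_inv_id F),
    congrArg Hom.f₀ (IsIso.inv_hom_id F)⟩
  have h₁ : IsIso F.f₁ := ⟨Hom.f₁ (CategoryTheory.inv F), congrArg Hom.f₁ (IsIso.hom_inv_id F),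
    congrArg Hom.f₁ (IsIso.inv_hom_id F)⟩
  exact IsPullback.of_horiz_isIso ⟨F.map_c⟩

theorem discreteFibration_comp (F : A ⟶ B) (G : B ⟶ C) (hF : discreteFibration E F)
    (hG : discreteFibration E G) : discreteFibration E (F ≫ G) :=
  IsPullback.paste_horiz hF hG

theorem discreteFibration_of_comp (F : A ⟶ B) (G : B ⟶ C) (hG : discreteFibration E G)
    (h : discreteFibration E (F ≫ G)) : discreteFibration E F :=
  IsPullback.of_right h F.map_c hG

theorem final_of_isIso (F : A ⟶ B) [IsIso F] : final E F := fun X Y p _ f g h => by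
  refine ⟨CategoryTheory.inv F ≫ f, ⟨by simp, by simp [h]⟩, fun k hk => ?_⟩
  rw [← hk.1, IsIso.inv_hom_id_assoc]

theorem final_comp (F : A ⟶ B) (G : B ⟶ C) (hF : final E F) (hG : final E G) :
    final E (F ≫ G) := fun X Y p hp f g h => by
  obtain ⟨k, ⟨hk₁, hk₂⟩, hk⟩ := hF p hp f (G ≫ g) (by simpa using h)
  obtain ⟨l, ⟨hl₁, hl₂⟩, hl⟩ := hG p hp k g hk₂
  refine ⟨l, ⟨by rw [Category.assoc, hl₁, hk₁], hl₂⟩, fun l' hl' => ?_⟩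
  refine hl l' ⟨hk _ ⟨?_, ?_⟩, hl'.2⟩
  · simpa using hl'.1
  · rw [Category.assoc, hl'.2]

/-- The diagonal `k` for `F ≫ G` also works for `G`: both `G ≫ k` and `f` fill the same square from
`F` to `p`, and such fillers are unique. -/
theorem final_of_comp (F : A ⟶ B) (G : B ⟶ C) (hF : final E F) (h : final E (F ≫ G)) :
    final E G := fun X Y p hp f g hfg => by
  obtain ⟨k, ⟨hk₁, hk₂⟩, hk⟩ := h p hp (F ≫ f) g (by simp [hfg])
  refine ⟨k, ⟨?_, hk₂⟩, fun l hl => hk l ⟨by rw [Category.assoc, hl.1], hl.2⟩⟩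
  obtain ⟨m, -, hm⟩ := hF p hp (F ≫ f) (G ≫ g) (by simp [hfg])
  exact (hm _ ⟨by simpa using hk₁, by rw [Category.assoc, hk₂]⟩).trans (hm _ ⟨rfl, hfg⟩).symm

theorem isIso_of_final_of_discreteFibration (F : A ⟶ B) (h : final E F)
    (h' : discreteFibration E F) : IsIso F := by
  obtain ⟨k, ⟨hk₁, hk₂⟩, -⟩ := h F h' (𝟙 _) (𝟙 _) (by simp)
  exact ⟨k, hk₁, hk₂⟩

theorem inv_inv (Z : IntGpd E) {T : E} (η : T ⟶ Z.arr) : (η ≫ Z.inv) ≫ Z.inv = η := by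
  have h₁ := Z.mul_inv (η ≫ Z.inv)
  have h₂ := Z.inv_mul η
  rw [← Z.mul_id ((η ≫ Z.inv) ≫ Z.inv) (η ≫ Z.c) (by simp [Z.inv_c, Z.inv_d])]
  refine (mul_congr rfl ((Category.assoc _ _ _).trans h₂.symm) _).trans ?_
  rw [← Z.mul_assoc _ _ _ (by simp [Z.inv_c]) (by simp [Z.inv_c])]
  refine (mul_congr (Z.inv_mul (η ≫ Z.inv)) rfl _).trans ?_
  refine (mul_congr (Category.assoc _ _ _).symm rfl _).trans ?_
  exact Z.id_mul _ _ (by simp [Z.inv_c])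

variable {X Y : IntGpd E} {p : X ⟶ Y}

theorem discreteFibration_hom_ext (hp : discreteFibration E p) {T : E} {ξ ξ' : T ⟶ X.arr}
    (h₁ : ξ ≫ p.f₁ = ξ' ≫ p.f₁) (h₂ : ξ ≫ X.c = ξ' ≫ X.c) : ξ = ξ' :=
  IsPullback.hom_ext hp h₁ h₂

/-- Inversion exchanges domains and codomains, so a discrete fibration of groupoids also has unique
lifts with prescribed domain. -/
theorem discreteFibration_hom_ext' (hp : discreteFibration E p) {T : E} {ξ ξ' : T ⟶ X.arr}
    (h₁ : ξ ≫ p.f₁ = ξ' ≫ p.f₁) (h₂ : ξ ≫ X.d = ξ' ≫ X.d) : ξ = ξ' := by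
  rw [← X.inv_inv ξ, ← X.inv_inv ξ']
  congr 1
  apply discreteFibration_hom_ext hp
  · rw [Category.assoc, Category.assoc, p.map_inv, reassoc_of% h₁]
  · simp [X.inv_c, h₂]

theorem exists_lift_cod (hp : discreteFibration E p) {T : E} (x : T ⟶ X.obj) (y : T ⟶ Y.arr)
    (h : y ≫ Y.c = x ≫ p.f₀) :
    ∃ ξ : T ⟶ X.arr, ξ ≫ X.c = x ∧ ξ ≫ p.f₁ = y :=
  ⟨IsPullback.lift hp y x h, IsPullback.lift_snd _ _ _ _, IsPullback.lift_fst _ _ _ _⟩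

theorem exists_lift_dom (hp : discreteFibration E p) {T : E} (x : T ⟶ X.obj) (y : T ⟶ Y.arr)
    (h : y ≫ Y.d = x ≫ p.f₀) :
    ∃ ξ : T ⟶ X.arr, ξ ≫ X.d = x ∧ ξ ≫ p.f₁ = y := by
  obtain ⟨ξ, h₁, h₂⟩ := exists_lift_cod hp x (y ≫ Y.inv) (by simp [Y.inv_c, h])
  refine ⟨ξ ≫ X.inv, by simp [X.inv_d, h₁], ?_⟩
  rw [Category.assoc, p.map_inv, reassoc_of% h₂]
  simpa using Y.inv_inv y

end

/-! ### Locally full and essentially surjective functors are final -/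

section

variable {E : Type u} [Category.{v} E] [Regular E] {A B : IntGpd E}

/-- A functor that is locally full and locally essentially surjective on objects. -/
structure IsLocallyFullEso (F : A ⟶ B) : Prop where
  eso : ∀ {T : E} (b : T ⟶ B.obj), ∃ (T' : E) (e : T' ⟶ T) (a : T' ⟶ A.obj) (β : T' ⟶ B.arr),
    IsRegularEpi e ∧ β ≫ B.d = a ≫ F.f₀ ∧ β ≫ B.c = e ≫ b
  full : ∀ {T : E} (a a' : T ⟶ A.obj) (β : T ⟶ B.arr), β ≫ B.d = a ≫ F.f₀ → β ≫ B.c = a' ≫ F.f₀ →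
    ∃ (T' : E) (e : T' ⟶ T) (α : T' ⟶ A.arr), IsRegularEpi e ∧ α ≫ A.d = e ≫ a ∧
      α ≫ A.c = e ≫ a' ∧ α ≫ F.f₁ = e ≫ β

variable {F : A ⟶ B} {X Y : IntGpd E} {p : X ⟶ Y} (f : A ⟶ X) (g : B ⟶ Y)

/-- Well-definedness of the diagonal. Its value at `b` has to be the codomain of the lift of `g β`
starting at `f a`, for any arrow `β` from `F a` to `b`. Two choices differ by `β` followed by the
inverse of `β'`, which fullness lifts locally to an arrow `α` of `A`, and `f α` relates the two
lifts. -/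
theorem IsLocallyFullEso.lift_cod_unique (hF : IsLocallyFullEso F) (hp : discreteFibration E p)
    (h : f ≫ p = F ≫ g) {T : E} (a a' : T ⟶ A.obj) (β β' : T ⟶ B.arr)
    (hβ : β ≫ B.d = a ≫ F.f₀) (hβ' : β' ≫ B.d = a' ≫ F.f₀) (hc : β ≫ B.c = β' ≫ B.c)
    (ξ ξ' : T ⟶ X.arr) (h₁ : ξ ≫ X.d = a ≫ f.f₀) (h₂ : ξ ≫ p.f₁ = β ≫ g.f₁)
    (h₁' : ξ' ≫ X.d = a' ≫ f.f₀) (h₂' : ξ' ≫ p.f₁ = β' ≫ g.f₁) : ξ ≫ X.c = ξ' ≫ X.c := by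
  have hw : β ≫ B.c = (β' ≫ B.inv) ≫ B.d := by rw [Category.assoc, B.inv_d, hc]
  obtain ⟨T', e, α, he, hα, hα', hαF⟩ := hF.full a a' (B.mul β (β' ≫ B.inv) hw)
    (by rw [mul_d, hβ]) (by rw [mul_c, Category.assoc, B.inv_c, hβ'])
  have hcomp : (α ≫ f.f₁) ≫ X.c = (e ≫ ξ') ≫ X.d := by
    rw [Category.assoc, f.map_c, reassoc_of% hα', Category.assoc, h₁']
  have hf₁ : f.f₁ ≫ p.f₁ = F.f₁ ≫ g.f₁ := congrArg Hom.f₁ h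
  -- Both sides start at the same object and lie over `g β`, since `β` is `F α` followed by `β'`.
  have key : e ≫ ξ = X.mul (α ≫ f.f₁) (e ≫ ξ') hcomp := by
    apply discreteFibration_hom_ext' hp
    · have hαβ : (α ≫ F.f₁) ≫ B.c = (e ≫ β') ≫ B.d := by
        rw [Category.assoc, F.map_c, reassoc_of% hα', Category.assoc, hβ']
      have hβ₂ : e ≫ β = B.mul (α ≫ F.f₁) (e ≫ β') hαβ := by
        refine Eq.symm ((mul_congr (hαF.trans (comp_mul _ _ _ _)) rfl _).trans ?_)
        rw [mul_assoc _ _ _ (by simp [hw]) (by simp [B.inv_c])]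
        refine (mul_congr rfl ((mul_congr (Category.assoc _ _ _).symm rfl _).trans
          (B.inv_mul (e ≫ β'))) _).trans ?_
        refine (mul_congr rfl (Category.assoc _ _ _).symm _).trans ?_
        exact B.mul_id _ _ (by simp [hc])
      rw [Category.assoc, h₂, ← Category.assoc, hβ₂, g.map_mul, p.map_mul]
      apply mul_congr
      · simp [hf₁]
      · simp [h₂']
    · rw [mul_d, Category.assoc, h₁, Category.assoc, f.map_d, reassoc_of% hα]
  rw [← cancel_epi e, ← Category.assoc, key, mul_c, Category.assoc]

theorem IsLocallyFullEso.exists_diagonal (hF : IsLocallyFullEso F) (hp : discreteFibration E p)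
    (h : f ≫ p = F ≫ g) : ∃ K : B ⟶ X, F ≫ K = f ∧ K ≫ p = g := by
  have hf₀ : f.f₀ ≫ p.f₀ = F.f₀ ≫ g.f₀ := congrArg Hom.f₀ h
  have hf₁ : f.f₁ ≫ p.f₁ = F.f₁ ≫ g.f₁ := congrArg Hom.f₁ h
  obtain ⟨T, e, a, β, he, hβ, hβ'⟩ := hF.eso (𝟙 B.obj)
  rw [Category.comp_id] at hβ'
  obtain ⟨ξ, hξ, hξ'⟩ := exists_lift_dom hp (a ≫ f.f₀) (β ≫ g.f₁)
    (by rw [Category.assoc, g.map_d, reassoc_of% hβ, Category.assoc, hf₀])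
  -- The object part is defined on the cover supplied by essential surjectivity at the universal
  -- element of `B.obj`.
  obtain ⟨K₀, hK₀⟩ := exists_desc e (ξ ≫ X.c) (fun u v huv => ⟨_, 𝟙 _, inferInstance, by
    simpa using hF.lift_cod_unique f g hp h (u ≫ a) (v ≫ a) (u ≫ β) (v ≫ β)
      (by simp [hβ]) (by simp [hβ]) (by simp [hβ', huv]) (u ≫ ξ) (v ≫ ξ) (by simp [hξ])
      (by simp [hξ']) (by simp [hξ]) (by simp [hξ'])⟩)
  -- The object part may be computed from any arrow out of an image, not only from the one chosen
  -- above.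
  have hK : ∀ {T : E} (a : T ⟶ A.obj) (β : T ⟶ B.arr) (ξ : T ⟶ X.arr), β ≫ B.d = a ≫ F.f₀ →
      ξ ≫ X.d = a ≫ f.f₀ → ξ ≫ p.f₁ = β ≫ g.f₁ → β ≫ B.c ≫ K₀ = ξ ≫ X.c := by
    intro T' a' β₁ ξ₁ h₁ h₂ h₃
    obtain ⟨T'', e', y, he', hy⟩ := exists_cover_lift e (β₁ ≫ B.c)
    rw [← cancel_epi e', ← reassoc_of% hy, hK₀]
    simpa using hF.lift_cod_unique f g hp h (y ≫ a) (e' ≫ a') (y ≫ β) (e' ≫ β₁)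
      (by simp [hβ]) (by simp [h₁]) (by simp [hβ', hy]) (y ≫ ξ) (e' ≫ ξ₁) (by simp [hξ])
      (by simp [hξ']) (by simp [h₂]) (by simp [h₃])
  have hK₀p : K₀ ≫ p.f₀ = g.f₀ := by
    rw [← cancel_epi e, reassoc_of% hK₀, ← p.map_c, reassoc_of% hξ', g.map_c, reassoc_of% hβ']
  -- The arrow part is forced: it is the lift of `g.f₁` whose codomain is `B.c ≫ K₀`. What remains
  -- to be shown is that its domain is right.
  obtain ⟨K₁, hK₁, hK₁'⟩ := exists_lift_cod hp (B.c ≫ K₀) g.f₁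
    (by rw [g.map_c, Category.assoc, hK₀p])
  have hK₁d : K₁ ≫ X.d = B.d ≫ K₀ := by
    obtain ⟨T', e', y, he', hy⟩ := exists_cover_lift e B.d
    have hβb : (y ≫ β) ≫ B.c = e' ≫ B.d := by rw [Category.assoc, hβ', hy]
    -- Lift the same arrow from the expected domain instead. Preceded by `ξ`, it is a lift of a
    -- composite starting at an image, so `hK` identifies its codomain, and uniqueness of lifts then
    -- gives `η = K₁` over the cover.
    obtain ⟨η, hη, hη'⟩ := exists_lift_dom hp (y ≫ ξ ≫ X.c) (e' ≫ g.f₁)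
      (by rw [Category.assoc, Category.assoc, Category.assoc, g.map_d, ← p.map_c,
        reassoc_of% hξ', g.map_c, reassoc_of% hβ', reassoc_of% hy])
    have hcomp : (y ≫ ξ) ≫ X.c = η ≫ X.d := by rw [Category.assoc, hη]
    have h₁ := hK (y ≫ a) (B.mul (y ≫ β) e' hβb) (X.mul (y ≫ ξ) η hcomp)
      (by rw [mul_d, Category.assoc, Category.assoc, hβ])
      (by rw [mul_d, Category.assoc, Category.assoc, hξ])
      (by rw [p.map_mul, g.map_mul]; exact mul_congr (by simp [hξ']) hη' _)
    rw [← Category.assoc, mul_c, mul_c, Category.assoc] at h₁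
    have h₂ : e' ≫ K₁ = η := discreteFibration_hom_ext hp (by rw [Category.assoc, hK₁', hη'])
      (by rw [Category.assoc, hK₁, h₁])
    rw [← cancel_epi e', reassoc_of% h₂, hη, ← reassoc_of% hy, hK₀]
  have hF₀ : F.f₀ ≫ K₀ = f.f₀ := by
    -- On an image the identity arrow can be used, whose lift is an identity.
    have h₁ := hK (𝟙 _) (F.f₀ ≫ B.e) (f.f₀ ≫ X.e) (by simp [B.e_d]) (by simp [X.e_d])
      (by rw [Category.assoc, Category.assoc, p.map_e, g.map_e, reassoc_of% hf₀])
    simpa [reassoc_of% B.e_c, X.e_c] using h₁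
  refine ⟨⟨K₀, K₁, hK₁d, hK₁, ?_, ?_⟩, ?_, ?_⟩
  · apply discreteFibration_hom_ext hp
    · rw [Category.assoc, Category.assoc, hK₁', p.map_e, reassoc_of% hK₀p, g.map_e]
    · rw [Category.assoc, Category.assoc, hK₁, X.e_c, reassoc_of% B.e_c, Category.comp_id]
  · apply discreteFibration_hom_ext hp
    · rw [Category.assoc, hK₁', g.map_m, p.map_mul]
      apply mul_congr <;> rw [Category.assoc, hK₁']
    · rw [mul_c, Category.assoc, Category.assoc, hK₁, reassoc_of% B.m_c]
  · refine hom_ext hF₀ (discreteFibration_hom_ext hp ?_ ?_)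
    · rw [hf₁]
      exact (Category.assoc _ _ _).trans (congrArg (F.f₁ ≫ ·) hK₁')
    · refine (Category.assoc _ _ _).trans ((congrArg (F.f₁ ≫ ·) hK₁).trans ?_)
      rw [f.map_c, ← hF₀, ← Category.assoc, F.map_c, Category.assoc]
  · exact hom_ext hK₀p hK₁'

theorem IsLocallyFullEso.final (hF : IsLocallyFullEso F) : final E F := by
  intro X Y p hp f g h
  obtain ⟨K, hK, hK'⟩ := hF.exists_diagonal f g hp h
  refine ⟨K, ⟨hK, hK'⟩, fun L hL => ?_⟩
  obtain ⟨T, e, a, β, he, hβ, hβ'⟩ := hF.eso (𝟙 B.obj)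
  rw [Category.comp_id] at hβ'
  have h₀ : L.f₀ = K.f₀ := by
    -- Two diagonals agree at the domain of `β`, which is an image, and over `Y`. Unique lifting
    -- makes them agree on `β`, hence at its codomain.
    have h₁ : β ≫ L.f₁ = β ≫ K.f₁ := by
      apply discreteFibration_hom_ext' hp
      · have h₁ := congrArg Hom.f₁ (hL.2.trans hK'.symm)
        simp only [comp_f₁] at h₁
        rw [Category.assoc, h₁, Category.assoc]
      · have h₁ := congrArg Hom.f₀ (hL.1.trans hK.symm)
        simp only [comp_f₀] at h₁
        rw [Category.assoc, L.map_d, Category.assoc, K.map_d, reassoc_of% hβ, h₁, reassoc_of% hβ]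
    rw [← cancel_epi e, ← hβ', Category.assoc, Category.assoc, ← L.map_c, ← K.map_c,
      reassoc_of% h₁]
  refine hom_ext h₀ (discreteFibration_hom_ext hp ?_ ?_)
  · exact congrArg Hom.f₁ (hL.2.trans hK'.symm)
  · rw [L.map_c, K.map_c, h₀]

end

end IntGpd

/-! ### Levelwise computation of finite limits of internal groupoids -/

namespace IntGpd

section

variable {E : Type u} [Category.{v} E] [HasFiniteLimits E]

variable (E) in
/-- The functor sending an internal groupoid to its object of objects. -/
def objFunctor : IntGpd E ⥤ E where
  obj A := A.obj
  map F := F.f₀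

variable (E) in
/-- The functor sending an internal groupoid to its object of arrows. -/
def arrFunctor : IntGpd E ⥤ E where
  obj A := A.arr
  map F := F.f₁

variable {P A B C : IntGpd E} {a : P ⟶ A} {b : P ⟶ B} {F : A ⟶ C} {G : B ⟶ C}

/-- Any pullback of groupoids is isomorphic to the explicit one `pullbackGpd`, whose levels are
pullbacks by construction. The arrow level is treated in the same way. -/
theorem isPullback_f₀ (h : IsPullback a b F G) : IsPullback a.f₀ b.f₀ F.f₀ G.f₀ := by
  let i := h.isoIsPullback _ _ (pullbackGpd_isPullback F G)
  refine IsPullback.of_iso_pullback ⟨congrArg Hom.f₀ h.w⟩ ((objFunctor E).mapIso i) ?_ ?_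
  · exact congrArg Hom.f₀ (h.isoIsPullback_hom_fst _ _ (pullbackGpd_isPullback F G))
  · exact congrArg Hom.f₀ (h.isoIsPullback_hom_snd _ _ (pullbackGpd_isPullback F G))

theorem isPullback_f₁ (h : IsPullback a b F G) : IsPullback a.f₁ b.f₁ F.f₁ G.f₁ := by
  let i := h.isoIsPullback _ _ (pullbackGpd_isPullback F G)
  refine IsPullback.of_iso_pullback ⟨congrArg Hom.f₁ h.w⟩ ((arrFunctor E).mapIso i) ?_ ?_
  · exact congrArg Hom.f₁ (h.isoIsPullback_hom_fst _ _ (pullbackGpd_isPullback F G))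
  · exact congrArg Hom.f₁ (h.isoIsPullback_hom_snd _ _ (pullbackGpd_isPullback F G))

end

end IntGpd

namespace Spans

variable {E : Type u} [Category.{v} E] [HasFiniteLimits E] {A B C : IntGpd E}
  (S : Spans A B) (T : Spans B C)

theorem isPullback_comp_f₀ : IsPullback (p₁ S T).f₀ (p₂ S T).f₀ S.r.f₀ T.l.f₀ :=
  IntGpd.isPullback_f₀ (IsPullback.of_hasPullback S.r T.l)

theorem isPullback_comp_f₁ : IsPullback (p₁ S T).f₁ (p₂ S T).f₁ S.r.f₁ T.l.f₁ :=
  IntGpd.isPullback_f₁ (IsPullback.of_hasPullback S.r T.l)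

end Spans

/-! ### Morphisms of spans into the span of a distributor -/

namespace IntDist

section

variable {E : Type u} [Category.{v} E] [HasFiniteLimits E] {A B : IntGpd E} {S : IntDist A B}
  {X : Spans A B}

theorem elGpd_mul {T : E} (f g : T ⟶ S.elArr) (h : f ≫ S.elCod = g ≫ S.elDom) :
    S.elGpd.mul f g h = elMul f g h := by
  refine (comp_elMul (h := pullback.condition) _).trans ?_
  congr 1
  · exact pullback.lift_fst _ _ _
  · exact pullback.lift_snd _ _ _

theorem lact_spanHom_condition {f : X.apex.obj ⟶ S.S₀} (hL : f ≫ S.L = X.l.f₀) :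
    X.l.f₁ ≫ A.d = (X.apex.d ≫ f) ≫ S.L := by rw [Category.assoc, hL, X.l.map_d]

theorem ract_spanHom_condition {f : X.apex.obj ⟶ S.S₀} (hR : f ≫ S.R = X.r.f₀) :
    (X.apex.c ≫ f) ≫ S.R = X.r.f₁ ≫ B.c := by rw [Category.assoc, hR, X.r.map_c]

theorem spanHom_map_m (f : X.apex.obj ⟶ S.S₀) (hL : f ≫ S.L = X.l.f₀)
    (hR : f ≫ S.R = X.r.f₀) (h : S.lact X.l.f₁ (X.apex.d ≫ f) (lact_spanHom_condition hL) =
      S.ract (X.apex.c ≫ f) X.r.f₁ (ract_spanHom_condition hR)) :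
    X.apex.m ≫ elMk X.l.f₁ (X.apex.d ≫ f) (X.apex.c ≫ f) X.r.f₁ (lact_spanHom_condition hL)
        (ract_spanHom_condition hR) h =
      elMul (pullback.fst X.apex.c X.apex.d ≫ elMk X.l.f₁ (X.apex.d ≫ f) (X.apex.c ≫ f) X.r.f₁
          (lact_spanHom_condition hL) (ract_spanHom_condition hR) h)
        (pullback.snd X.apex.c X.apex.d ≫ elMk X.l.f₁ (X.apex.d ≫ f) (X.apex.c ≫ f) X.r.f₁
          (lact_spanHom_condition hL) (ract_spanHom_condition hR) h)
        (by simp only [Category.assoc, elMk_elCod, elMk_elDom, pullback.condition_assoc]) := by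
  apply el_hom_ext
  · rw [Category.assoc, elMk_elA, elMul_elA, X.l.map_m]
    apply IntGpd.mul_congr <;> simp
  · simp [reassoc_of% X.apex.m_d]
  · simp [reassoc_of% X.apex.m_c]
  · rw [Category.assoc, elMk_elB, elMul_elB, X.r.map_m]
    apply IntGpd.mul_congr <;> simp

/-- The morphism of spans into the span of a distributor with a given object part. -/
noncomputable def spanHom (f : X.apex.obj ⟶ S.S₀) (hL : f ≫ S.L = X.l.f₀)
    (hR : f ≫ S.R = X.r.f₀) (h : S.lact X.l.f₁ (X.apex.d ≫ f) (lact_spanHom_condition hL) =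
      S.ract (X.apex.c ≫ f) X.r.f₁ (ract_spanHom_condition hR)) : X ⟶ S.elSpan where
  hom :=
    { f₀ := f
      f₁ := elMk X.l.f₁ (X.apex.d ≫ f) (X.apex.c ≫ f) X.r.f₁ (lact_spanHom_condition hL)
        (ract_spanHom_condition hR) h
      map_d := elMk_elDom
      map_c := elMk_elCod
      map_e := by
        change X.apex.e ≫ elMk _ _ _ _ _ _ _ = f ≫ elMk _ _ _ _ _ _ _
        apply el_hom_ext
        · simp [X.l.map_e, ← hL]
        · simp [reassoc_of% X.apex.e_d]
        · simp [reassoc_of% X.apex.e_c]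
        · simp [X.r.map_e, ← hR]
      map_m := by
        exact (spanHom_map_m f hL hR h).trans (elGpd_mul (S := S) _ _ _).symm }
  hom_l := IntGpd.hom_ext hL elMk_elA
  hom_r := IntGpd.hom_ext hR elMk_elB

/-- The object part of a morphism of spans into the span of a distributor. -/
def homObj (F : X ⟶ S.elSpan) : X.apex.obj ⟶ S.S₀ := F.hom.f₀

/-- The arrow part of a morphism of spans into the span of a distributor. -/
noncomputable def homArr (F : X ⟶ S.elSpan) : X.apex.arr ⟶ S.elArr := F.hom.f₁

variable (F : X ⟶ S.elSpan)

theorem homObj_L : homObj F ≫ S.L = X.l.f₀ := congrArg IntGpd.Hom.f₀ F.hom_l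

theorem homObj_R : homObj F ≫ S.R = X.r.f₀ := congrArg IntGpd.Hom.f₀ F.hom_r

theorem homArr_elA : homArr F ≫ S.elA = X.l.f₁ := congrArg IntGpd.Hom.f₁ F.hom_l

theorem homArr_elB : homArr F ≫ S.elB = X.r.f₁ := congrArg IntGpd.Hom.f₁ F.hom_r

theorem homArr_elDom : homArr F ≫ S.elDom = X.apex.d ≫ homObj F := F.hom.map_d

theorem homArr_elCod : homArr F ≫ S.elCod = X.apex.c ≫ homObj F := F.hom.map_c

variable {F} in
-- An arrow of the groupoid of a distributor consists of `α`, `β` and its two ends. The legs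
-- prescribe `α` and `β`, and the object part prescribes the ends. For this reason equations between
-- 2-cells will only be checked on objects.
theorem hom_elSpan_ext {G : X ⟶ S.elSpan} (h : homObj F = homObj G) : F = G := by
  ext1
  refine IntGpd.hom_ext h (el_hom_ext ?_ ?_ ?_ ?_)
  · exact (homArr_elA F).trans (homArr_elA G).symm
  · exact (homArr_elDom F).trans ((congrArg (_ ≫ ·) h).trans (homArr_elDom G).symm)
  · exact (homArr_elCod F).trans ((congrArg (_ ≫ ·) h).trans (homArr_elCod G).symm)
  · exact (homArr_elB F).trans (homArr_elB G).symm

/-- The condition required by `spanHom` is also necessary: it is the equation carried by the image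
of each arrow. -/
theorem lact_homObj {T : E} (ξ : T ⟶ X.apex.arr) :
    S.lact (ξ ≫ X.l.f₁) (ξ ≫ X.apex.d ≫ homObj F)
        (by rw [Category.assoc, Category.assoc, Category.assoc, homObj_L, X.l.map_d]) =
      S.ract (ξ ≫ X.apex.c ≫ homObj F) (ξ ≫ X.r.f₁)
        (by rw [Category.assoc, Category.assoc, Category.assoc, homObj_R, X.r.map_c]) := by
  refine (lact_congr ?_ ?_ _).trans ((el_lact' (ξ ≫ homArr F)).trans (ract_congr ?_ ?_ _))
  · rw [Category.assoc, homArr_elA]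
  · rw [Category.assoc, homArr_elDom]
  · rw [Category.assoc, homArr_elCod]
  · rw [Category.assoc, homArr_elB]

end

/-! ### The embedding of distributors in spans is fully faithful -/

section

variable {E : Type u} [Category.{v} E] [HasFiniteLimits E] {A B : IntGpd E}

instance : (elements A B).Faithful where
  map_injective h := IntDist.Hom.ext (congrArg (fun k => IntGpd.Hom.f₀ (Span.Hom.hom k)) h)

variable {S T : IntDist A B} (F : S.elSpan ⟶ T.elSpan)

/-- The morphism between the objects of elements of two distributors underlying a morphism between
their spans. -/
def elHom : S.S₀ ⟶ T.S₀ := F.hom.f₀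

theorem elHom_L : elHom F ≫ T.L = S.L := homObj_L F

theorem elHom_R : elHom F ≫ T.R = S.R := homObj_R F

theorem lact_elHom' {X : E} (ξ : X ⟶ S.elArr) :
    T.lact (ξ ≫ S.elA) (ξ ≫ S.elDom ≫ elHom F)
        (by rw [Category.assoc, Category.assoc, Category.assoc, elHom_L, elA_d]) =
      T.ract (ξ ≫ S.elCod ≫ elHom F) (ξ ≫ S.elB)
        (by rw [Category.assoc, Category.assoc, Category.assoc, elHom_R, elCod_R]) :=
  lact_homObj F ξ

/-- Equivariance on the left is read off from the image of the arrow `(α, 1)` from `s` to `α · s`.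
On the right the arrow `(1, β)` from `s · β` to `s` plays the same role. -/
theorem lact_elHom {X : E} (α : X ⟶ A.arr) (s : X ⟶ S.S₀) (h : α ≫ A.d = s ≫ S.L) :
    S.lact α s h ≫ elHom F = T.lact α (s ≫ elHom F) (by rw [Category.assoc, elHom_L, h]) := by
  have := lact_elHom' F (elMk α s (S.lact α s h) ((s ≫ S.R) ≫ B.e) h
    (by rw [lact_R, Category.assoc _ B.e, B.e_c, Category.comp_id])
    (ract_one _ _ (by rw [lact_R])).symm)
  refine Eq.symm ((lact_congr ?_ ?_ _).trans (this.trans ((ract_congr ?_ ?_ _).trans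
    (T.ract_one (S.lact α s h ≫ elHom F) (s ≫ S.R)
      (by rw [Category.assoc, elHom_R, lact_R]))))) <;> simp

theorem ract_elHom {X : E} (s : X ⟶ S.S₀) (β : X ⟶ B.arr) (h : s ≫ S.R = β ≫ B.c) :
    S.ract s β h ≫ elHom F = T.ract (s ≫ elHom F) β (by rw [Category.assoc, elHom_R, h]) := by
  have := lact_elHom' F (elMk ((s ≫ S.L) ≫ A.e) (S.ract s β h) s β
    (by rw [ract_L, Category.assoc _ A.e, A.e_d, Category.comp_id]) h
    (one_lact _ _ (by rw [ract_L])))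
  refine Eq.symm ((ract_congr ?_ ?_ _).trans (this.symm.trans ((lact_congr ?_ ?_ _).trans
    (T.one_lact (S.ract s β h ≫ elHom F) (s ≫ S.L)
      (by rw [Category.assoc, elHom_L, ract_L]))))) <;> simp

instance : (elements A B).Full where
  map_surjective {S T} F := by
    refine ⟨⟨elHom F, elHom_L F, elHom_R F, ?_, ?_⟩, hom_elSpan_ext rfl⟩
    · refine Eq.trans (congrArg (· ≫ _) ?_)
        (lact_elHom F (pullback.fst A.d S.L) (pullback.snd A.d S.L) pullback.condition)
      refine (Category.id_comp _).symm.trans (congrArg (· ≫ S.lam) ?_)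
      apply pullback.hom_ext <;> simp
    · refine Eq.trans (congrArg (· ≫ _) ?_)
        (ract_elHom F (pullback.fst S.R B.c) (pullback.snd S.R B.c) pullback.condition)
      refine (Category.id_comp _).symm.trans (congrArg (· ≫ S.rho) ?_)
      apply pullback.hom_ext <;> simp

end

/-! ### A criterion for locally full and essentially surjective morphisms into the span of a
distributor -/

section

variable {E : Type u} [Category.{v} E] [Regular E] {A B : IntGpd E} {S : IntDist A B}
  {X : Spans A B}

/-- Arrows of the target are unfolded into equations `α · s = s' · β`, so that the criterion can be
verified by computing in the distributor. -/
theorem isLocallyFullEso_of_elements (F : X ⟶ S.elSpan)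
    (eso : ∀ {T : E} (s : T ⟶ S.S₀), ∃ (T' : E) (e : T' ⟶ T) (x : T' ⟶ X.apex.obj)
      (α : T' ⟶ A.arr) (β : T' ⟶ B.arr) (h₁ : α ≫ A.d = (x ≫ homObj F) ≫ S.L)
      (h₂ : (e ≫ s) ≫ S.R = β ≫ B.c), IsRegularEpi e ∧
      S.lact α (x ≫ homObj F) h₁ = S.ract (e ≫ s) β h₂)
    (full : ∀ {T : E} (x x' : T ⟶ X.apex.obj) (α : T ⟶ A.arr) (β : T ⟶ B.arr)
      (h₁ : α ≫ A.d = (x ≫ homObj F) ≫ S.L) (h₂ : (x' ≫ homObj F) ≫ S.R = β ≫ B.c),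
      S.lact α (x ≫ homObj F) h₁ = S.ract (x' ≫ homObj F) β h₂ →
      ∃ (T' : E) (e : T' ⟶ T) (ξ : T' ⟶ X.apex.arr), IsRegularEpi e ∧ ξ ≫ X.apex.d = e ≫ x ∧
        ξ ≫ X.apex.c = e ≫ x' ∧ ξ ≫ X.l.f₁ = e ≫ α ∧ ξ ≫ X.r.f₁ = e ≫ β) :
    IntGpd.IsLocallyFullEso F.hom where
  eso s := by
    obtain ⟨T', e, x, α, β, h₁, h₂, he, h⟩ := eso s
    exact ⟨T', e, x, elMk α _ _ β h₁ h₂ h, he, elMk_elDom, elMk_elCod⟩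
  full {T} x x' (ξ : T ⟶ S.elArr) hd hc := by
    replace hd : ξ ≫ S.elDom = x ≫ homObj F := hd
    replace hc : ξ ≫ S.elCod = x' ≫ homObj F := hc
    obtain ⟨T', e, η, he, h₁, h₂, h₃, h₄⟩ := full x x' (ξ ≫ S.elA) (ξ ≫ S.elB)
      (by rw [← hd, Category.assoc, Category.assoc, elA_d])
      (by rw [← hc, Category.assoc, Category.assoc, elCod_R])
      ((lact_congr rfl hd.symm _).trans ((el_lact' ξ).trans (ract_congr hc rfl _)))
    refine ⟨T', e, η, he, h₁, h₂, show η ≫ homArr F = e ≫ ξ from el_hom_ext ?_ ?_ ?_ ?_⟩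
    · rw [Category.assoc, Category.assoc, homArr_elA, h₃]
    · rw [Category.assoc, Category.assoc, homArr_elDom, hd, reassoc_of% h₁]
    · rw [Category.assoc, Category.assoc, homArr_elCod, hc, reassoc_of% h₂]
    · rw [Category.assoc, Category.assoc, homArr_elB, h₄]

end

end IntDist

/-! ### Comparison of composites of spans and of distributors -/

namespace IntDist

namespace Tensor

section

variable {E : Type u} [Category.{v} E] [HasFiniteLimits E] {A B C : IntGpd E} {S : IntDist A B}
  {T : IntDist B C} (τ : Tensor S T) {X : E}

theorem tmul_congr {s s' : X ⟶ S.S₀} {t t' : X ⟶ T.S₀} (hs : s = s') (ht : t = t')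
    (h : s ≫ S.R = t ≫ T.L) : τ.tmul s t h = τ.tmul s' t' (by rw [← hs, ← ht, h]) := by
  subst hs ht; rfl

theorem comp_tmul {Y : E} (k : Y ⟶ X) (s : X ⟶ S.S₀) (t : X ⟶ T.S₀)
    (h : s ≫ S.R = t ≫ T.L) : k ≫ τ.tmul s t h = τ.tmul (k ≫ s) (k ≫ t) (by simp [h]) :=
  comp_lift_comp k s t h τ.q

theorem lact_tmul (α : X ⟶ A.arr) (s : X ⟶ S.S₀) (t : X ⟶ T.S₀) (hst : s ≫ S.R = t ≫ T.L)
    (h : α ≫ A.d = s ≫ S.L) : τ.obj.lact α (τ.tmul s t hst) (by rw [tmul_L, h]) =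
      τ.tmul (S.lact α s h) t (by rw [lact_R, hst]) :=
  (τ.lact_q α s t h hst).symm

theorem ract_tmul (s : X ⟶ S.S₀) (t : X ⟶ T.S₀) (γ : X ⟶ C.arr) (hst : s ≫ S.R = t ≫ T.L)
    (h : t ≫ T.R = γ ≫ C.c) : τ.obj.ract (τ.tmul s t hst) γ (by rw [tmul_R, h]) =
      τ.tmul s (T.ract t γ h) (by rw [ract_L, hst]) :=
  (τ.ract_q s t γ hst h).symm

theorem tmul_ract (s : X ⟶ S.S₀) (β : X ⟶ B.arr) (t : X ⟶ T.S₀) (h₁ : s ≫ S.R = β ≫ B.c)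
    (h₂ : β ≫ B.d = t ≫ T.L) : τ.tmul (S.ract s β h₁) t (by rw [ract_R, h₂]) =
      τ.tmul s (T.lact β t h₂) (by rw [lact_L, h₁]) := by
  rw [tmul, tmul, ← triplesMk_left S T s β t h₁ h₂, ← triplesMk_right S T s β t h₁ h₂,
    Category.assoc, Category.assoc, τ.w]

end

section

variable {E : Type u} [Category.{v} E] [BarrExact E] {A B C : IntGpd E} {S : IntDist A B}
  {T : IntDist B C} (τ : Tensor S T) {X : E}

theorem isQuotient : IsQuotient (triplesLeft S T) (triplesRight S T) τ.q :=
  (triples_isPregroupoid S T).isQuotient τ.w τ.isColimit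

theorem exists_arrow {s s' : X ⟶ S.S₀} {t t' : X ⟶ T.S₀} (h : s ≫ S.R = t ≫ T.L)
    (h' : s' ≫ S.R = t' ≫ T.L) (hst : τ.tmul s t h = τ.tmul s' t' h') :
    ∃ (X' : E) (e : X' ⟶ X) (β : X' ⟶ B.arr) (h₁ : (e ≫ s') ≫ S.R = β ≫ B.c)
      (h₂ : β ≫ B.d = (e ≫ t) ≫ T.L), IsRegularEpi e ∧
      e ≫ s = S.ract (e ≫ s') β h₁ ∧ e ≫ t' = T.lact β (e ≫ t) h₂ := by
  obtain ⟨X', e, β, h₁, h₂, he, h₃, h₄⟩ := τ.isQuotient.exists_arrow _ _ hst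
  simp only [pullback.lift_fst, pullback.lift_snd] at h₁ h₂ h₃ h₄
  exact ⟨X', e, β, h₁, h₂, he, h₃, h₄⟩

theorem exists_cover_eq_tmul (x : X ⟶ τ.obj.S₀) : ∃ (X' : E) (e : X' ⟶ X) (s : X' ⟶ S.S₀)
    (t : X' ⟶ T.S₀) (h : s ≫ S.R = t ≫ T.L), IsRegularEpi e ∧ e ≫ x = τ.tmul s t h := by
  have := τ.isQuotient.isRegularEpi
  obtain ⟨X', e, p, he, hp⟩ := exists_cover_lift τ.q x
  refine ⟨X', e, p ≫ pullback.fst _ _, p ≫ pullback.snd _ _,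
    by simp [pullback.condition], he, ?_⟩
  rw [← hp, tmul]
  congr 1
  apply pullback.hom_ext <;> simp

end

section

variable {E : Type u} [Category.{v} E] [HasFiniteLimits E] {A B C : IntGpd E} {S : IntDist A B}
  {T : IntDist B C} (τ : Tensor S T) {X : E}

/-! The projections from the apex of the composite of the spans of two distributors. -/

variable (S T) in
/-- The first component of an object of the composite of the spans of two distributors. -/
noncomputable def fst₀ : (Spans.comp S.elSpan T.elSpan).apex.obj ⟶ S.S₀ :=
  (Spans.p₁ S.elSpan T.elSpan).f₀

variable (S T) in
/-- The second component of an object of the composite of the spans of two distributors. -/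
noncomputable def snd₀ : (Spans.comp S.elSpan T.elSpan).apex.obj ⟶ T.S₀ :=
  (Spans.p₂ S.elSpan T.elSpan).f₀

variable (S T) in
/-- The first component of an arrow of the composite of the spans of two distributors. -/
noncomputable def fst₁ : (Spans.comp S.elSpan T.elSpan).apex.arr ⟶ S.elArr :=
  (Spans.p₁ S.elSpan T.elSpan).f₁

variable (S T) in
/-- The second component of an arrow of the composite of the spans of two distributors. -/
noncomputable def snd₁ : (Spans.comp S.elSpan T.elSpan).apex.arr ⟶ T.elArr :=
  (Spans.p₂ S.elSpan T.elSpan).f₁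

theorem isPullback₀ : IsPullback (fst₀ S T) (snd₀ S T) S.R T.L :=
  Spans.isPullback_comp_f₀ S.elSpan T.elSpan

theorem isPullback₁ : IsPullback (fst₁ S T) (snd₁ S T) S.elB T.elA :=
  Spans.isPullback_comp_f₁ S.elSpan T.elSpan

theorem fst₁_elDom : fst₁ S T ≫ S.elDom = (Spans.comp S.elSpan T.elSpan).apex.d ≫ fst₀ S T :=
  (Spans.p₁ S.elSpan T.elSpan).map_d

theorem fst₁_elCod : fst₁ S T ≫ S.elCod = (Spans.comp S.elSpan T.elSpan).apex.c ≫ fst₀ S T :=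
  (Spans.p₁ S.elSpan T.elSpan).map_c

theorem snd₁_elDom : snd₁ S T ≫ T.elDom = (Spans.comp S.elSpan T.elSpan).apex.d ≫ snd₀ S T :=
  (Spans.p₂ S.elSpan T.elSpan).map_d

theorem snd₁_elCod : snd₁ S T ≫ T.elCod = (Spans.comp S.elSpan T.elSpan).apex.c ≫ snd₀ S T :=
  (Spans.p₂ S.elSpan T.elSpan).map_c

theorem spanObj_eq : τ.spanObj = τ.tmul (fst₀ S T) (snd₀ S T) isPullback₀.w := rfl

/-- The arrow `β` shared by the two equations crosses the tensor sign: `α · (s ⊗ t) = (s' · β) ⊗ t =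
s' ⊗ (β · t) = (s' ⊗ t') · γ`. This makes `spanObj` compatible with the arrows of the composite
span. -/
theorem lact_spanObj {α : X ⟶ A.arr} {s s' : X ⟶ S.S₀} {β : X ⟶ B.arr} {t t' : X ⟶ T.S₀}
    {γ : X ⟶ C.arr} (hst : s ≫ S.R = t ≫ T.L) (hst' : s' ≫ S.R = t' ≫ T.L)
    (hα : α ≫ A.d = s ≫ S.L) (hβ : s' ≫ S.R = β ≫ B.c) (hβ' : β ≫ B.d = t ≫ T.L)
    (hγ : t' ≫ T.R = γ ≫ C.c) (h : S.lact α s hα = S.ract s' β hβ)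
    (h' : T.lact β t hβ' = T.ract t' γ hγ) :
    τ.obj.lact α (τ.tmul s t hst) (by rw [tmul_L, hα]) =
      τ.obj.ract (τ.tmul s' t' hst') γ (by rw [tmul_R, hγ]) := by
  rw [τ.lact_tmul α s t hst hα, τ.ract_tmul s' t' γ hst' hγ]
  refine (τ.tmul_congr h rfl _).trans ((τ.tmul_ract s' β t hβ hβ').trans (τ.tmul_congr rfl h' _))

theorem lact_spanObj_elements :
    τ.obj.lact (fst₁ S T ≫ S.elA) ((Spans.comp S.elSpan T.elSpan).apex.d ≫ τ.spanObj)
        (by rw [spanObj_eq, Category.assoc, Category.assoc, tmul_L, ← reassoc_of% fst₁_elDom,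
          elA_d]) =
      τ.obj.ract ((Spans.comp S.elSpan T.elSpan).apex.c ≫ τ.spanObj) (snd₁ S T ≫ T.elB)
        (by rw [spanObj_eq, Category.assoc, Category.assoc, tmul_R, ← reassoc_of% snd₁_elCod,
          elCod_R]) := by
  have hβ : fst₁ S T ≫ S.elB = snd₁ S T ≫ T.elA := isPullback₁.w
  refine (lact_congr rfl ?_ _).trans ((τ.lact_spanObj (α := fst₁ S T ≫ S.elA)
    (s := fst₁ S T ≫ S.elDom) (s' := fst₁ S T ≫ S.elCod) (β := fst₁ S T ≫ S.elB)
    (t := snd₁ S T ≫ T.elDom) (t' := snd₁ S T ≫ T.elCod) (γ := snd₁ S T ≫ T.elB)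
    ?_ ?_ ?_ ?_ ?_ ?_ ?_ ?_).trans (ract_congr ?_ rfl _))
  · rw [spanObj_eq, comp_tmul]
    exact τ.tmul_congr fst₁_elDom.symm snd₁_elDom.symm _
  · rw [fst₁_elCod, snd₁_elCod, Category.assoc, Category.assoc, isPullback₀.w]
  · rw [Category.assoc, Category.assoc, elA_d]
  · rw [Category.assoc, Category.assoc, elCod_R]
  · rw [hβ, Category.assoc, Category.assoc, elA_d]
  · rw [Category.assoc, Category.assoc, elCod_R]
  · exact el_lact' _
  · exact (lact_congr hβ rfl _).trans (el_lact' _)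
  · rw [spanObj_eq, comp_tmul]
    exact (τ.tmul_congr fst₁_elCod.symm snd₁_elCod.symm _).symm

/-- The comparison from the composite of the spans of two distributors to the span of their
composite. -/
noncomputable def spanMap : Spans.comp S.elSpan T.elSpan ⟶ τ.obj.elSpan :=
  spanHom τ.spanObj (τ.tmul_L _ _ _) (τ.tmul_R _ _ _) τ.lact_spanObj_elements

theorem spanMap_f₀ : IntGpd.Hom.f₀ τ.spanMap.hom = τ.spanObj := rfl

theorem homObj_spanMap : homObj τ.spanMap = τ.spanObj := rfl

end

/-! ### The comparison with the tensor product is final -/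

section

variable {E : Type u} [Category.{v} E] [BarrExact E] {A B C : IntGpd E} {S : IntDist A B}
  {T : IntDist B C} (τ : Tensor S T)

/-- On objects it is even locally surjective, since every element is locally a pure tensor. For
fullness, an arrow between pure tensors is an equation `(α · s) ⊗ t = s' ⊗ (t' · γ)`. Exactness
provides a local `β` with `α · s = s' · β` and `β · t = t' · γ`, that is, a pair of arrows of the
two groupoids with a common component in `B`. -/
theorem isLocallyFullEso_spanMap : IntGpd.IsLocallyFullEso τ.spanMap.hom := by
  apply isLocallyFullEso_of_elements
  · intro X x
    obtain ⟨X', e, s, t, h, he, hx⟩ := τ.exists_cover_eq_tmul x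
    have hy : isPullback₀.lift s t h ≫ homObj τ.spanMap = e ≫ x := by
      rw [homObj_spanMap, spanObj_eq, comp_tmul, hx]
      exact τ.tmul_congr (isPullback₀.lift_fst _ _ _) (isPullback₀.lift_snd _ _ _) _
    refine ⟨X', e, isPullback₀.lift s t h, ((e ≫ x) ≫ τ.obj.L) ≫ A.e, ((e ≫ x) ≫ τ.obj.R) ≫ C.e,
      by rw [hy, Category.assoc _ A.e, A.e_d, Category.comp_id],
      by rw [Category.assoc _ C.e, C.e_c, Category.comp_id], he, ?_⟩
    exact (lact_congr rfl hy _).trans ((one_lact _ _ rfl).trans (ract_one _ _ rfl).symm)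
  · intro X x x' α γ h₁ h₂ h
    let s := x ≫ fst₀ S T
    let t := x ≫ snd₀ S T
    let s' := x' ≫ fst₀ S T
    let t' := x' ≫ snd₀ S T
    have hst : s ≫ S.R = t ≫ T.L := by simp only [s, t, Category.assoc, isPullback₀.w]
    have hst' : s' ≫ S.R = t' ≫ T.L := by simp only [s', t', Category.assoc, isPullback₀.w]
    have hx : x ≫ homObj τ.spanMap = τ.tmul s t hst := τ.comp_tmul _ _ _ _
    have hx' : x' ≫ homObj τ.spanMap = τ.tmul s' t' hst' := τ.comp_tmul _ _ _ _
    have hα : α ≫ A.d = s ≫ S.L := by rw [h₁, hx, tmul_L]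
    have hγ : t' ≫ T.R = γ ≫ C.c := by rw [← h₂, hx', tmul_R]
    have key : τ.tmul (S.lact α s hα) t (by rw [lact_R, hst]) =
        τ.tmul s' (T.ract t' γ hγ) (by rw [ract_L, hst']) := by
      rw [← τ.lact_tmul α s t hst hα, ← τ.ract_tmul s' t' γ hst' hγ]
      exact (lact_congr rfl hx.symm _).trans (h.trans (ract_congr hx' rfl _))
    obtain ⟨X', e, β, k₁, k₂, he, k₃, k₄⟩ := τ.exists_arrow _ _ key
    rw [comp_lact] at k₃
    rw [comp_ract] at k₄
    let σ : X' ⟶ S.elArr := elMk (e ≫ α) (e ≫ s) (e ≫ s') β (by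
      rw [Category.assoc, Category.assoc e s, hα]) k₁ k₃
    let ρ : X' ⟶ T.elArr := elMk β (e ≫ t) (e ≫ t') (e ≫ γ) k₂ (by
      rw [Category.assoc, hγ, Category.assoc]) k₄.symm
    have hσρ : σ ≫ S.elB = ρ ≫ T.elA := elMk_elB.trans elMk_elA.symm
    have l₁ : isPullback₁.lift σ ρ hσρ ≫ fst₁ S T = σ := isPullback₁.lift_fst _ _ _
    have l₂ : isPullback₁.lift σ ρ hσρ ≫ snd₁ S T = ρ := isPullback₁.lift_snd _ _ _
    refine ⟨X', e, isPullback₁.lift σ ρ hσρ, he, ?_, ?_, ?_, ?_⟩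
    · apply isPullback₀.hom_ext
      · rw [Category.assoc, ← fst₁_elDom, reassoc_of% l₁, Category.assoc]
        exact elMk_elDom
      · rw [Category.assoc, ← snd₁_elDom, reassoc_of% l₂, Category.assoc]
        exact elMk_elDom
    · apply isPullback₀.hom_ext
      · rw [Category.assoc, ← fst₁_elCod, reassoc_of% l₁, Category.assoc]
        exact elMk_elCod
      · rw [Category.assoc, ← snd₁_elCod, reassoc_of% l₂, Category.assoc]
        exact elMk_elCod
    · exact ((Category.assoc _ _ _).symm.trans (congrArg (· ≫ S.elA) l₁)).trans elMk_elA
    · exact ((Category.assoc _ _ _).symm.trans (congrArg (· ≫ T.elB) l₂)).trans elMk_elB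

end

end Tensor

/-! ### Identity spans and identity distributors -/

section

variable {E : Type u} [Category.{v} E] [HasFiniteLimits E] (A : IntGpd E)

theorem one_lact_eq {X : E} (α s : X ⟶ A.arr) (h : α ≫ A.d = s ≫ A.c) :
    (one A).lact α s h = A.mul s α h.symm :=
  (IntGpd.comp_mul _ _ _ _).trans
    (IntGpd.mul_congr (pullback.lift_snd _ _ _) (pullback.lift_fst _ _ _) _)

theorem one_ract_eq {X : E} (s β : X ⟶ A.arr) (h : s ≫ A.d = β ≫ A.c) :
    (one A).ract s β h = A.mul β s h.symm :=
  (IntGpd.comp_mul _ _ _ _).trans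
    (IntGpd.mul_congr (pullback.lift_snd _ _ _) (pullback.lift_fst _ _ _) _)

/-- The comparison from the identity span to the span of the identity distributor. -/
noncomputable def oneMap : Spans.one A ⟶ (one A).elSpan :=
  spanHom (X := Spans.one A) (S := one A) A.e A.e_c A.e_d
    ((one_lact_eq A (𝟙 A.arr) (A.d ≫ A.e) (by simp [A.e_c])).trans
      ((A.id_mul (𝟙 A.arr) A.d (by simp)).trans
        ((A.mul_id (𝟙 A.arr) A.c (by simp)).symm.trans
          (one_ract_eq A (A.c ≫ A.e) (𝟙 A.arr) (by simp [A.e_d])).symm)))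

theorem oneMap_f₀ : IntGpd.Hom.f₀ (oneMap A).hom = A.e := rfl

end

section

variable {E : Type u} [Category.{v} E] [Regular E] (A : IntGpd E)

/-- No cover is needed. An arrow `s` of `A` is reached from the identity of its domain by the arrow
with components `s` and `1`, and an arrow between two identities has equal components `α = β`, hence
comes from `α`. -/
theorem isLocallyFullEso_oneMap : IntGpd.IsLocallyFullEso (oneMap A).hom := by
  apply isLocallyFullEso_of_elements
  · intro X (s : X ⟶ A.arr)
    refine ⟨X, 𝟙 X, s ≫ A.d, s, (s ≫ A.d) ≫ A.e, ?_, ?_, inferInstance, ?_⟩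
    · change s ≫ A.d = ((s ≫ A.d) ≫ A.e) ≫ A.c
      simp [A.e_c]
    · change (𝟙 X ≫ s) ≫ A.d = _
      simp [A.e_c]
    · refine (one_lact_eq A s ((s ≫ A.d) ≫ A.e) (by simp [A.e_c])).trans
        (Eq.trans ?_ (one_ract_eq A (𝟙 X ≫ s) ((s ≫ A.d) ≫ A.e) (by simp [A.e_c])).symm)
      exact IntGpd.mul_congr rfl (Category.id_comp _).symm _
  · intro X (x : X ⟶ A.obj) (x' : X ⟶ A.obj) α β h₁ h₂ h
    have k₁ : α ≫ A.d = (x ≫ A.e) ≫ A.c := h₁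
    have k₂ : (x' ≫ A.e) ≫ A.d = β ≫ A.c := h₂
    have key := (one_lact_eq A α (x ≫ A.e) k₁).symm.trans (h.trans
      (one_ract_eq A (x' ≫ A.e) β k₂))
    have k₁' : α ≫ A.d = x := by simpa [A.e_c] using k₁
    have k₂' : β ≫ A.c = x' := by simpa [A.e_d] using k₂.symm
    rw [A.id_mul α x k₁'.symm, A.mul_id β x' k₂'] at key
    subst key
    refine ⟨X, 𝟙 X, α, inferInstance, ?_, ?_, ?_, ?_⟩
    · exact k₁'.trans (Category.id_comp _).symm
    · exact k₂'.trans (Category.id_comp _).symm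
    · exact (Category.comp_id _).trans (Category.id_comp _).symm
    · exact (Category.comp_id _).trans (Category.id_comp _).symm

end

/-! ### The distributor of a cospan and the reflection of a span -/

section

variable {E : Type u} [Category.{v} E] [HasFiniteLimits E] {A B Y : IntGpd E} (G : A ⟶ Y)
  (H : B ⟶ Y)

/-- The object of generalized triples `(a, y, b)` with `y : H b ⟶ G a`. -/
noncomputable abbrev commaObj : E := pullback (pullback.snd G.f₀ Y.c ≫ Y.d) H.f₀

/-- The component `a`. -/
noncomputable def commaFst : commaObj G H ⟶ A.obj := pullback.fst _ _ ≫ pullback.fst _ _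

/-- The component `y`. -/
noncomputable def commaMid : commaObj G H ⟶ Y.arr := pullback.fst _ _ ≫ pullback.snd _ _

/-- The component `b`. -/
noncomputable def commaSnd : commaObj G H ⟶ B.obj := pullback.snd _ _

theorem commaMid_d : commaMid G H ≫ Y.d = commaSnd G H ≫ H.f₀ := by
  simp [commaMid, commaSnd, pullback.condition]

theorem commaMid_c : commaMid G H ≫ Y.c = commaFst G H ≫ G.f₀ := by
  simp [commaMid, commaFst, pullback.condition]

variable {G H} {X : E}

theorem comma_hom_ext {f g : X ⟶ commaObj G H} (h₁ : f ≫ commaFst G H = g ≫ commaFst G H)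
    (h₂ : f ≫ commaMid G H = g ≫ commaMid G H) (h₃ : f ≫ commaSnd G H = g ≫ commaSnd G H) :
    f = g := by
  apply pullback.hom_ext
  · apply pullback.hom_ext <;> simpa [commaFst, commaMid] using ‹_›
  · exact h₃

/-- The generalized triple with given components. -/
noncomputable def commaMk (a : X ⟶ A.obj) (y : X ⟶ Y.arr) (b : X ⟶ B.obj)
    (hd : y ≫ Y.d = b ≫ H.f₀) (hc : y ≫ Y.c = a ≫ G.f₀) : X ⟶ commaObj G H :=
  pullback.lift (pullback.lift a y hc.symm) b (by simp [hd])

variable {a : X ⟶ A.obj} {y : X ⟶ Y.arr} {b : X ⟶ B.obj} {hd : y ≫ Y.d = b ≫ H.f₀}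
  {hc : y ≫ Y.c = a ≫ G.f₀}

@[simp] theorem commaMk_fst : commaMk a y b hd hc ≫ commaFst G H = a := by
  simp [commaMk, commaFst]

@[simp] theorem commaMk_mid : commaMk a y b hd hc ≫ commaMid G H = y := by
  simp [commaMk, commaMid]

@[simp] theorem commaMk_snd : commaMk a y b hd hc ≫ commaSnd G H = b := by
  simp [commaMk, commaSnd]

theorem commaMk_congr {a' : X ⟶ A.obj} {y' : X ⟶ Y.arr} {b' : X ⟶ B.obj} (ha : a = a')
    (hy : y = y') (hb : b = b') : commaMk (G := G) (H := H) a y b hd hc =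
      commaMk a' y' b' (by rw [← hy, ← hb, hd]) (by rw [← hy, ← ha, hc]) := by
  subst ha hy hb; rfl

theorem comp_commaMk {Z : E} (k : Z ⟶ X) : k ≫ commaMk (G := G) (H := H) a y b hd hc =
    commaMk (k ≫ a) (k ≫ y) (k ≫ b) (by simp [hd]) (by simp [hc]) := by
  apply comma_hom_ext <;> simp

theorem exists_commaMk (s : X ⟶ commaObj G H) : ∃ (a : X ⟶ A.obj) (y : X ⟶ Y.arr)
    (b : X ⟶ B.obj) (hd : y ≫ Y.d = b ≫ H.f₀) (hc : y ≫ Y.c = a ≫ G.f₀),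
    s = commaMk a y b hd hc :=
  ⟨s ≫ commaFst G H, s ≫ commaMid G H, s ≫ commaSnd G H, by simp [commaMid_d],
    by simp [commaMid_c], by apply comma_hom_ext <;> simp⟩

/-- The left action on generalized triples. -/
noncomputable def commaLact (α : X ⟶ A.arr) (s : X ⟶ commaObj G H)
    (h : α ≫ A.d = s ≫ commaFst G H) : X ⟶ commaObj G H :=
  commaMk (α ≫ A.c)
    (Y.mul (s ≫ commaMid G H) (α ≫ G.f₁) (by
      rw [Category.assoc, commaMid_c, Category.assoc, G.map_d, reassoc_of% h]))
    (s ≫ commaSnd G H) (by rw [IntGpd.mul_d, Category.assoc, Category.assoc, commaMid_d])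
    (by rw [IntGpd.mul_c, Category.assoc, Category.assoc, G.map_c])

/-- The right action on generalized triples. -/
noncomputable def commaRact (s : X ⟶ commaObj G H) (β : X ⟶ B.arr)
    (h : s ≫ commaSnd G H = β ≫ B.c) : X ⟶ commaObj G H :=
  commaMk (s ≫ commaFst G H)
    (Y.mul (β ≫ H.f₁) (s ≫ commaMid G H) (by
      rw [Category.assoc, Category.assoc, commaMid_d, H.map_c, reassoc_of% h]))
    (β ≫ B.d) (by rw [IntGpd.mul_d, Category.assoc, Category.assoc, H.map_d])
    (by rw [IntGpd.mul_c, Category.assoc, Category.assoc, commaMid_c])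

theorem comp_commaLact {Z : E} (k : Z ⟶ X) (α : X ⟶ A.arr) (s : X ⟶ commaObj G H)
    (h : α ≫ A.d = s ≫ commaFst G H) :
    k ≫ commaLact α s h = commaLact (k ≫ α) (k ≫ s) (by simp [h]) := by
  apply comma_hom_ext
  · simp [commaLact]
  · simp only [commaLact, Category.assoc, commaMk_mid, IntGpd.comp_mul]
  · simp [commaLact]

theorem comp_commaRact {Z : E} (k : Z ⟶ X) (s : X ⟶ commaObj G H) (β : X ⟶ B.arr)
    (h : s ≫ commaSnd G H = β ≫ B.c) :
    k ≫ commaRact s β h = commaRact (k ≫ s) (k ≫ β) (by simp [h]) := by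
  apply comma_hom_ext
  · simp [commaRact]
  · simp only [commaRact, Category.assoc, commaMk_mid, IntGpd.comp_mul]
  · simp [commaRact]

theorem commaLact_congr {α α' : X ⟶ A.arr} {s s' : X ⟶ commaObj G H} (hα : α = α') (hs : s = s')
    (h : α ≫ A.d = s ≫ commaFst G H) :
    commaLact α s h = commaLact α' s' (by rw [← hα, ← hs, h]) := by
  subst hα hs; rfl

theorem commaRact_congr {β β' : X ⟶ B.arr} {s s' : X ⟶ commaObj G H} (hs : s = s') (hβ : β = β')
    (h : s ≫ commaSnd G H = β ≫ B.c) :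
    commaRact s β h = commaRact s' β' (by rw [← hβ, ← hs, h]) := by
  subst hβ hs; rfl

theorem lift_commaLact (α : X ⟶ A.arr) (s : X ⟶ commaObj G H)
    (h : α ≫ A.d = s ≫ commaFst G H) :
    pullback.lift α s h ≫ commaLact (pullback.fst _ _) (pullback.snd _ _) pullback.condition =
      commaLact α s h :=
  (comp_commaLact _ _ _ _).trans (commaLact_congr (by simp) (by simp) _)

theorem lift_commaRact (s : X ⟶ commaObj G H) (β : X ⟶ B.arr)
    (h : s ≫ commaSnd G H = β ≫ B.c) :
    pullback.lift s β h ≫ commaRact (pullback.fst _ _) (pullback.snd _ _) pullback.condition =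
      commaRact s β h :=
  (comp_commaRact _ _ _ _).trans (commaRact_congr (by simp) (by simp) _)

variable (G H)

/-- The distributor of a cospan `A ⟶ Y ⟵ B`: its generalized elements are the triples `(a, y, b)`
with `y : H b ⟶ G a`. -/
noncomputable def comma : IntDist A B where
  S₀ := commaObj G H
  L := commaFst G H
  R := commaSnd G H
  lam := commaLact (pullback.fst _ _) (pullback.snd _ _) pullback.condition
  rho := commaRact (pullback.fst _ _) (pullback.snd _ _) pullback.condition
  lam_L := commaMk_fst
  lam_R := commaMk_snd
  rho_L := commaMk_fst
  rho_R := commaMk_snd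
  lam_one := by
    rw [lift_commaLact]
    apply comma_hom_ext
    · simp [commaLact, A.e_c]
    · simp only [commaLact, commaMk_mid]
      refine (IntGpd.mul_congr rfl ?_ _).trans (Y.mul_id _ (commaFst G H ≫ G.f₀) ?_)
      · rw [Category.assoc, G.map_e, Category.assoc]
      · rw [Category.id_comp, commaMid_c]
    · simp [commaLact]
  rho_one := by
    rw [lift_commaRact]
    apply comma_hom_ext
    · simp [commaRact]
    · simp only [commaRact, commaMk_mid]
      refine (IntGpd.mul_congr ?_ rfl _).trans (Y.id_mul _ (commaSnd G H ≫ H.f₀) ?_)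
      · rw [Category.assoc, H.map_e, Category.assoc]
      · rw [Category.id_comp, commaMid_d]
    · simp [commaRact, B.e_d]
  lam_mul α α' s h hs := by
    have h' : (s ≫ commaMid G H) ≫ Y.c = (α ≫ G.f₁) ≫ Y.d := by
      rw [Category.assoc, commaMid_c, Category.assoc, G.map_d, reassoc_of% hs]
    have h'' : (α ≫ G.f₁) ≫ Y.c = (α' ≫ G.f₁) ≫ Y.d := by
      rw [Category.assoc, Category.assoc, G.map_d, G.map_c, reassoc_of% h]
    simp only [lift_commaLact]
    apply comma_hom_ext
    · simp [commaLact, IntGpd.mul_c]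
    · simp only [commaLact, commaMk_mid, G.map_mul]
      exact (IntGpd.mul_assoc _ _ _ h' h'').symm
    · simp [commaLact]
  rho_mul s β' β h hs := by
    have h' : (β' ≫ H.f₁) ≫ Y.c = (β ≫ H.f₁) ≫ Y.d := by
      rw [Category.assoc, Category.assoc, H.map_d, H.map_c, reassoc_of% h]
    have h'' : (β ≫ H.f₁) ≫ Y.c = (s ≫ commaMid G H) ≫ Y.d := by
      rw [Category.assoc, Category.assoc, commaMid_d, H.map_c, reassoc_of% hs]
    simp only [lift_commaRact]
    apply comma_hom_ext
    · simp [commaRact]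
    · simp only [commaRact, commaMk_mid, H.map_mul]
      exact IntGpd.mul_assoc _ _ _ h' h''
    · simp [commaRact, IntGpd.mul_d]
  lam_rho α s β hα hβ := by
    have h' : (s ≫ commaMid G H) ≫ Y.c = (α ≫ G.f₁) ≫ Y.d := by
      rw [Category.assoc, commaMid_c, Category.assoc, G.map_d, reassoc_of% hα]
    have h'' : (β ≫ H.f₁) ≫ Y.c = (s ≫ commaMid G H) ≫ Y.d := by
      rw [Category.assoc, Category.assoc, commaMid_d, H.map_c, reassoc_of% hβ]
    simp only [lift_commaRact, lift_commaLact]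
    apply comma_hom_ext
    · simp [commaRact, commaLact]
    · simp only [commaRact, commaLact, commaMk_mid]
      exact (IntGpd.mul_assoc _ _ _ h'' h').symm
    · simp [commaRact, commaLact]

variable {G H}

theorem comma_lact (α : X ⟶ A.arr)
    (h : α ≫ A.d = commaMk (G := G) (H := H) a y b hd hc ≫ (comma G H).L) :
    (comma G H).lact α (commaMk a y b hd hc) h = commaMk (α ≫ A.c) (Y.mul y (α ≫ G.f₁) (by
      rw [hc, Category.assoc, G.map_d, reassoc_of% h]; simp [comma])) b
      (by rw [IntGpd.mul_d, hd]) (by rw [IntGpd.mul_c, Category.assoc, Category.assoc, G.map_c]) :=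
  (lift_commaLact α (commaMk a y b hd hc) h).trans
    (commaMk_congr rfl (IntGpd.mul_congr commaMk_mid rfl _) commaMk_snd)

theorem comma_ract (β : X ⟶ B.arr)
    (h : commaMk (G := G) (H := H) a y b hd hc ≫ (comma G H).R = β ≫ B.c) :
    (comma G H).ract (commaMk a y b hd hc) β h = commaMk a (Y.mul (β ≫ H.f₁) y (by
      rw [hd, Category.assoc, H.map_c, ← reassoc_of% h]; simp [comma])) (β ≫ B.d)
      (by rw [IntGpd.mul_d, Category.assoc, Category.assoc, H.map_d]) (by rw [IntGpd.mul_c, hc]) :=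
  (lift_commaRact (commaMk a y b hd hc) β h).trans
    (commaMk_congr commaMk_fst (IntGpd.mul_congr rfl commaMk_mid _) rfl)

end

end IntDist

/-! ### The distributors represented by the legs of a span -/

namespace IntDist

section

variable {E : Type u} [Category.{v} E] [HasFiniteLimits E] {A B : IntGpd E} (X : Spans A B)

/-- The distributor represented by the left leg of a span; its generalized elements are the pairs
`(α, x)` with `α` an arrow of `A` whose domain is the image of `x`. -/
noncomputable def leftDist : IntDist A X.apex := comma (𝟙 A) X.l

/-- The distributor represented by the right leg of a span; its generalized elements are the pairs
`(x, β)` with `β` an arrow of `B` whose codomain is the image of `x`. -/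
noncomputable def rightDist : IntDist X.apex B := comma X.r (𝟙 B)

variable {X} {T : E}

/-- A generalized element of the distributor represented by the left leg. -/
noncomputable def leftMk (α : T ⟶ A.arr) (x : T ⟶ X.apex.obj) (h : α ≫ A.d = x ≫ X.l.f₀) :
    T ⟶ (leftDist X).S₀ :=
  commaMk (G := 𝟙 A) (H := X.l) (α ≫ A.c) α x h (Category.comp_id _).symm

/-- A generalized element of the distributor represented by the right leg. -/
noncomputable def rightMk (x : T ⟶ X.apex.obj) (β : T ⟶ B.arr) (h : β ≫ B.c = x ≫ X.r.f₀) :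
    T ⟶ (rightDist X).S₀ :=
  commaMk (G := X.r) (H := 𝟙 B) x β (β ≫ B.d) (Category.comp_id _).symm h

section

variable {α α' : T ⟶ A.arr} {β β' : T ⟶ B.arr} {x x' : T ⟶ X.apex.obj}

@[simp] theorem leftMk_L (h : α ≫ A.d = x ≫ X.l.f₀) : leftMk α x h ≫ (leftDist X).L = α ≫ A.c :=
  commaMk_fst

@[simp] theorem leftMk_R (h : α ≫ A.d = x ≫ X.l.f₀) : leftMk α x h ≫ (leftDist X).R = x :=
  commaMk_snd

@[simp] theorem rightMk_L (h : β ≫ B.c = x ≫ X.r.f₀) : rightMk x β h ≫ (rightDist X).L = x :=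
  commaMk_fst

@[simp] theorem rightMk_R (h : β ≫ B.c = x ≫ X.r.f₀) :
    rightMk x β h ≫ (rightDist X).R = β ≫ B.d :=
  commaMk_snd

theorem leftMk_congr (hα : α = α') (hx : x = x') (h : α ≫ A.d = x ≫ X.l.f₀) :
    leftMk α x h = leftMk α' x' (by rw [← hα, ← hx, h]) := by
  subst hα hx; rfl

theorem rightMk_congr (hx : x = x') (hβ : β = β') (h : β ≫ B.c = x ≫ X.r.f₀) :
    rightMk x β h = rightMk x' β' (by rw [← hβ, ← hx, h]) := by
  subst hβ hx; rfl

theorem leftMk_injective {h : α ≫ A.d = x ≫ X.l.f₀} {h' : α' ≫ A.d = x' ≫ X.l.f₀}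
    (e : leftMk α x h = leftMk α' x' h') : α = α' ∧ x = x' :=
  ⟨commaMk_mid.symm.trans ((congrArg (· ≫ commaMid (𝟙 A) X.l) e).trans commaMk_mid),
    (leftMk_R h).symm.trans ((congrArg (· ≫ (leftDist X).R) e).trans (leftMk_R h'))⟩

theorem rightMk_injective {h : β ≫ B.c = x ≫ X.r.f₀} {h' : β' ≫ B.c = x' ≫ X.r.f₀}
    (e : rightMk x β h = rightMk x' β' h') : x = x' ∧ β = β' :=
  ⟨(rightMk_L h).symm.trans ((congrArg (· ≫ (rightDist X).L) e).trans (rightMk_L h')),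
    commaMk_mid.symm.trans ((congrArg (· ≫ commaMid X.r (𝟙 B)) e).trans commaMk_mid)⟩

theorem comp_leftMk {U : E} (k : U ⟶ T) (h : α ≫ A.d = x ≫ X.l.f₀) :
    k ≫ leftMk α x h = leftMk (k ≫ α) (k ≫ x) (by simp [h]) :=
  (comp_commaMk k).trans (commaMk_congr (Category.assoc _ _ _).symm rfl rfl)

theorem comp_rightMk {U : E} (k : U ⟶ T) (h : β ≫ B.c = x ≫ X.r.f₀) :
    k ≫ rightMk x β h = rightMk (k ≫ x) (k ≫ β) (by simp [h]) :=
  (comp_commaMk k).trans (commaMk_congr rfl rfl (Category.assoc _ _ _).symm)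

theorem exists_leftMk (s : T ⟶ (leftDist X).S₀) :
    ∃ (α : T ⟶ A.arr) (x : T ⟶ X.apex.obj) (h : α ≫ A.d = x ≫ X.l.f₀), s = leftMk α x h := by
  obtain ⟨a, α, x, hd, hc, rfl⟩ := exists_commaMk (G := 𝟙 A) (H := X.l) s
  exact ⟨α, x, hd, commaMk_congr ((Category.comp_id a).symm.trans hc.symm) rfl rfl⟩

theorem exists_rightMk (t : T ⟶ (rightDist X).S₀) :
    ∃ (x : T ⟶ X.apex.obj) (β : T ⟶ B.arr) (h : β ≫ B.c = x ≫ X.r.f₀), t = rightMk x β h := by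
  obtain ⟨x, β, b, hd, hc, rfl⟩ := exists_commaMk (G := X.r) (H := 𝟙 B) t
  exact ⟨x, β, hc, commaMk_congr rfl rfl ((Category.comp_id b).symm.trans hd.symm)⟩

theorem lact_leftMk (α' : T ⟶ A.arr) (h : α ≫ A.d = x ≫ X.l.f₀) (h' : α ≫ A.c = α' ≫ A.d) :
    (leftDist X).lact α' (leftMk α x h) (by rw [leftMk_L, h']) =
      leftMk (A.mul α α' h') x (by rw [IntGpd.mul_d, h]) :=
  (comma_lact _ _).trans (commaMk_congr (IntGpd.mul_c _ _ _).symm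
    (IntGpd.mul_congr rfl (Category.comp_id _) _) rfl)

theorem ract_leftMk (ξ : T ⟶ X.apex.arr) (h : α ≫ A.d = x ≫ X.l.f₀) (h' : x = ξ ≫ X.apex.c) :
    (leftDist X).ract (leftMk α x h) ξ (by rw [leftMk_R, h']) =
      leftMk (A.mul (ξ ≫ X.l.f₁) α
          (by rw [h, Category.assoc, X.l.map_c, h', Category.assoc])) (ξ ≫ X.apex.d)
        (by rw [IntGpd.mul_d, Category.assoc, X.l.map_d, Category.assoc]) :=
  (comma_ract _ _).trans (commaMk_congr (IntGpd.mul_c _ _ _).symm rfl rfl)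

theorem lact_rightMk (ξ : T ⟶ X.apex.arr) (h : β ≫ B.c = x ≫ X.r.f₀) (h' : ξ ≫ X.apex.d = x) :
    (rightDist X).lact ξ (rightMk x β h) (by rw [rightMk_L, h']) =
      rightMk (ξ ≫ X.apex.c) (B.mul β (ξ ≫ X.r.f₁)
          (by rw [h, Category.assoc, X.r.map_d, ← h', Category.assoc]))
        (by rw [IntGpd.mul_c, Category.assoc, X.r.map_c, Category.assoc]) :=
  (comma_lact _ _).trans (commaMk_congr rfl rfl (IntGpd.mul_d _ _ _).symm)

theorem ract_rightMk (β' : T ⟶ B.arr) (h : β ≫ B.c = x ≫ X.r.f₀) (h' : β' ≫ B.c = β ≫ B.d) :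
    (rightDist X).ract (rightMk x β h) β' (by rw [rightMk_R, h']) =
      rightMk x (B.mul β' β h') (by rw [IntGpd.mul_c, h]) :=
  (comma_ract _ _).trans (commaMk_congr rfl (IntGpd.mul_congr (Category.comp_id _) rfl _)
    (IntGpd.mul_d _ _ _).symm)

end

section

variable (τ : Tensor (leftDist X) (rightDist X))

/-- The object part of the comparison from a span to its reflection. -/
noncomputable def reflObj : X.apex.obj ⟶ τ.obj.S₀ :=
  τ.tmul (leftMk (X.l.f₀ ≫ A.e) (𝟙 _) (by simp [A.e_d])) (rightMk (𝟙 _) (X.r.f₀ ≫ B.e)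
    (by simp [B.e_c])) (by rw [leftMk_R, rightMk_L])

theorem comp_reflObj (x : T ⟶ X.apex.obj) : x ≫ reflObj τ =
    τ.tmul (leftMk ((x ≫ X.l.f₀) ≫ A.e) x (by simp [A.e_d]))
      (rightMk x ((x ≫ X.r.f₀) ≫ B.e) (by simp [B.e_c])) (by rw [leftMk_R, rightMk_L]) := by
  rw [reflObj, τ.comp_tmul]
  refine τ.tmul_congr ?_ ?_ _
  · rw [comp_leftMk]; exact leftMk_congr (by simp) (by simp) _
  · rw [comp_rightMk]; exact rightMk_congr (by simp) (by simp) _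

theorem reflObj_L : reflObj τ ≫ τ.obj.L = X.l.f₀ := by
  rw [reflObj, Tensor.tmul_L, leftMk_L, Category.assoc, A.e_c, Category.comp_id]

theorem reflObj_R : reflObj τ ≫ τ.obj.R = X.r.f₀ := by
  rw [reflObj, Tensor.tmul_R, rightMk_R, Category.assoc, B.e_d, Category.comp_id]

/-- Acting on a value of the unit gives the forms `(α, x) ⊗ (x, 1)` on the left and, in the next
lemma, `(1, x) ⊗ (x, β)` on the right. Arrows between values of the unit become equations between
such tensors. -/
theorem lact_comp_reflObj (x : T ⟶ X.apex.obj) (α : T ⟶ A.arr) (h : α ≫ A.d = x ≫ X.l.f₀) :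
    τ.obj.lact α (x ≫ reflObj τ) (by rw [Category.assoc, reflObj_L, h]) =
      τ.tmul (leftMk α x h) (rightMk x ((x ≫ X.r.f₀) ≫ B.e) (by simp [B.e_c]))
        (by rw [leftMk_R, rightMk_L]) := by
  refine (lact_congr rfl (comp_reflObj τ x) _).trans ?_
  refine (τ.lact_tmul _ _ _ _ (by rw [leftMk_L, Category.assoc _ A.e, A.e_c, Category.comp_id,
    h])).trans (τ.tmul_congr ((lact_leftMk _ _ (by rw [Category.assoc _ A.e, A.e_c,
      Category.comp_id, h])).trans (leftMk_congr (A.id_mul _ _ h.symm) rfl _)) rfl _)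

theorem ract_comp_reflObj (x : T ⟶ X.apex.obj) (β : T ⟶ B.arr) (h : β ≫ B.c = x ≫ X.r.f₀) :
    τ.obj.ract (x ≫ reflObj τ) β (by rw [Category.assoc, reflObj_R, h]) =
      τ.tmul (leftMk ((x ≫ X.l.f₀) ≫ A.e) x (by simp [A.e_d])) (rightMk x β h)
        (by rw [leftMk_R, rightMk_L]) := by
  refine (ract_congr (comp_reflObj τ x) rfl _).trans ?_
  refine (τ.ract_tmul _ _ _ _ (by rw [rightMk_R, Category.assoc _ B.e, B.e_d, Category.comp_id,
    h])).trans (τ.tmul_congr rfl ((ract_rightMk _ _ (by rw [Category.assoc _ B.e, B.e_d,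
      Category.comp_id, h])).trans (rightMk_congr rfl (B.mul_id _ _ h) _)) _)

/-- The comparison from a span to its reflection in distributors. -/
noncomputable def reflMap : X ⟶ τ.obj.elSpan :=
  spanHom (reflObj τ) (reflObj_L τ) (reflObj_R τ) (by
    rw [lact_comp_reflObj τ _ _ X.l.map_d, ract_comp_reflObj τ _ _ X.r.map_c]
    have hl : (X.apex.c ≫ X.l.f₀) ≫ A.e ≫ A.d = X.apex.c ≫ X.l.f₀ := by simp [A.e_d]
    have hr : (X.apex.d ≫ X.r.f₀) ≫ B.e ≫ B.c = X.apex.d ≫ X.r.f₀ := by simp [B.e_c]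
    have h₁ := ract_leftMk (𝟙 X.apex.arr) ((Category.assoc _ _ _).trans hl)
      (Category.id_comp _).symm
    have h₂ := lact_rightMk (𝟙 X.apex.arr) ((Category.assoc _ _ _).trans hr) (Category.id_comp _)
    -- For the universal arrow `ξ` from `x` to `x'`, both sides are obtained by moving `ξ` across
    -- the tensor sign: `(l ξ, x) ⊗ (x, 1) = ((1, x') · ξ) ⊗ (x, 1) = (1, x') ⊗ (ξ · (x, 1)) = (1,
    -- x') ⊗ (x', r ξ)`.
    refine Eq.trans ?_ ((τ.tmul_ract (leftMk ((X.apex.c ≫ X.l.f₀) ≫ A.e) X.apex.c (by simpa using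
      hl)) (𝟙 X.apex.arr) (rightMk X.apex.d ((X.apex.d ≫ X.r.f₀) ≫ B.e) (by simpa using hr))
      (by simp) (by simp)).trans ?_)
    · refine τ.tmul_congr (Eq.trans ?_ h₁.symm) rfl _
      refine leftMk_congr ?_ (Category.id_comp _).symm _
      exact ((IntGpd.mul_congr (Category.id_comp _) rfl _).trans
        (A.mul_id _ _ X.l.map_c)).symm
    · refine τ.tmul_congr rfl (h₂.trans ?_) _
      refine rightMk_congr (Category.id_comp _) ?_ _
      exact (IntGpd.mul_congr rfl (Category.id_comp _) _).trans (B.id_mul _ _ X.r.map_d.symm))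

theorem homObj_reflMap : homObj (reflMap τ) = reflObj τ := rfl

end

end

section

variable {E : Type u} [Category.{v} E] [BarrExact E] {A B : IntGpd E} {X : Spans A B}
  (τ : Tensor (leftDist X) (rightDist X))

/-- Locally an element is `(α, x) ⊗ (x, β)`, the value of the unit at `x` acted on by `α` and `β`,
so it is the target of an arrow from that value. An arrow between values at `x` and `x'` is an
equation of tensors, and the arrow `ξ` of the groupoid `X` that exactness provides is its local
preimage. -/
theorem isLocallyFullEso_reflMap : IntGpd.IsLocallyFullEso (reflMap τ).hom := by
  apply isLocallyFullEso_of_elements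
  · intro T s
    obtain ⟨T', e, s₁, t₁, h, he, hs⟩ := τ.exists_cover_eq_tmul s
    obtain ⟨α, x, hα, rfl⟩ := exists_leftMk s₁
    obtain ⟨x', β, hβ, rfl⟩ := exists_rightMk t₁
    rw [leftMk_R, rightMk_L] at h
    subst h
    -- The component in `B` is inverted because an arrow to `s` satisfies `α · η x = s · β'`, with
    -- `η` the unit, whereas `s` is `α · η x · β`.
    refine ⟨T', e, x, α, β ≫ B.inv, ?_, ?_, he, ?_⟩
    · rw [homObj_reflMap, Category.assoc, reflObj_L, hα]
    · rw [hs, Tensor.tmul_R, rightMk_R, Category.assoc, B.inv_c]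
    · refine (lact_comp_reflObj τ x α hα).trans (Eq.trans ?_ (ract_congr hs.symm rfl
        (by rw [Tensor.tmul_R, rightMk_R, Category.assoc, B.inv_c])))
      refine ((τ.ract_tmul _ _ _ _ (by rw [rightMk_R, Category.assoc, B.inv_c])).trans
        (τ.tmul_congr rfl ((ract_rightMk _ _ (by rw [Category.assoc, B.inv_c])).trans
          (rightMk_congr rfl ?_ _)) _)).symm
      exact ((B.inv_mul β).trans (Category.assoc _ _ _).symm).trans (congrArg (· ≫ B.e) hβ)
  · intro T x x' α β h₁ h₂ h
    have hα : α ≫ A.d = x ≫ X.l.f₀ := by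
      rw [h₁, homObj_reflMap, Category.assoc, reflObj_L]
    have hβ : β ≫ B.c = x' ≫ X.r.f₀ := by
      rw [← h₂, homObj_reflMap, Category.assoc, reflObj_R]
    have h' := ((lact_comp_reflObj τ x α hα).symm.trans h).trans (ract_comp_reflObj τ x' β hβ)
    obtain ⟨T', e, ξ, k₁, k₂, he, k₃, k₄⟩ := τ.exists_arrow _ _ h'
    have hξ : e ≫ x' = ξ ≫ X.apex.c := by
      rw [← k₁, Category.assoc, leftMk_R]
    have hξ' : ξ ≫ X.apex.d = e ≫ x := by
      rw [k₂, Category.assoc, rightMk_L]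
    have k₃' := k₃.trans (ract_congr (comp_leftMk _ _) rfl _)
    rw [comp_leftMk, ract_leftMk (h' := hξ)] at k₃'
    have k₄' := k₄.trans (lact_congr rfl (comp_rightMk _ _) _)
    rw [comp_rightMk, lact_rightMk (h' := hξ')] at k₄'
    refine ⟨T', e, ξ, he, hξ', hξ.symm, ?_, ?_⟩
    -- Comparing first components: `α` is the image of `ξ` under the left leg, composed with an
    -- identity.
    · refine ((leftMk_injective k₃').1.trans ?_).symm
      refine (IntGpd.mul_congr rfl (Category.assoc _ _ _).symm _).trans (A.mul_id _ _ ?_)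
      rw [Category.assoc, X.l.map_c, reassoc_of% hξ]
    · refine ((rightMk_injective k₄').2.trans ?_).symm
      refine (IntGpd.mul_congr (Category.assoc _ _ _).symm rfl _).trans (B.id_mul _ _ ?_)
      rw [Category.assoc, X.r.map_d, reassoc_of% hξ']

variable (X)

/-- The reflection of a span in distributors. -/
noncomputable def reflDist : IntDist A B := (tensor (leftDist X) (rightDist X)).obj

/-- The unit of the reflection of spans in distributors. -/
noncomputable def reflUnit : X ⟶ (reflDist X).elSpan := reflMap (tensor (leftDist X) (rightDist X))

theorem isLocallyFullEso_reflUnit : IntGpd.IsLocallyFullEso (reflUnit X).hom :=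
  isLocallyFullEso_reflMap _

end

end IntDist

/-! ### Spans that are relations, and the comprehensive factorization -/

namespace IntGpd

section

variable {E : Type u} [Category.{v} E] [HasFiniteLimits E]

theorem discreteFibration_iff {X Y : IntGpd E} (p : X ⟶ Y) : discreteFibration E p ↔
    ∀ {T : E} (x : T ⟶ X.obj) (y : T ⟶ Y.arr), y ≫ Y.c = x ≫ p.f₀ →
      ∃! ξ : T ⟶ X.arr, ξ ≫ X.c = x ∧ ξ ≫ p.f₁ = y := by
  refine ⟨fun hp T x y h => ?_, fun h => ⟨⟨p.map_c⟩, ⟨PullbackCone.IsLimit.mk _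
    (fun s => (h s.snd s.fst s.condition).choose)
    (fun s => (h s.snd s.fst s.condition).choose_spec.1.2)
    (fun s => (h s.snd s.fst s.condition).choose_spec.1.1)
    (fun s m h₁ h₂ => (h s.snd s.fst s.condition).choose_spec.2 m ⟨h₂, h₁⟩)⟩⟩⟩
  obtain ⟨ξ, h₁, h₂⟩ := exists_lift_cod hp x y h
  exact ⟨ξ, ⟨h₁, h₂⟩, fun η hη => discreteFibration_hom_ext hp (hη.2.trans h₂.symm)
    (hη.1.trans h₁.symm)⟩

/-- The chosen terminal groupoid is a retract of `terminalGpd`, both of whose levels are terminal.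
-/
instance subsingleton_hom_terminal_obj (T : E) :
    Subsingleton (T ⟶ (⊤_ (IntGpd E)).obj) where
  allEq f g := by
    let F : (⊤_ (IntGpd E)) ⟶ terminalGpd :=
      { f₀ := terminal.from _
        f₁ := terminal.from _
        map_d := Subsingleton.elim (α := _ ⟶ ⊤_ E) _ _
        map_c := Subsingleton.elim (α := _ ⟶ ⊤_ E) _ _
        map_e := Subsingleton.elim (α := _ ⟶ ⊤_ E) _ _
        map_m := Subsingleton.elim (α := _ ⟶ ⊤_ E) _ _ }
    have hF : Hom.f₀ F ≫ Hom.f₀ (terminal.from terminalGpd) = 𝟙 (⊤_ (IntGpd E)).obj :=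
      congrArg Hom.f₀ (Subsingleton.elim (F ≫ terminal.from terminalGpd) (𝟙 _))
    have h : f ≫ F.f₀ = g ≫ F.f₀ := Subsingleton.elim (α := _ ⟶ ⊤_ E) _ _
    rw [← Category.comp_id f, ← Category.comp_id g, ← hF, reassoc_of% h]

instance subsingleton_hom_terminal_arr (T : E) :
    Subsingleton (T ⟶ (⊤_ (IntGpd E)).arr) where
  allEq f g := by
    let F : (⊤_ (IntGpd E)) ⟶ terminalGpd :=
      { f₀ := terminal.from _
        f₁ := terminal.from _
        map_d := Subsingleton.elim (α := _ ⟶ ⊤_ E) _ _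
        map_c := Subsingleton.elim (α := _ ⟶ ⊤_ E) _ _
        map_e := Subsingleton.elim (α := _ ⟶ ⊤_ E) _ _
        map_m := Subsingleton.elim (α := _ ⟶ ⊤_ E) _ _ }
    have hF : Hom.f₁ F ≫ Hom.f₁ (terminal.from terminalGpd) = 𝟙 (⊤_ (IntGpd E)).arr :=
      congrArg Hom.f₁ (Subsingleton.elim (F ≫ terminal.from terminalGpd) (𝟙 _))
    have h : f ≫ F.f₁ = g ≫ F.f₁ := Subsingleton.elim (α := _ ⟶ ⊤_ E) _ _
    rw [← Category.comp_id f, ← Category.comp_id g, ← hF, reassoc_of% h]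

section

variable (A B : IntGpd E)

theorem isPullback_prod : IsPullback (prod.fst : A ⨯ B ⟶ A) prod.snd (terminal.from A)
    (terminal.from B) :=
  IsPullback.of_hasBinaryProduct' A B

variable {A B} {T : E}

theorem prod_obj_hom_ext {f g : T ⟶ (A ⨯ B).obj}
    (h₁ : f ≫ Hom.f₀ (prod.fst : A ⨯ B ⟶ A) = g ≫ Hom.f₀ (prod.fst : A ⨯ B ⟶ A))
    (h₂ : f ≫ Hom.f₀ (prod.snd : A ⨯ B ⟶ B) = g ≫ Hom.f₀ (prod.snd : A ⨯ B ⟶ B)) : f = g :=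
  (isPullback_f₀ (isPullback_prod A B)).hom_ext h₁ h₂

theorem prod_arr_hom_ext {f g : T ⟶ (A ⨯ B).arr}
    (h₁ : f ≫ Hom.f₁ (prod.fst : A ⨯ B ⟶ A) = g ≫ Hom.f₁ (prod.fst : A ⨯ B ⟶ A))
    (h₂ : f ≫ Hom.f₁ (prod.snd : A ⨯ B ⟶ B) = g ≫ Hom.f₁ (prod.snd : A ⨯ B ⟶ B)) : f = g :=
  (isPullback_f₁ (isPullback_prod A B)).hom_ext h₁ h₂

theorem exists_prod_arr (α : T ⟶ A.arr) (β : T ⟶ B.arr) : ∃ η : T ⟶ (A ⨯ B).arr,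
    η ≫ Hom.f₁ (prod.fst : A ⨯ B ⟶ A) = α ∧ η ≫ Hom.f₁ (prod.snd : A ⨯ B ⟶ B) = β :=
  ⟨_, (isPullback_f₁ (isPullback_prod A B)).lift_fst α β (Subsingleton.elim _ _),
    (isPullback_f₁ (isPullback_prod A B)).lift_snd α β (Subsingleton.elim _ _)⟩

end

end

end IntGpd

/-! ### Relations as spans with unique lifting -/

namespace Spans

variable {E : Type u} [Category.{v} E] [HasFiniteLimits E] {A B : IntGpd E}

/-- The unique lifting property which characterizes the relations among the spans. -/
def IsBifibration (X : Spans A B) : Prop :=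
  ∀ {T : E} (x : T ⟶ X.apex.obj) (α : T ⟶ A.arr) (β : T ⟶ B.arr), α ≫ A.c = x ≫ X.l.f₀ →
    β ≫ B.c = x ≫ X.r.f₀ → ∃! ξ : T ⟶ X.apex.arr, ξ ≫ X.apex.c = x ∧ ξ ≫ X.l.f₁ = α ∧
      ξ ≫ X.r.f₁ = β

/-- Products of groupoids are levelwise, so an arrow of `A ⨯ B` is a pair of arrows. This rids the
condition of the chosen product. -/
theorem isRelation_iff (X : Spans A B) :
    isRelation (discreteFibration E) A B X ↔ X.IsBifibration := by
  have hl₀ : IntGpd.Hom.f₀ (prod.lift X.l X.r) ≫ IntGpd.Hom.f₀ (prod.fst : A ⨯ B ⟶ A) = X.l.f₀ :=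
    congrArg IntGpd.Hom.f₀ (prod.lift_fst X.l X.r)
  have hr₀ : IntGpd.Hom.f₀ (prod.lift X.l X.r) ≫ IntGpd.Hom.f₀ (prod.snd : A ⨯ B ⟶ B) = X.r.f₀ :=
    congrArg IntGpd.Hom.f₀ (prod.lift_snd X.l X.r)
  have hl₁ : IntGpd.Hom.f₁ (prod.lift X.l X.r) ≫ IntGpd.Hom.f₁ (prod.fst : A ⨯ B ⟶ A) = X.l.f₁ :=
    congrArg IntGpd.Hom.f₁ (prod.lift_fst X.l X.r)
  have hr₁ : IntGpd.Hom.f₁ (prod.lift X.l X.r) ≫ IntGpd.Hom.f₁ (prod.snd : A ⨯ B ⟶ B) = X.r.f₁ :=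
    congrArg IntGpd.Hom.f₁ (prod.lift_snd X.l X.r)
  refine (IntGpd.discreteFibration_iff _).trans ⟨fun h T x α β hα hβ => ?_, fun h T x y hy => ?_⟩
  · obtain ⟨η, h₁, h₂⟩ := IntGpd.exists_prod_arr α β
    obtain ⟨ξ, ⟨h₃, h₄⟩, hu⟩ := h x η (by
      apply IntGpd.prod_obj_hom_ext
      · rw [Category.assoc, ← IntGpd.Hom.map_c, reassoc_of% h₁, Category.assoc, hl₀, hα]
      · rw [Category.assoc, ← IntGpd.Hom.map_c, reassoc_of% h₂, Category.assoc, hr₀, hβ])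
    refine ⟨ξ, ⟨h₃, ?_, ?_⟩, fun ξ' hξ' => hu ξ' ⟨hξ'.1, IntGpd.prod_arr_hom_ext ?_ ?_⟩⟩
    · rw [← hl₁, reassoc_of% h₄, h₁]
    · rw [← hr₁, reassoc_of% h₄, h₂]
    · rw [Category.assoc, hl₁, hξ'.2.1, h₁]
    · rw [Category.assoc, hr₁, hξ'.2.2, h₂]
  · obtain ⟨ξ, ⟨h₁, h₂, h₃⟩, hu⟩ := h x (y ≫ IntGpd.Hom.f₁ (prod.fst : A ⨯ B ⟶ A))
      (y ≫ IntGpd.Hom.f₁ (prod.snd : A ⨯ B ⟶ B))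
      (by rw [Category.assoc, IntGpd.Hom.map_c, reassoc_of% hy, hl₀])
      (by rw [Category.assoc, IntGpd.Hom.map_c, reassoc_of% hy, hr₀])
    refine ⟨ξ, ⟨h₁, IntGpd.prod_arr_hom_ext ?_ ?_⟩, fun ξ' hξ' => hu ξ' ⟨hξ'.1, ?_, ?_⟩⟩
    · rw [Category.assoc, hl₁, h₂]
    · rw [Category.assoc, hr₁, h₃]
    · rw [← hl₁, reassoc_of% hξ'.2]
    · rw [← hr₁, reassoc_of% hξ'.2]

end Spans

/-! ### The spans of distributors are relations -/

namespace IntDist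

section

variable {E : Type u} [Category.{v} E] [HasFiniteLimits E] {A B : IntGpd E} {S : IntDist A B}

theorem inv_lact_lact {T : E} (α : T ⟶ A.arr) (s : T ⟶ S.S₀) (h : α ≫ A.d = s ≫ S.L) :
    S.lact (α ≫ A.inv) (S.lact α s h) (by rw [lact_L, Category.assoc, A.inv_d]) = s := by
  refine (S.mul_lact α (α ≫ A.inv) s (by simp [A.inv_d]) h).symm.trans ?_
  refine (lact_congr ((A.mul_inv α).trans (Category.assoc _ _ _).symm) rfl _).trans ?_
  exact one_lact s _ h

theorem lact_inv_lact {T : E} (α : T ⟶ A.arr) (s : T ⟶ S.S₀) (h : α ≫ A.c = s ≫ S.L) :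
    S.lact α (S.lact (α ≫ A.inv) s (by rw [Category.assoc, A.inv_d, h]))
      (by rw [lact_L, Category.assoc, A.inv_c]) = s := by
  refine (S.mul_lact (α ≫ A.inv) α s (by simp [A.inv_c])
    (by rw [Category.assoc, A.inv_d, h])).symm.trans ?_
  refine (lact_congr ((A.inv_mul α).trans (Category.assoc _ _ _).symm) rfl _).trans ?_
  exact one_lact s _ h

variable (S)

/-- Given the codomain `s` and the components `α` and `β`, the equation `α · s₀ = s · β` can be
solved for the domain in exactly one way, namely `s₀ = α⁻¹ · (s · β)`. -/
theorem isBifibration_elSpan : S.elSpan.IsBifibration := by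
  intro T (s : T ⟶ S.S₀) α β hα hβ
  replace hα : α ≫ A.c = s ≫ S.L := hα
  replace hβ : s ≫ S.R = β ≫ B.c := hβ.symm
  have h : (α ≫ A.inv) ≫ A.d = S.ract s β hβ ≫ S.L := by
    rw [Category.assoc, A.inv_d, hα, ract_L]
  have h' : α ≫ A.d = S.lact (α ≫ A.inv) (S.ract s β hβ) h ≫ S.L := by
    rw [lact_L, Category.assoc, A.inv_c]
  refine ⟨elMk α (S.lact (α ≫ A.inv) (S.ract s β hβ) h) s β h' hβ
    (lact_inv_lact α _ (by rw [ract_L, hα])), ⟨elMk_elCod, elMk_elA, elMk_elB⟩, ?_⟩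
  rintro (ξ : T ⟶ S.elArr) ⟨(h₁ : ξ ≫ S.elCod = s), (h₂ : ξ ≫ S.elA = α), (h₃ : ξ ≫ S.elB = β)⟩
  apply el_hom_ext
  · rw [h₂, elMk_elA]
  · rw [elMk_elDom]
    have h₄ : α ≫ A.d = (ξ ≫ S.elDom) ≫ S.L := by
      rw [← h₂, Category.assoc, Category.assoc, elA_d]
    refine (inv_lact_lact α (ξ ≫ S.elDom) h₄).symm.trans (lact_congr rfl ?_ _)
    exact (lact_congr h₂.symm rfl _).trans ((el_lact' ξ).trans (ract_congr h₁ h₃ _))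
  · rw [h₁, elMk_elCod]
  · rw [h₃, elMk_elB]

theorem isRelation_elSpan : isRelation (discreteFibration E) A B S.elSpan :=
  (Spans.isRelation_iff _).2 S.isBifibration_elSpan

end

end IntDist

/-! ### The comprehensive factorization -/

namespace IntGpd

section

variable {E : Type u} [Category.{v} E] [HasFiniteLimits E] {B : IntGpd E}

theorem discreteFibration_r_of_isBifibration {X : Spans (⊤_ (IntGpd E)) B}
    (h : X.IsBifibration) : discreteFibration E X.r := by
  refine (discreteFibration_iff X.r).2 fun {T} x β hβ => ?_
  obtain ⟨ξ, ⟨h₁, h₂, h₃⟩, hu⟩ := h x ((x ≫ X.l.f₀) ≫ (⊤_ (IntGpd E)).e) β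
    (Subsingleton.elim _ _) hβ
  exact ⟨ξ, ⟨h₁, h₃⟩, fun ξ' hξ' => hu ξ' ⟨hξ'.1, Subsingleton.elim _ _, hξ'.2⟩⟩

end

section

variable {E : Type u} [Category.{v} E] [BarrExact E] {A B C : IntGpd E}

/-- A functor `A ⟶ B` is a span from the terminal groupoid to `B`, and a relation from the terminal
groupoid to `B` is a discrete fibration over `B`. The reflection of this span is therefore the
factorization. -/
theorem exists_factorization (F : A ⟶ B) : ∃ (Z : IntGpd E) (G : A ⟶ Z) (p : Z ⟶ B),
    G ≫ p = F ∧ IsLocallyFullEso G ∧ discreteFibration E p := by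
  let X : Spans (⊤_ (IntGpd E)) B :=
    { apex := A, l := terminal.from A, r := F, wl := trivial, wr := trivial }
  exact ⟨_, (IntDist.reflUnit X).hom, (IntDist.reflDist X).elSpan.r,
    (IntDist.reflUnit X).hom_r, IntDist.isLocallyFullEso_reflUnit X,
    discreteFibration_r_of_isBifibration (IntDist.isBifibration_elSpan _)⟩

variable (E) in
theorem isOrthogonalFactorizationSystem :
    IsOrthogonalFactorizationSystem (final E) (discreteFibration E) where
  iso_left _ _ F hF := by
    have : IsIso F := hF
    exact final_of_isIso F
  iso_right _ _ F hF := by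
    have : IsIso F := hF
    exact discreteFibration_of_isIso F
  comp_left := final_comp
  comp_right := discreteFibration_comp
  factorization := ⟨fun F => by
    obtain ⟨Z, G, p, h, hG, hp⟩ := exists_factorization F
    exact ⟨{ Z := Z, i := G, p := p, fac := h, hi := hG.final, hp := hp }⟩⟩
  orthogonal _ p hF hp := hF p hp

theorem IsLocallyFullEso.comp_isIso {F : A ⟶ B} (hF : IsLocallyFullEso F) (G : B ⟶ C) [IsIso G] :
    IsLocallyFullEso (F ≫ G) := by
  have hi : Hom.f₀ (CategoryTheory.inv G) ≫ Hom.f₀ G = 𝟙 _ :=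
    congrArg Hom.f₀ (IsIso.inv_hom_id G)
  have hi₁ : Hom.f₁ (CategoryTheory.inv G) ≫ Hom.f₁ G = 𝟙 _ :=
    congrArg Hom.f₁ (IsIso.inv_hom_id G)
  have hi' : Hom.f₀ G ≫ Hom.f₀ (CategoryTheory.inv G) = 𝟙 _ :=
    congrArg Hom.f₀ (IsIso.hom_inv_id G)
  constructor
  · intro T c
    obtain ⟨T', e, a, β, he, h₁, h₂⟩ := hF.eso (c ≫ Hom.f₀ (CategoryTheory.inv G))
    refine ⟨T', e, a, β ≫ G.f₁, he, ?_, ?_⟩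
    · rw [Category.assoc, G.map_d, reassoc_of% h₁, comp_f₀]
    · rw [Category.assoc, G.map_c, reassoc_of% h₂, hi, Category.comp_id]
  · intro T a a' γ h₁ h₂
    obtain ⟨T', e, α, he, h₃, h₄, h₅⟩ := hF.full a a' (γ ≫ Hom.f₁ (CategoryTheory.inv G))
      (by rw [Category.assoc, Hom.map_d, reassoc_of% h₁, comp_f₀, Category.assoc, hi',
        Category.comp_id])
      (by rw [Category.assoc, Hom.map_c, reassoc_of% h₂, comp_f₀, Category.assoc, hi',
        Category.comp_id])
    exact ⟨T', e, α, he, h₃, h₄, by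
      rw [comp_f₁, reassoc_of% h₅, hi₁, Category.comp_id]⟩

/-- Converse of `IsLocallyFullEso.final`. In the factorization of a final functor the second part is
final by cancellation and a discrete fibration, hence invertible. Orthogonality is thereby replaced
by a local condition that can be followed through the pullbacks defining composites of spans. -/
theorem isLocallyFullEso_of_final (F : A ⟶ B) (h : final E F) : IsLocallyFullEso F := by
  obtain ⟨Z, G, p, rfl, hG, hp⟩ := exists_factorization F
  have := isIso_of_final_of_discreteFibration p (final_of_comp G p hG.final h) hp
  exact hG.comp_isIso p

end

end IntGpd

/-! ### Reflections of spans -/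

namespace Spans

section

variable {E : Type u} [Category.{v} E] [HasFiniteLimits E] {A B : IntGpd E}

/-- A morphism of spans into a relation is a functor over `A ⨯ B`, so extensions along `w` are
diagonal fillers. -/
theorem existsUnique_extension {X X' R : Spans A B} (w : X ⟶ X') (hw : final E w.hom)
    (hR : isRelation (discreteFibration E) A B R) (f : X ⟶ R) : ∃! g : X' ⟶ R, w ≫ g = f := by
  obtain ⟨k, ⟨hk₁, hk₂⟩, hu⟩ := hw _ hR f.hom (prod.lift X'.l X'.r)
    (by apply Limits.prod.hom_ext <;> simp [prod.lift_fst, prod.lift_snd])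
  refine ⟨⟨k, ?_, ?_⟩, Span.hom_ext hk₁, fun g hg => Span.hom_ext (hu g.hom
    ⟨congrArg Span.Hom.hom hg, ?_⟩)⟩
  · simpa [prod.lift_fst] using hk₂ =≫ prod.fst
  · simpa [prod.lift_snd] using hk₂ =≫ prod.snd
  · apply Limits.prod.hom_ext <;> simp [prod.lift_fst, prod.lift_snd]

theorem bijective_precomp {X X' R : Spans A B} (w : X ⟶ X') (hw : final E w.hom)
    (hR : isRelation (discreteFibration E) A B R) :
    Function.Bijective (fun g : X' ⟶ R => w ≫ g) :=
  Function.bijective_iff_existsUnique _ |>.2 (existsUnique_extension w hw hR)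

end

/-! ### Stability of final morphisms under composition with relations -/

section

variable {E : Type u} [Category.{v} E] [Regular E] {A B C : IntGpd E}

/-- The lifting property of `Y` is needed only for essential surjectivity: an arrow of `X'` reaching
the first component of an object has to be accompanied by an arrow of `Y` over the same arrow of
`B`. For fullness the component in `Y` is kept unchanged. -/
theorem isLocallyFullEso_whiskerR {X X' : Spans A B} (w : X ⟶ X')
    (hw : IntGpd.IsLocallyFullEso w.hom) {Y : Spans B C} (hY : Y.IsBifibration) :
    IntGpd.IsLocallyFullEso (whiskerR w Y).hom := by
  have k₁ : (whiskerR w Y).hom ≫ p₁ X' Y = p₁ X Y ≫ w.hom := pair_p₁ _ _ _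
  have k₂ : (whiskerR w Y).hom ≫ p₂ X' Y = p₂ X Y := pair_p₂ _ _ _
  have k₁₀ : (whiskerR w Y).hom.f₀ ≫ (p₁ X' Y).f₀ = (p₁ X Y).f₀ ≫ w.hom.f₀ :=
    congrArg IntGpd.Hom.f₀ k₁
  have k₂₀ : (whiskerR w Y).hom.f₀ ≫ (p₂ X' Y).f₀ = (p₂ X Y).f₀ := congrArg IntGpd.Hom.f₀ k₂
  have k₁₁ : (whiskerR w Y).hom.f₁ ≫ (p₁ X' Y).f₁ = (p₁ X Y).f₁ ≫ w.hom.f₁ :=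
    congrArg IntGpd.Hom.f₁ k₁
  have k₂₁ : (whiskerR w Y).hom.f₁ ≫ (p₂ X' Y).f₁ = (p₂ X Y).f₁ := congrArg IntGpd.Hom.f₁ k₂
  have hr₀ : w.hom.f₀ ≫ X'.r.f₀ = X.r.f₀ := congrArg IntGpd.Hom.f₀ w.hom_r
  have hr₁ : w.hom.f₁ ≫ X'.r.f₁ = X.r.f₁ := congrArg IntGpd.Hom.f₁ w.hom_r
  constructor
  · intro T z
    obtain ⟨T', e, x, ξ, he, h₁, h₂⟩ := hw.eso (z ≫ (p₁ X' Y).f₀)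
    -- The accompanying arrow ends at the given second component, lies over the image of `ξ` in `B`
    -- and over an identity of `C`.
    obtain ⟨η, ⟨h₃, h₄, -⟩, -⟩ := hY (e ≫ z ≫ (p₂ X' Y).f₀) (ξ ≫ X'.r.f₁)
      ((e ≫ z ≫ (p₂ X' Y).f₀ ≫ Y.r.f₀) ≫ C.e) (by
        rw [Category.assoc, X'.r.map_c, reassoc_of% h₂, Category.assoc, Category.assoc,
          (isPullback_comp_f₀ X' Y).w]) (by simp [C.e_c])
    have h₅ : x ≫ X.r.f₀ = (η ≫ Y.apex.d) ≫ Y.l.f₀ := by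
      rw [Category.assoc, ← Y.l.map_d, reassoc_of% h₄, X'.r.map_d, reassoc_of% h₁, hr₀]
    have h₆ : ξ ≫ X'.r.f₁ = η ≫ Y.l.f₁ := h₄.symm
    have l₁ := (isPullback_comp_f₀ X Y).lift_fst _ _ h₅
    have l₂ := (isPullback_comp_f₀ X Y).lift_snd _ _ h₅
    have l₃ := (isPullback_comp_f₁ X' Y).lift_fst _ _ h₆
    have l₄ := (isPullback_comp_f₁ X' Y).lift_snd _ _ h₆
    refine ⟨T', e, (isPullback_comp_f₀ X Y).lift _ _ h₅, (isPullback_comp_f₁ X' Y).lift _ _ h₆,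
      he, (isPullback_comp_f₀ X' Y).hom_ext ?_ ?_, (isPullback_comp_f₀ X' Y).hom_ext ?_ ?_⟩
    · rw [Category.assoc, ← IntGpd.Hom.map_d, reassoc_of% l₃, h₁, Category.assoc, k₁₀,
        reassoc_of% l₁]
    · rw [Category.assoc, ← IntGpd.Hom.map_d, reassoc_of% l₄, Category.assoc, k₂₀, l₂]
    · rw [Category.assoc, ← IntGpd.Hom.map_c, reassoc_of% l₃, h₂, Category.assoc]
    · rw [Category.assoc, ← IntGpd.Hom.map_c, reassoc_of% l₄, h₃, Category.assoc]
  · intro T z z' ζ hd hc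
    obtain ⟨T', e, ξ, he, h₁, h₂, h₃⟩ := hw.full (z ≫ (p₁ X Y).f₀) (z' ≫ (p₁ X Y).f₀)
      (ζ ≫ (p₁ X' Y).f₁) (by
        rw [Category.assoc, (p₁ X' Y).map_d, reassoc_of% hd, Category.assoc, k₁₀]) (by
        rw [Category.assoc, (p₁ X' Y).map_c, reassoc_of% hc, Category.assoc, k₁₀])
    have h₅ : ξ ≫ X.r.f₁ = (e ≫ ζ ≫ (p₂ X' Y).f₁) ≫ Y.l.f₁ := by
      rw [← hr₁, reassoc_of% h₃, Category.assoc, Category.assoc, (isPullback_comp_f₁ X' Y).w]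
    have l₁ := (isPullback_comp_f₁ X Y).lift_fst _ _ h₅
    have l₂ := (isPullback_comp_f₁ X Y).lift_snd _ _ h₅
    refine ⟨T', e, (isPullback_comp_f₁ X Y).lift _ _ h₅, he,
      (isPullback_comp_f₀ X Y).hom_ext ?_ ?_, (isPullback_comp_f₀ X Y).hom_ext ?_ ?_,
      (isPullback_comp_f₁ X' Y).hom_ext ?_ ?_⟩
    · rw [Category.assoc, ← IntGpd.Hom.map_d, reassoc_of% l₁, h₁, Category.assoc]
    · rw [Category.assoc, ← IntGpd.Hom.map_d, reassoc_of% l₂, Category.assoc,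
        (p₂ X' Y).map_d, reassoc_of% hd, k₂₀]
    · rw [Category.assoc, ← IntGpd.Hom.map_c, reassoc_of% l₁, h₂, Category.assoc]
    · rw [Category.assoc, ← IntGpd.Hom.map_c, reassoc_of% l₂, Category.assoc,
        (p₂ X' Y).map_c, reassoc_of% hc, k₂₀]
    · rw [Category.assoc, k₁₁, reassoc_of% l₁, h₃, Category.assoc]
    · rw [Category.assoc, k₂₁, l₂, Category.assoc]

theorem isLocallyFullEso_whiskerL {X : Spans A B} (hX : X.IsBifibration) {Y Y' : Spans B C}
    (w : Y ⟶ Y') (hw : IntGpd.IsLocallyFullEso w.hom) :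
    IntGpd.IsLocallyFullEso (whiskerL X w).hom := by
  have k₁ : (whiskerL X w).hom ≫ p₁ X Y' = p₁ X Y := pair_p₁ _ _ _
  have k₂ : (whiskerL X w).hom ≫ p₂ X Y' = p₂ X Y ≫ w.hom := pair_p₂ _ _ _
  have k₁₀ : (whiskerL X w).hom.f₀ ≫ (p₁ X Y').f₀ = (p₁ X Y).f₀ := congrArg IntGpd.Hom.f₀ k₁
  have k₂₀ : (whiskerL X w).hom.f₀ ≫ (p₂ X Y').f₀ = (p₂ X Y).f₀ ≫ w.hom.f₀ :=
    congrArg IntGpd.Hom.f₀ k₂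
  have k₁₁ : (whiskerL X w).hom.f₁ ≫ (p₁ X Y').f₁ = (p₁ X Y).f₁ := congrArg IntGpd.Hom.f₁ k₁
  have k₂₁ : (whiskerL X w).hom.f₁ ≫ (p₂ X Y').f₁ = (p₂ X Y).f₁ ≫ w.hom.f₁ :=
    congrArg IntGpd.Hom.f₁ k₂
  have hl₀ : w.hom.f₀ ≫ Y'.l.f₀ = Y.l.f₀ := congrArg IntGpd.Hom.f₀ w.hom_l
  have hl₁ : w.hom.f₁ ≫ Y'.l.f₁ = Y.l.f₁ := congrArg IntGpd.Hom.f₁ w.hom_l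
  constructor
  · intro T z
    obtain ⟨T', e, y, η, he, h₁, h₂⟩ := hw.eso (z ≫ (p₂ X Y').f₀)
    obtain ⟨ξ, ⟨h₃, -, h₄⟩, -⟩ := hX (e ≫ z ≫ (p₁ X Y').f₀)
      ((e ≫ z ≫ (p₁ X Y').f₀ ≫ X.l.f₀) ≫ A.e) (η ≫ Y'.l.f₁) (by simp [A.e_c]) (by
        rw [Category.assoc, Y'.l.map_c, reassoc_of% h₂, Category.assoc, Category.assoc,
          (isPullback_comp_f₀ X Y').w])
    have h₅ : (ξ ≫ X.apex.d) ≫ X.r.f₀ = y ≫ Y.l.f₀ := by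
      rw [Category.assoc, ← X.r.map_d, reassoc_of% h₄, Y'.l.map_d, reassoc_of% h₁, hl₀]
    have h₆ : ξ ≫ X.r.f₁ = η ≫ Y'.l.f₁ := h₄
    have l₁ := (isPullback_comp_f₀ X Y).lift_fst _ _ h₅
    have l₂ := (isPullback_comp_f₀ X Y).lift_snd _ _ h₅
    have l₃ := (isPullback_comp_f₁ X Y').lift_fst _ _ h₆
    have l₄ := (isPullback_comp_f₁ X Y').lift_snd _ _ h₆
    refine ⟨T', e, (isPullback_comp_f₀ X Y).lift _ _ h₅, (isPullback_comp_f₁ X Y').lift _ _ h₆,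
      he, (isPullback_comp_f₀ X Y').hom_ext ?_ ?_, (isPullback_comp_f₀ X Y').hom_ext ?_ ?_⟩
    · rw [Category.assoc, ← IntGpd.Hom.map_d, reassoc_of% l₃, Category.assoc, k₁₀, l₁]
    · rw [Category.assoc, ← IntGpd.Hom.map_d, reassoc_of% l₄, h₁, Category.assoc, k₂₀,
        reassoc_of% l₂]
    · rw [Category.assoc, ← IntGpd.Hom.map_c, reassoc_of% l₃, h₃, Category.assoc]
    · rw [Category.assoc, ← IntGpd.Hom.map_c, reassoc_of% l₄, h₂, Category.assoc]
  · intro T z z' ζ hd hc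
    obtain ⟨T', e, η, he, h₁, h₂, h₃⟩ := hw.full (z ≫ (p₂ X Y).f₀) (z' ≫ (p₂ X Y).f₀)
      (ζ ≫ (p₂ X Y').f₁) (by
        rw [Category.assoc, (p₂ X Y').map_d, reassoc_of% hd, Category.assoc, k₂₀]) (by
        rw [Category.assoc, (p₂ X Y').map_c, reassoc_of% hc, Category.assoc, k₂₀])
    have h₅ : (e ≫ ζ ≫ (p₁ X Y').f₁) ≫ X.r.f₁ = η ≫ Y.l.f₁ := by
      rw [← hl₁, reassoc_of% h₃, Category.assoc, Category.assoc, (isPullback_comp_f₁ X Y').w]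
    have l₁ := (isPullback_comp_f₁ X Y).lift_fst _ _ h₅
    have l₂ := (isPullback_comp_f₁ X Y).lift_snd _ _ h₅
    refine ⟨T', e, (isPullback_comp_f₁ X Y).lift _ _ h₅, he,
      (isPullback_comp_f₀ X Y).hom_ext ?_ ?_, (isPullback_comp_f₀ X Y).hom_ext ?_ ?_,
      (isPullback_comp_f₁ X Y').hom_ext ?_ ?_⟩
    · rw [Category.assoc, ← IntGpd.Hom.map_d, reassoc_of% l₁, Category.assoc,
        (p₁ X Y').map_d, reassoc_of% hd, k₁₀]
    · rw [Category.assoc, ← IntGpd.Hom.map_d, reassoc_of% l₂, h₁, Category.assoc]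
    · rw [Category.assoc, ← IntGpd.Hom.map_c, reassoc_of% l₁, Category.assoc,
        (p₁ X Y').map_c, reassoc_of% hc, k₁₀]
    · rw [Category.assoc, ← IntGpd.Hom.map_c, reassoc_of% l₂, h₂, Category.assoc]
    · rw [Category.assoc, k₁₁, l₁, Category.assoc]
    · rw [Category.assoc, k₂₁, reassoc_of% l₂, h₃, Category.assoc]

end

end Spans

/-! ### The reflection as an adjunction, and relations as distributors -/

namespace IntDist

variable {E : Type u} [Category.{v} E] [BarrExact E] (A B : IntGpd E)

variable {A B} in
theorem bijective_precomp_map {X : Spans A B} {S : IntDist A B} (w : X ⟶ S.elSpan)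
    (hw : final E w.hom) (T : IntDist A B) :
    Function.Bijective (fun g : S ⟶ T => w ≫ (elements A B).map g) :=
  (Spans.bijective_precomp w hw T.isRelation_elSpan).comp
    ((Functor.FullyFaithful.ofFullyFaithful (elements A B)).map_bijective S T)

/-- Morphisms from the reflection of a span correspond to morphisms of spans. -/
noncomputable def reflEquiv (X : Spans A B) (T : IntDist A B) :
    (reflDist X ⟶ T) ≃ (X ⟶ (elements A B).obj T) :=
  Equiv.ofBijective _ (bijective_precomp_map (reflUnit X) (isLocallyFullEso_reflUnit X).final T)

theorem reflEquiv_comp (X : Spans A B) (S T : IntDist A B) (g : S ⟶ T) (h : reflDist X ⟶ S) :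
    reflEquiv A B X T (h ≫ g) = reflEquiv A B X S h ≫ (elements A B).map g := by
  simp only [reflEquiv, Equiv.ofBijective_apply, Functor.map_comp]
  exact (Category.assoc _ _ _).symm

/-- The reflection of spans in distributors. -/
noncomputable def reflFunctor : Spans A B ⥤ IntDist A B :=
  Adjunction.leftAdjointOfEquiv (reflEquiv A B) (reflEquiv_comp A B)

/-- The reflection of spans in distributors is left adjoint to the inclusion. -/
noncomputable def reflAdjunction : reflFunctor A B ⊣ elements A B :=
  Adjunction.adjunctionOfEquivLeft (reflEquiv A B) (reflEquiv_comp A B)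

theorem reflAdjunction_unit_app (X : Spans A B) :
    (reflAdjunction A B).unit.app X = reflUnit X := by
  have : (reflAdjunction A B).unit.app X = reflEquiv A B X (reflDist X) (𝟙 _) := by
    rw [reflAdjunction, Adjunction.adjunctionOfEquivLeft_unit_app]
  rw [this]
  exact (congrArg (reflUnit X ≫ ·) ((elements A B).map_id _)).trans (Category.comp_id _)

variable {A B}

/-- Every final morphism into the span of a distributor is a universal arrow, so by the Yoneda lemma
its transpose is invertible, whichever left adjoint is chosen. -/
theorem isIso_homEquiv_symm {X : Spans A B} {S : IntDist A B} (w : X ⟶ S.elSpan)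
    (hw : final E w.hom) (r : Spans A B ⥤ IntDist A B) (adj : r ⊣ elements A B) :
    IsIso ((adj.homEquiv X S).symm w) := by
  refine isIso_of_coyoneda_map_bijective _ fun T => ?_
  have h := (adj.homEquiv X T).symm.bijective.comp (bijective_precomp_map w hw T)
  convert h using 1
  funext g
  exact (adj.homEquiv_naturality_right_symm w g).symm

theorem isEquivalence_toRel (h : ∀ (A B : IntGpd E) (S : IntDist A B),
    isRelation (discreteFibration E) A B S.elSpan) : (toRel h A B).IsEquivalence := by
  have : (toRel h A B).Full := ⟨fun f =>
    ⟨(elements A B).preimage f.hom, ObjectProperty.hom_ext _ ((elements A B).map_preimage _)⟩⟩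
  have : (toRel h A B).Faithful := ⟨fun h =>
    (elements A B).map_injective
      (congrArg (fun f => (isRelation (discreteFibration E) A B).ι.map f) h)⟩
  have : (toRel h A B).EssSurj := by
    refine ⟨fun R => ⟨reflDist R.obj, ⟨ObjectProperty.isoMk _ (Iso.symm ?_)⟩⟩⟩
    -- For a relation, the unit is a discrete fibration by cancellation over `A ⨯ B`. Being also
    -- final, it is invertible, which gives essential surjectivity.
    have hd : discreteFibration E (reflUnit R.obj).hom := by
      refine IntGpd.discreteFibration_of_comp _ _ (h A B (reflDist R.obj)) ?_
      have hR : (reflUnit R.obj).hom ≫ prod.lift (reflDist R.obj).elSpan.l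
          (reflDist R.obj).elSpan.r = prod.lift R.obj.l R.obj.r := by
        apply Limits.prod.hom_ext
        · rw [Category.assoc, prod.lift_fst, prod.lift_fst]
          exact (reflUnit R.obj).hom_l
        · rw [Category.assoc, prod.lift_snd, prod.lift_snd]
          exact (reflUnit R.obj).hom_r
      rw [hR]
      exact R.property
    have : IsIso (reflUnit R.obj).hom := IntGpd.isIso_of_final_of_discreteFibration _
      (isLocallyFullEso_reflUnit R.obj).final hd
    let e := asIso (reflUnit R.obj).hom
    exact Span.mkIso e (reflUnit R.obj).hom_l (reflUnit R.obj).hom_r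
  exact { }

end IntDist

/-! ### Bicategories of reflections -/

section LocalReflection

open Bicategory

universe w₁ v₁ u₁ u₂ v₂

variable {B : Type u₁} [Bicategory.{w₁, v₁} B] {H : B → B → Type u₂}
  [∀ a b, Category.{v₂} (H a b)]

/-- A class of 2-cells along which 2-cells into objects in the image of the functors `F` extend
uniquely and which is stable under whiskering by such objects. -/
structure IsLocallyReflecting (F : ∀ a b, H a b ⥤ (a ⟶ b))
    (W : ∀ a b : B, MorphismProperty (a ⟶ b)) : Prop where
  bijective : ∀ {a b : B} {x y : a ⟶ b} {p : x ⟶ y}, W a b p → ∀ z : H a b,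
    Function.Bijective (fun q : y ⟶ (F a b).obj z => p ≫ q)
  whiskerLeft : ∀ {a b c : B} (f : H a b) {x y : b ⟶ c} {p : x ⟶ y}, W b c p →
    W a c ((F a b).obj f ◁ p)
  whiskerRight : ∀ {a b c : B} {x y : a ⟶ b} {p : x ⟶ y} (g : H b c), W a b p →
    W a c (p ▷ (F b c).obj g)

/-- The constraints of a lax functor, which is the identity on objects and locally given by the
functors `F`, from a bicategory with given homs. -/
structure LaxConstraints (F : ∀ a b, H a b ⥤ (a ⟶ b)) (one : ∀ a, H a a)
    (comp : ∀ {a b c : B}, H a b → H b c → H a c) where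
  /-- the lax unity constraint -/
  unit : ∀ a, 𝟙 a ⟶ (F a a).obj (one a)
  /-- the lax functoriality constraint -/
  mul : ∀ {a b c : B} (f : H a b) (g : H b c),
    (F a b).obj f ≫ (F b c).obj g ⟶ (F a c).obj (comp f g)

variable {F : ∀ a b, H a b ⥤ (a ⟶ b)} {one : ∀ a, H a a}
  {comp : ∀ {a b c : B}, H a b → H b c → H a c}

/-- The axioms of a lax functor which is the identity on objects. -/
structure LaxConstraints.IsLax (μ : LaxConstraints F one comp)
    (𝓑 : HomBicategory B H one comp) : Prop where
  mul_whiskerRight : ∀ {a b c : B} {f f' : H a b} (η : f ⟶ f') (g : H b c),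
    μ.mul f g ≫ (F a c).map (𝓑.whiskerRight η g) = (F a b).map η ▷ (F b c).obj g ≫ μ.mul f' g
  mul_whiskerLeft : ∀ {a b c : B} (f : H a b) {g g' : H b c} (η : g ⟶ g'),
    μ.mul f g ≫ (F a c).map (𝓑.whiskerLeft f η) = (F a b).obj f ◁ (F b c).map η ≫ μ.mul f g'
  associator : ∀ {a b c d : B} (f : H a b) (g : H b c) (h : H c d),
    μ.mul f g ▷ (F c d).obj h ≫ μ.mul (comp f g) h ≫ (F a d).map (𝓑.associator f g h).hom =
      (α_ _ _ _).hom ≫ (F a b).obj f ◁ μ.mul g h ≫ μ.mul f (comp g h)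
  leftUnitor : ∀ {a b : B} (f : H a b),
    μ.unit a ▷ (F a b).obj f ≫ μ.mul (one a) f ≫ (F a b).map (𝓑.leftUnitor f).hom =
      (λ_ _).hom
  rightUnitor : ∀ {a b : B} (f : H a b),
    (F a b).obj f ◁ μ.unit b ≫ μ.mul f (one b) ≫ (F a b).map (𝓑.rightUnitor f).hom =
      (ρ_ _).hom

namespace IsLocallyReflecting

variable {W : ∀ a b : B, MorphismProperty (a ⟶ b)}

theorem cancel (hW : IsLocallyReflecting F W) {a b : B} {x y : a ⟶ b} {z : H a b} {p : x ⟶ y}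
    (hp : W a b p) {q r : y ⟶ (F a b).obj z} (h : p ≫ q = p ≫ r) : q = r :=
  (hW.bijective hp z).1 h

section

variable [∀ a b, (F a b).Full] (hW : IsLocallyReflecting F W) {a b : B} {x : a ⟶ b} {y z : H a b}
  {p : x ⟶ (F a b).obj y} (hp : W a b p) (q : x ⟶ (F a b).obj z)

/-- The 2-cell induced by extension along a 2-cell of the given class. -/
noncomputable def desc : y ⟶ z := (F a b).preimage ((hW.bijective hp z).2 q).choose

theorem comp_map_desc : p ≫ (F a b).map (hW.desc hp q) = q := by
  rw [desc, Functor.map_preimage]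
  exact ((hW.bijective hp z).2 q).choose_spec

end

end IsLocallyReflecting

/-! ### Construction of the reflected bicategory -/

namespace LaxConstraints

variable {W : ∀ a b : B, MorphismProperty (a ⟶ b)}

/-- The constraints of a lax functor belong to a class of 2-cells. -/
structure Mem (μ : LaxConstraints F one comp) (W : ∀ a b : B, MorphismProperty (a ⟶ b)) :
    Prop where
  unit : ∀ a, W a a (μ.unit a)
  mul : ∀ {a b c : B} (f : H a b) (g : H b c), W a c (μ.mul f g)

namespace Mem

section

variable [∀ a b, (F a b).Faithful] {μ : LaxConstraints F one comp} {a b c d : B}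

theorem hom_ext (hμ : μ.Mem W) (hW : IsLocallyReflecting F W) {f : H a b} {g : H b c} {h : H a c}
    {p q : comp f g ⟶ h}
    (e : μ.mul f g ≫ (F a c).map p = μ.mul f g ≫ (F a c).map q) : p = q :=
  (F a c).map_injective (hW.cancel (hμ.mul f g) e)

/-- A 2-cell out of an iterated reflected composite is determined by its restriction to the
corresponding composite in `B`. This lemma and its variants below reduce the axioms of the reflected
bicategory to those of `B`. -/
theorem hom_ext_right (hμ : μ.Mem W) (hW : IsLocallyReflecting F W) {f : H a b} {g : H b c}
    {h : H c d} {k : H a d} {p q : comp (comp f g) h ⟶ k}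
    (e : μ.mul f g ▷ (F c d).obj h ≫ μ.mul (comp f g) h ≫ (F a d).map p =
      μ.mul f g ▷ (F c d).obj h ≫ μ.mul (comp f g) h ≫ (F a d).map q) : p = q :=
  hμ.hom_ext hW (hW.cancel (hW.whiskerRight h (hμ.mul f g)) e)

theorem hom_ext_left (hμ : μ.Mem W) (hW : IsLocallyReflecting F W) {f : H a b} {g : H b c}
    {h : H c d} {k : H a d} {p q : comp f (comp g h) ⟶ k}
    (e : (F a b).obj f ◁ μ.mul g h ≫ μ.mul f (comp g h) ≫ (F a d).map p =
      (F a b).obj f ◁ μ.mul g h ≫ μ.mul f (comp g h) ≫ (F a d).map q) : p = q :=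
  hμ.hom_ext hW (hW.cancel (hW.whiskerLeft f (hμ.mul g h)) e)

theorem hom_ext_unit_right (hμ : μ.Mem W) (hW : IsLocallyReflecting F W) {f : H a b} {g : H a b}
    {p q : comp (one a) f ⟶ g}
    (e : μ.unit a ▷ (F a b).obj f ≫ μ.mul (one a) f ≫ (F a b).map p =
      μ.unit a ▷ (F a b).obj f ≫ μ.mul (one a) f ≫ (F a b).map q) : p = q :=
  hμ.hom_ext hW (hW.cancel (hW.whiskerRight f (hμ.unit a)) e)

theorem hom_ext_unit_left (hμ : μ.Mem W) (hW : IsLocallyReflecting F W) {f : H a b} {g : H a b}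
    {p q : comp f (one b) ⟶ g}
    (e : (F a b).obj f ◁ μ.unit b ≫ μ.mul f (one b) ≫ (F a b).map p =
      (F a b).obj f ◁ μ.unit b ≫ μ.mul f (one b) ≫ (F a b).map q) : p = q :=
  hμ.hom_ext hW (hW.cancel (hW.whiskerLeft f (hμ.unit b)) e)

end

end Mem

variable [∀ a b, (F a b).Full] {μ : LaxConstraints F one comp}
  (hμ : μ.Mem W) (hW : IsLocallyReflecting F W)

namespace Mem

section

variable {a b c d : B}

/-- Left whiskering of reflected 1-cells. -/
noncomputable def whiskerLeft (f : H a b) {g g' : H b c} (η : g ⟶ g') : comp f g ⟶ comp f g' :=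
  hW.desc (hμ.mul f g) ((F a b).obj f ◁ (F b c).map η ≫ μ.mul f g')

theorem mul_whiskerLeft (f : H a b) {g g' : H b c} (η : g ⟶ g') :
    μ.mul f g ≫ (F a c).map (hμ.whiskerLeft hW f η) =
      (F a b).obj f ◁ (F b c).map η ≫ μ.mul f g' :=
  hW.comp_map_desc _ _

/-- Right whiskering of reflected 1-cells. -/
noncomputable def whiskerRight {f f' : H a b} (η : f ⟶ f') (g : H b c) : comp f g ⟶ comp f' g :=
  hW.desc (hμ.mul f g) ((F a b).map η ▷ (F b c).obj g ≫ μ.mul f' g)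

theorem mul_whiskerRight {f f' : H a b} (η : f ⟶ f') (g : H b c) :
    μ.mul f g ≫ (F a c).map (hμ.whiskerRight hW η g) =
      (F a b).map η ▷ (F b c).obj g ≫ μ.mul f' g :=
  hW.comp_map_desc _ _

/-- The associator of reflected 1-cells. -/
noncomputable def assocHom (f : H a b) (g : H b c) (h : H c d) :
    comp (comp f g) h ⟶ comp f (comp g h) :=
  -- The associator of `B` is extended twice: along the whiskered inner constraint, then along the
  -- outer one.
  hW.desc (hμ.mul (comp f g) h) ((hW.bijective (hW.whiskerRight h (hμ.mul f g)) _).2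
    ((α_ _ _ _).hom ≫ (F a b).obj f ◁ μ.mul g h ≫ μ.mul f (comp g h))).choose

theorem mul_assocHom (f : H a b) (g : H b c) (h : H c d) :
    μ.mul f g ▷ (F c d).obj h ≫ μ.mul (comp f g) h ≫ (F a d).map (hμ.assocHom hW f g h) =
      (α_ _ _ _).hom ≫ (F a b).obj f ◁ μ.mul g h ≫ μ.mul f (comp g h) := by
  rw [assocHom, hW.comp_map_desc]
  exact ((hW.bijective (hW.whiskerRight h (hμ.mul f g)) _).2 _).choose_spec

/-- The inverse of the associator of reflected 1-cells. -/
noncomputable def assocInv (f : H a b) (g : H b c) (h : H c d) :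
    comp f (comp g h) ⟶ comp (comp f g) h :=
  hW.desc (hμ.mul f (comp g h)) ((hW.bijective (hW.whiskerLeft f (hμ.mul g h)) _).2
    ((α_ _ _ _).inv ≫ μ.mul f g ▷ (F c d).obj h ≫ μ.mul (comp f g) h)).choose

theorem mul_assocInv (f : H a b) (g : H b c) (h : H c d) :
    (F a b).obj f ◁ μ.mul g h ≫ μ.mul f (comp g h) ≫ (F a d).map (hμ.assocInv hW f g h) =
      (α_ _ _ _).inv ≫ μ.mul f g ▷ (F c d).obj h ≫ μ.mul (comp f g) h := by
  rw [assocInv, hW.comp_map_desc]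
  exact ((hW.bijective (hW.whiskerLeft f (hμ.mul g h)) _).2 _).choose_spec

/-- The left unitor of reflected 1-cells. -/
noncomputable def leftUnitorHom (f : H a b) : comp (one a) f ⟶ f :=
  hW.desc (hμ.mul (one a) f) ((hW.bijective (hW.whiskerRight f (hμ.unit a)) _).2
    (λ_ ((F a b).obj f)).hom).choose

theorem mul_leftUnitorHom (f : H a b) :
    μ.unit a ▷ (F a b).obj f ≫ μ.mul (one a) f ≫ (F a b).map (hμ.leftUnitorHom hW f) =
      (λ_ _).hom := by
  rw [leftUnitorHom, hW.comp_map_desc]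
  exact ((hW.bijective (hW.whiskerRight f (hμ.unit a)) _).2 _).choose_spec

/-- The right unitor of reflected 1-cells. -/
noncomputable def rightUnitorHom (f : H a b) : comp f (one b) ⟶ f :=
  hW.desc (hμ.mul f (one b)) ((hW.bijective (hW.whiskerLeft f (hμ.unit b)) _).2
    (ρ_ ((F a b).obj f)).hom).choose

theorem mul_rightUnitorHom (f : H a b) :
    (F a b).obj f ◁ μ.unit b ≫ μ.mul f (one b) ≫ (F a b).map (hμ.rightUnitorHom hW f) =
      (ρ_ _).hom := by
  rw [rightUnitorHom, hW.comp_map_desc]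
  exact ((hW.bijective (hW.whiskerLeft f (hμ.unit b)) _).2 _).choose_spec

variable [∀ a b, (F a b).Faithful]

/-- The associator of reflected 1-cells, as an isomorphism. -/
noncomputable def associator (f : H a b) (g : H b c) (h : H c d) :
    comp (comp f g) h ≅ comp f (comp g h) where
  hom := hμ.assocHom hW f g h
  inv := hμ.assocInv hW f g h
  hom_inv_id := by
    apply hμ.hom_ext_right hW
    rw [Functor.map_comp, reassoc_of% (hμ.mul_assocHom hW f g h), hμ.mul_assocInv hW]
    simp
  inv_hom_id := by
    apply hμ.hom_ext_left hW
    rw [Functor.map_comp, reassoc_of% (hμ.mul_assocInv hW f g h), hμ.mul_assocHom hW]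
    simp

/-- The left unitor of reflected 1-cells, as an isomorphism. -/
noncomputable def leftUnitor (f : H a b) : comp (one a) f ≅ f where
  hom := hμ.leftUnitorHom hW f
  inv := (F a b).preimage ((λ_ _).inv ≫ μ.unit a ▷ (F a b).obj f ≫ μ.mul (one a) f)
  hom_inv_id := by
    apply hμ.hom_ext_unit_right hW
    rw [Functor.map_comp, reassoc_of% (hμ.mul_leftUnitorHom hW f), Functor.map_preimage]
    simp
  inv_hom_id := by
    apply (F a b).map_injective
    rw [Functor.map_comp, Functor.map_preimage, Category.assoc, Category.assoc,
      hμ.mul_leftUnitorHom hW f]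
    simp

/-- The right unitor of reflected 1-cells, as an isomorphism. -/
noncomputable def rightUnitor (f : H a b) : comp f (one b) ≅ f where
  hom := hμ.rightUnitorHom hW f
  inv := (F a b).preimage ((ρ_ _).inv ≫ (F a b).obj f ◁ μ.unit b ≫ μ.mul f (one b))
  hom_inv_id := by
    apply hμ.hom_ext_unit_left hW
    rw [Functor.map_comp, reassoc_of% (hμ.mul_rightUnitorHom hW f), Functor.map_preimage]
    simp
  inv_hom_id := by
    apply (F a b).map_injective
    rw [Functor.map_comp, Functor.map_preimage, Category.assoc, Category.assoc,
      hμ.mul_rightUnitorHom hW f]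
    simp

end

variable [∀ a b, (F a b).Faithful]

/-- The bicategory of reflected 1-cells. -/
noncomputable def bicategory : HomBicategory B H one comp where
  whiskerLeft f _ _ η := hμ.whiskerLeft hW f η
  whiskerRight η g := hμ.whiskerRight hW η g
  associator f g h := hμ.associator hW f g h
  leftUnitor f := hμ.leftUnitor hW f
  rightUnitor f := hμ.rightUnitor hW f
  whiskerLeft_id f g := by
    apply hμ.hom_ext hW
    rw [hμ.mul_whiskerLeft hW]
    simp
  whiskerLeft_comp f _ _ _ η θ := by
    apply hμ.hom_ext hW
    rw [Functor.map_comp, hμ.mul_whiskerLeft hW, reassoc_of% (hμ.mul_whiskerLeft hW f η),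
      hμ.mul_whiskerLeft hW]
    simp
  id_whiskerLeft {a b f g} η := by
    rw [← Category.assoc, Iso.eq_comp_inv]
    apply hμ.hom_ext_unit_right hW
    change _ ≫ _ ≫ (F a b).map (_ ≫ hμ.leftUnitorHom hW g) =
      _ ≫ _ ≫ (F a b).map (hμ.leftUnitorHom hW f ≫ _)
    rw [Functor.map_comp, Functor.map_comp, reassoc_of% (hμ.mul_whiskerLeft hW (one a) η),
      reassoc_of% (hμ.mul_leftUnitorHom hW f), ← whisker_exchange_assoc,
      hμ.mul_leftUnitorHom hW]
    simp
  comp_whiskerLeft {a b c d} f g h h' η := by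
    rw [← Category.assoc, Iso.eq_comp_inv]
    apply hμ.hom_ext_right hW
    change _ ≫ _ ≫ (F a d).map (_ ≫ hμ.assocHom hW f g h') =
      _ ≫ _ ≫ (F a d).map (hμ.assocHom hW f g h ≫ _)
    rw [Functor.map_comp, Functor.map_comp,
      reassoc_of% (hμ.mul_whiskerLeft hW (comp f g) η), ← whisker_exchange_assoc,
      hμ.mul_assocHom hW, reassoc_of% (hμ.mul_assocHom hW f g h), hμ.mul_whiskerLeft hW,
      ← Bicategory.whiskerLeft_comp_assoc, hμ.mul_whiskerLeft hW]
    simp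
  id_whiskerRight f g := by
    apply hμ.hom_ext hW
    rw [hμ.mul_whiskerRight hW]
    simp
  comp_whiskerRight η θ g := by
    apply hμ.hom_ext hW
    rw [Functor.map_comp, hμ.mul_whiskerRight hW, reassoc_of% (hμ.mul_whiskerRight hW η g),
      hμ.mul_whiskerRight hW]
    simp
  whiskerRight_id {a b f g} η := by
    rw [← Category.assoc, Iso.eq_comp_inv]
    apply hμ.hom_ext_unit_left hW
    change _ ≫ _ ≫ (F a b).map (_ ≫ hμ.rightUnitorHom hW g) =
      _ ≫ _ ≫ (F a b).map (hμ.rightUnitorHom hW f ≫ _)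
    rw [Functor.map_comp, Functor.map_comp, reassoc_of% (hμ.mul_whiskerRight hW η (one b)),
      reassoc_of% (hμ.mul_rightUnitorHom hW f), whisker_exchange_assoc,
      hμ.mul_rightUnitorHom hW]
    simp
  whiskerRight_comp {a b c d} f f' η g h := by
    rw [Iso.eq_inv_comp]
    apply hμ.hom_ext_right hW
    change _ ≫ _ ≫ (F a d).map (hμ.assocHom hW f g h ≫ _) =
      _ ≫ _ ≫ (F a d).map (_ ≫ hμ.assocHom hW f' g h)
    rw [Functor.map_comp, Functor.map_comp, reassoc_of% (hμ.mul_assocHom hW f g h),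
      hμ.mul_whiskerRight hW, whisker_exchange_assoc,
      reassoc_of% (hμ.mul_whiskerRight hW (hμ.whiskerRight hW η g) h),
      ← Bicategory.comp_whiskerRight_assoc, hμ.mul_whiskerRight hW,
      Bicategory.comp_whiskerRight_assoc, hμ.mul_assocHom hW]
    simp
  whisker_assoc {a b c d} f g g' η h := by
    rw [← Category.assoc, Iso.eq_comp_inv]
    apply hμ.hom_ext_right hW
    change _ ≫ _ ≫ (F a d).map (_ ≫ hμ.assocHom hW f g' h) =
      _ ≫ _ ≫ (F a d).map (hμ.assocHom hW f g h ≫ _)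
    rw [Functor.map_comp, Functor.map_comp, reassoc_of% (hμ.mul_assocHom hW f g h),
      hμ.mul_whiskerLeft hW, reassoc_of% (hμ.mul_whiskerRight hW (hμ.whiskerLeft hW f η) h),
      ← Bicategory.comp_whiskerRight_assoc, hμ.mul_whiskerLeft hW,
      Bicategory.comp_whiskerRight_assoc, hμ.mul_assocHom hW,
      ← Bicategory.whiskerLeft_comp_assoc, hμ.mul_whiskerRight hW]
    simp
  whisker_exchange {a b c} f g h i η θ := by
    apply hμ.hom_ext hW
    rw [Functor.map_comp, Functor.map_comp, reassoc_of% (hμ.mul_whiskerLeft hW f θ),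
      reassoc_of% (hμ.mul_whiskerRight hW η h), hμ.mul_whiskerLeft hW, hμ.mul_whiskerRight hW,
      whisker_exchange_assoc]
  pentagon {a b c d e} f g h i := by
    apply hμ.hom_ext_right hW
    -- Three constraints separate the fourfold composite from its reflection. Two were cancelled by
    -- `hom_ext_right`, and the innermost one is cancelled here. What is left follows from the
    -- pentagon of `B`.
    apply hW.cancel (hW.whiskerRight i (hW.whiskerRight h (hμ.mul f g)))
    change _ ≫ _ ≫ _ ≫ (F a e).map (hμ.whiskerRight hW (hμ.assocHom hW f g h) i ≫
        hμ.assocHom hW f (comp g h) i ≫ hμ.whiskerLeft hW f (hμ.assocHom hW g h i)) =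
      _ ≫ _ ≫ _ ≫ (F a e).map (hμ.assocHom hW (comp f g) h i ≫ hμ.assocHom hW f g (comp h i))
    rw [Functor.map_comp, Functor.map_comp, Functor.map_comp,
      reassoc_of% (hμ.mul_whiskerRight hW (hμ.assocHom hW f g h) i),
      ← Bicategory.comp_whiskerRight_assoc, ← Bicategory.comp_whiskerRight_assoc,
      Category.assoc, hμ.mul_assocHom hW, Bicategory.comp_whiskerRight_assoc,
      Bicategory.comp_whiskerRight_assoc, reassoc_of% (hμ.mul_assocHom hW f (comp g h) i),
      hμ.mul_whiskerLeft hW, reassoc_of% (hμ.mul_assocHom hW (comp f g) h i),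
      associator_naturality_left_assoc, ← whisker_exchange_assoc, hμ.mul_assocHom hW,
      associator_naturality_middle_assoc, ← Bicategory.whiskerLeft_comp_assoc,
      ← Bicategory.whiskerLeft_comp_assoc, Category.assoc, hμ.mul_assocHom hW]
    simp
  triangle {a b c} f g := by
    apply hμ.hom_ext_right hW
    -- Besides the two composition constraints, the unity constraint inside `comp f (one b)` is
    -- cancelled, which leaves the triangle of `B`.
    apply hW.cancel (hW.whiskerRight g (hW.whiskerLeft f (hμ.unit b)))
    change _ ≫ _ ≫ _ ≫ (F a c).map (hμ.assocHom hW f (one b) g ≫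
        hμ.whiskerLeft hW f (hμ.leftUnitorHom hW g)) =
      _ ≫ _ ≫ _ ≫ (F a c).map (hμ.whiskerRight hW (hμ.rightUnitorHom hW f) g)
    rw [Functor.map_comp, reassoc_of% (hμ.mul_assocHom hW f (one b) g), hμ.mul_whiskerLeft hW,
      hμ.mul_whiskerRight hW, ← Bicategory.comp_whiskerRight_assoc,
      ← Bicategory.comp_whiskerRight_assoc, Category.assoc, hμ.mul_rightUnitorHom hW,
      associator_naturality_middle_assoc, ← Bicategory.whiskerLeft_comp_assoc,
      ← Bicategory.whiskerLeft_comp_assoc, Category.assoc, hμ.mul_leftUnitorHom hW]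
    simp

theorem isLax_bicategory : μ.IsLax (hμ.bicategory hW) where
  mul_whiskerRight := hμ.mul_whiskerRight hW
  mul_whiskerLeft := hμ.mul_whiskerLeft hW
  associator := hμ.mul_assocHom hW
  leftUnitor := hμ.mul_leftUnitorHom hW
  rightUnitor := hμ.mul_rightUnitorHom hW

end Mem

end LaxConstraints

end LocalReflection

/-! ### Comparison of two reflected bicategories -/

section LocalReflection

open Bicategory

universe w₁ v₁ u₁ u₂ v₂ u₃ v₃

variable {B : Type u₁} [Bicategory.{w₁, v₁} B] {H₁ : B → B → Type u₂} {H₂ : B → B → Type u₃}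
  [∀ a b, Category.{v₂} (H₁ a b)] [∀ a b, Category.{v₃} (H₂ a b)]
  {G : ∀ a b, H₁ a b ⥤ H₂ a b} {F : ∀ a b, H₂ a b ⥤ (a ⟶ b)}
  {one₁ : ∀ a, H₁ a a} {comp₁ : ∀ {a b c : B}, H₁ a b → H₁ b c → H₁ a c}
  {one₂ : ∀ a, H₂ a a} {comp₂ : ∀ {a b c : B}, H₂ a b → H₂ b c → H₂ a c}
  {W : ∀ a b : B, MorphismProperty (a ⟶ b)} [∀ a b, (F a b).Full]

/-- Both `p` and `q` represent the functor of 2-cells from `x` into images, so the induced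
comparison is invertible by the Yoneda lemma. -/
theorem IsLocallyReflecting.isIso_desc [∀ a b, (F a b).Faithful]
    (hW : IsLocallyReflecting F W) {a b : B} {x : a ⟶ b} {y z : H₂ a b}
    {p : x ⟶ (F a b).obj y} {q : x ⟶ (F a b).obj z} (hp : W a b p) (hq : W a b q) :
    IsIso (hW.desc hp q) := by
  refine isIso_of_coyoneda_map_bijective _ fun t => ?_
  have h := fun {y : H₂ a b} {p : x ⟶ (F a b).obj y} (hp : W a b p) =>
    (hW.bijective hp t).comp ((Functor.FullyFaithful.ofFullyFaithful (F a b)).map_bijective y t)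
  refine (Function.Bijective.of_comp_iff' (h hp) _).1 ?_
  convert h hq using 1
  funext g
  simp [reassoc_of% (hW.comp_map_desc hp q)]

/-- The unit axioms of a lax functor involve inverse unitors, those of `LaxConstraints.IsLax` the
unitors. This passes from one form to the other. -/
theorem map_inv_eq_iff {X Y : Type*} [Category X] [Category Y] (F : X ⥤ Y) {x y : X} (i : x ≅ y)
    {z : Y} (j : z ≅ F.obj y) (m : z ⟶ F.obj x) :
    F.map i.inv = j.inv ≫ m ↔ m ≫ F.map i.hom = j.hom := by
  rw [Iso.eq_inv_comp]
  exact ((Iso.comp_inv_eq (F.mapIso i)).trans eq_comm)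

namespace LaxConstraints

variable {μ₁ : LaxConstraints (fun a b => G a b ⋙ F a b) one₁ comp₁}
  {μ₂ : LaxConstraints F one₂ comp₂} {𝓑₁ : HomBicategory B H₁ one₁ comp₁}
  {𝓑₂ : HomBicategory B H₂ one₂ comp₂} (hW : IsLocallyReflecting F W) (hμ₂ : μ₂.Mem W)

section

variable {a b c : B}

variable (μ₁) in
/-- The unity constraint of the comparison. -/
noncomputable def compareUnit (a : B) : one₂ a ⟶ (G a a).obj (one₁ a) :=
  hW.desc (hμ₂.unit a) (μ₁.unit a)

variable (μ₁) in
/-- The functoriality constraint of the comparison. -/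
noncomputable def compareMul (f : H₁ a b) (g : H₁ b c) :
    comp₂ ((G a b).obj f) ((G b c).obj g) ⟶ (G a c).obj (comp₁ f g) :=
  hW.desc (hμ₂.mul _ _) (μ₁.mul f g)

theorem unit_compareUnit (a : B) :
    μ₂.unit a ≫ (F a a).map (compareUnit μ₁ hW hμ₂ a) = μ₁.unit a :=
  hW.comp_map_desc _ _

theorem mul_compareMul (f : H₁ a b) (g : H₁ b c) :
    μ₂.mul ((G a b).obj f) ((G b c).obj g) ≫ (F a c).map (compareMul μ₁ hW hμ₂ f g) =
      μ₁.mul f g :=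
  hW.comp_map_desc _ _

end

variable [∀ a b, (F a b).Faithful] (h₁ : μ₁.IsLax 𝓑₁) (h₂ : μ₂.IsLax 𝓑₂)

/-- The comparison of bicategories with the same underlying constraints. -/
noncomputable def compare : HomLaxFunctor 𝓑₁ 𝓑₂ G where
  mapId := compareUnit μ₁ hW hμ₂
  mapComp := compareMul μ₁ hW hμ₂
  mapComp_naturality_left {a b c f f'} η g := by
    -- The comparison cells are characterized by composing with the constraints of `μ₂` to those of
    -- `μ₁`. Restricted along `μ₂`, each axiom of the comparison becomes the corresponding axiom for
    -- `μ₁`.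
    apply hμ₂.hom_ext hW
    rw [Functor.map_comp, Functor.map_comp, reassoc_of% (mul_compareMul hW hμ₂ f g),
      reassoc_of% (h₂.mul_whiskerRight ((G a b).map η) ((G b c).obj g)),
      mul_compareMul hW hμ₂]
    exact h₁.mul_whiskerRight η g
  mapComp_naturality_right {a b c} f g g' η := by
    apply hμ₂.hom_ext hW
    rw [Functor.map_comp, Functor.map_comp, reassoc_of% (mul_compareMul hW hμ₂ f g),
      reassoc_of% (h₂.mul_whiskerLeft ((G a b).obj f) ((G b c).map η)),
      mul_compareMul hW hμ₂]
    exact h₁.mul_whiskerLeft f η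
  map₂_associator {a b c d} f g h := by
    apply hμ₂.hom_ext_right hW
    rw [Functor.map_comp, Functor.map_comp, Functor.map_comp, Functor.map_comp,
      reassoc_of% (h₂.mul_whiskerRight (compareMul μ₁ hW hμ₂ f g) ((G c d).obj h)),
      reassoc_of% (mul_compareMul hW hμ₂ (comp₁ f g) h), ← Bicategory.comp_whiskerRight_assoc,
      mul_compareMul hW hμ₂,
      reassoc_of% (h₂.associator ((G a b).obj f) ((G b c).obj g) ((G c d).obj h)),
      reassoc_of% (h₂.mul_whiskerLeft ((G a b).obj f) (compareMul μ₁ hW hμ₂ g h)),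
      mul_compareMul hW hμ₂, ← Bicategory.whiskerLeft_comp_assoc, mul_compareMul hW hμ₂]
    exact h₁.associator f g h
  map₂_leftUnitor {a b} f := by
    rw [Iso.eq_inv_comp]
    refine (Iso.comp_inv_eq ((G a b).mapIso (𝓑₁.leftUnitor f))).2 ?_
    rw [Functor.mapIso_hom]
    apply hμ₂.hom_ext_unit_right hW
    rw [h₂.leftUnitor, Functor.map_comp, Functor.map_comp, Category.assoc,
      reassoc_of% (h₂.mul_whiskerRight (compareUnit μ₁ hW hμ₂ a) ((G a b).obj f)),
      reassoc_of% (mul_compareMul hW hμ₂ (one₁ a) f), ← Bicategory.comp_whiskerRight_assoc,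
      unit_compareUnit hW hμ₂]
    exact (h₁.leftUnitor f).symm
  map₂_rightUnitor {a b} f := by
    rw [Iso.eq_inv_comp]
    refine (Iso.comp_inv_eq ((G a b).mapIso (𝓑₁.rightUnitor f))).2 ?_
    rw [Functor.mapIso_hom]
    apply hμ₂.hom_ext_unit_left hW
    rw [h₂.rightUnitor, Functor.map_comp, Functor.map_comp, Category.assoc,
      reassoc_of% (h₂.mul_whiskerLeft ((G a b).obj f) (compareUnit μ₁ hW hμ₂ b)),
      reassoc_of% (mul_compareMul hW hμ₂ f (one₁ b)), ← Bicategory.whiskerLeft_comp_assoc,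
      unit_compareUnit hW hμ₂]
    exact (h₁.rightUnitor f).symm

theorem isPseudo_compare (hμ₁ : μ₁.Mem W) : (compare hW hμ₂ h₁ h₂).IsPseudo where
  isIso_mapId a := hW.isIso_desc (hμ₂.unit a) (hμ₁.unit a)
  isIso_mapComp f g := hW.isIso_desc (hμ₂.mul _ _) (hμ₁.mul f g)

end LaxConstraints

end LocalReflection

/-! ### The lax functor from distributors to spans, on generalized elements -/

namespace Spans

section

variable {E : Type u} [Category.{v} E] [HasFiniteLimits E] {A B C D : IntGpd E}

theorem whiskerR_f₀_p₁ {S S' : Spans A B} (η : S ⟶ S') (T : Spans B C) :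
    (whiskerR η T).hom.f₀ ≫ (p₁ S' T).f₀ = (p₁ S T).f₀ ≫ η.hom.f₀ :=
  congrArg IntGpd.Hom.f₀
    (show (whiskerR η T).hom ≫ p₁ S' T = p₁ S T ≫ η.hom from pair_p₁ _ _ _)

theorem whiskerR_f₀_p₂ {S S' : Spans A B} (η : S ⟶ S') (T : Spans B C) :
    (whiskerR η T).hom.f₀ ≫ (p₂ S' T).f₀ = (p₂ S T).f₀ :=
  congrArg IntGpd.Hom.f₀ (show (whiskerR η T).hom ≫ p₂ S' T = p₂ S T from pair_p₂ _ _ _)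

theorem whiskerL_f₀_p₁ (S : Spans A B) {T T' : Spans B C} (η : T ⟶ T') :
    (whiskerL S η).hom.f₀ ≫ (p₁ S T').f₀ = (p₁ S T).f₀ :=
  congrArg IntGpd.Hom.f₀ (show (whiskerL S η).hom ≫ p₁ S T' = p₁ S T from pair_p₁ _ _ _)

theorem whiskerL_f₀_p₂ (S : Spans A B) {T T' : Spans B C} (η : T ⟶ T') :
    (whiskerL S η).hom.f₀ ≫ (p₂ S T').f₀ = (p₂ S T).f₀ ≫ η.hom.f₀ :=
  congrArg IntGpd.Hom.f₀
    (show (whiskerL S η).hom ≫ p₂ S T' = p₂ S T ≫ η.hom from pair_p₂ _ _ _)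

variable (S : Spans A B) (T : Spans B C) (U : Spans C D)

theorem assoc_f₀_p₁ : (assoc S T U).hom.hom.f₀ ≫ (p₁ S (comp T U)).f₀ =
    (p₁ (comp S T) U).f₀ ≫ (p₁ S T).f₀ :=
  congrArg IntGpd.Hom.f₀ (show (assoc S T U).hom.hom ≫ p₁ S (comp T U) =
    p₁ (comp S T) U ≫ p₁ S T from pair_p₁ _ _ _)

theorem assoc_f₀_p₂_p₁ : (assoc S T U).hom.hom.f₀ ≫ (p₂ S (comp T U)).f₀ ≫ (p₁ T U).f₀ =
    (p₁ (comp S T) U).f₀ ≫ (p₂ S T).f₀ :=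
  congrArg IntGpd.Hom.f₀ (show (assoc S T U).hom.hom ≫ p₂ S (comp T U) ≫ p₁ T U =
    p₁ (comp S T) U ≫ p₂ S T by simp [assoc])

theorem assoc_f₀_p₂_p₂ : (assoc S T U).hom.hom.f₀ ≫ (p₂ S (comp T U)).f₀ ≫ (p₂ T U).f₀ =
    (p₂ (comp S T) U).f₀ :=
  congrArg IntGpd.Hom.f₀ (show (assoc S T U).hom.hom ≫ p₂ S (comp T U) ≫ p₂ T U =
    p₂ (comp S T) U by simp [assoc])

end

end Spans

namespace IntDist

section

variable {E : Type u} [Category.{v} E] [HasFiniteLimits E] {A B C D : IntGpd E}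

theorem homObj_comp_spanMap {S : IntDist A B} {T : IntDist B C} (τ : Tensor S T) {X : Spans A C}
    (k : X ⟶ Spans.comp S.elSpan T.elSpan) : homObj (k ≫ τ.spanMap) =
      τ.tmul (k.hom.f₀ ≫ Tensor.fst₀ S T) (k.hom.f₀ ≫ Tensor.snd₀ S T)
        (by rw [Category.assoc, Category.assoc, Tensor.isPullback₀.w]) :=
  τ.comp_tmul _ _ _ _

theorem lift_comp_tmul {S : IntDist A B} {T : IntDist B C} (τ : Tensor S T) {X : E}
    (s : X ⟶ S.S₀) (t : X ⟶ T.S₀) (h : s ≫ S.R = t ≫ T.L) :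
    Tensor.isPullback₀.lift s t h ≫
      τ.tmul (Tensor.fst₀ S T) (Tensor.snd₀ S T) Tensor.isPullback₀.w = τ.tmul s t h :=
  (τ.comp_tmul _ _ _ _).trans
    (τ.tmul_congr (Tensor.isPullback₀.lift_fst _ _ _) (Tensor.isPullback₀.lift_snd _ _ _) _)

/-- Morphisms into the span of a distributor are determined on objects, and the objects of the
composite span carry the universal pair `(s, t)`. An equation between 2-cells of spans is thus the
same as a formula on `s ⊗ t`. The other coherence cells are treated likewise. -/
theorem spanMap_comp_map_iff_whiskerRight {S S' : IntDist A B} {T : IntDist B C}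
    (τ : Tensor S T) (τ' : Tensor S' T) (η : S ⟶ S') (φ : τ.obj ⟶ τ'.obj) :
    τ.spanMap ≫ (elements A C).map φ =
        Spans.whiskerR ((elements A B).map η) T.elSpan ≫ τ'.spanMap ↔
      ∀ {X : E} (s : X ⟶ S.S₀) (t : X ⟶ T.S₀) (h : s ≫ S.R = t ≫ T.L),
        τ.tmul s t h ≫ IntDist.Hom.f φ =
          τ'.tmul (s ≫ IntDist.Hom.f η) t (by rw [Category.assoc, η.f_R, h]) := by
  have hl : homObj (τ.spanMap ≫ (elements A C).map φ) =
    τ.tmul (Tensor.fst₀ S T) (Tensor.snd₀ S T) Tensor.isPullback₀.w ≫ IntDist.Hom.f φ := rfl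
  have hr : homObj (Spans.whiskerR ((elements A B).map η) T.elSpan ≫ τ'.spanMap) =
      τ'.tmul (Tensor.fst₀ S T ≫ IntDist.Hom.f η) (Tensor.snd₀ S T)
        (by rw [Category.assoc, η.f_R, Tensor.isPullback₀.w]) :=
    (homObj_comp_spanMap _ _).trans (τ'.tmul_congr
      (Spans.whiskerR_f₀_p₁ _ _)
      (Spans.whiskerR_f₀_p₂ _ _) _)
  refine ⟨fun e X s t h => ?_, fun e => hom_elSpan_ext (hl.trans ((e _ _ _).trans hr.symm))⟩
  have := congrArg (Tensor.isPullback₀.lift s t h ≫ ·)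
    (hl.symm.trans ((congrArg homObj e).trans hr))
  refine ((congrArg (· ≫ IntDist.Hom.f φ) (lift_comp_tmul τ s t h)).symm.trans
    (Category.assoc _ _ _)).trans (this.trans ((τ'.comp_tmul _ _ _ _).trans
      (τ'.tmul_congr ?_ (Tensor.isPullback₀.lift_snd _ _ _) _)))
  rw [Tensor.isPullback₀.lift_fst_assoc]

theorem spanMap_comp_map_iff_whiskerLeft {S : IntDist A B} {T T' : IntDist B C}
    (τ : Tensor S T) (τ' : Tensor S T') (η : T ⟶ T') (φ : τ.obj ⟶ τ'.obj) :
    τ.spanMap ≫ (elements A C).map φ =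
        Spans.whiskerL S.elSpan ((elements B C).map η) ≫ τ'.spanMap ↔
      ∀ {X : E} (s : X ⟶ S.S₀) (t : X ⟶ T.S₀) (h : s ≫ S.R = t ≫ T.L),
        τ.tmul s t h ≫ IntDist.Hom.f φ =
          τ'.tmul s (t ≫ IntDist.Hom.f η) (by rw [Category.assoc, η.f_L, h]) := by
  have hl : homObj (τ.spanMap ≫ (elements A C).map φ) =
    τ.tmul (Tensor.fst₀ S T) (Tensor.snd₀ S T) Tensor.isPullback₀.w ≫ IntDist.Hom.f φ := rfl
  have hr : homObj (Spans.whiskerL S.elSpan ((elements B C).map η) ≫ τ'.spanMap) =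
      τ'.tmul (Tensor.fst₀ S T) (Tensor.snd₀ S T ≫ IntDist.Hom.f η)
        (by rw [Category.assoc, η.f_L, Tensor.isPullback₀.w]) :=
    (homObj_comp_spanMap _ _).trans (τ'.tmul_congr
      (Spans.whiskerL_f₀_p₁ _ _)
      (Spans.whiskerL_f₀_p₂ _ _) _)
  refine ⟨fun e X s t h => ?_, fun e => hom_elSpan_ext (hl.trans ((e _ _ _).trans hr.symm))⟩
  have := congrArg (Tensor.isPullback₀.lift s t h ≫ ·)
    (hl.symm.trans ((congrArg homObj e).trans hr))
  refine ((congrArg (· ≫ IntDist.Hom.f φ) (lift_comp_tmul τ s t h)).symm.trans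
    (Category.assoc _ _ _)).trans (this.trans ((τ'.comp_tmul _ _ _ _).trans
      (τ'.tmul_congr (Tensor.isPullback₀.lift_fst _ _ _) ?_ _)))
  rw [Tensor.isPullback₀.lift_snd_assoc]

theorem spanMap_comp_map_iff_associator {S : IntDist A B} {T : IntDist B C} {U : IntDist C D}
    (τ : Tensor S T) (τ' : Tensor τ.obj U) (σ : Tensor T U) (σ' : Tensor S σ.obj)
    (φ : τ'.obj ⟶ σ'.obj) :
    Spans.whiskerR τ.spanMap U.elSpan ≫ τ'.spanMap ≫ (elements A D).map φ =
        (Spans.assoc S.elSpan T.elSpan U.elSpan).hom ≫ Spans.whiskerL S.elSpan σ.spanMap ≫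
          σ'.spanMap ↔
      ∀ {X : E} (s : X ⟶ S.S₀) (t : X ⟶ T.S₀) (u : X ⟶ U.S₀) (hst : s ≫ S.R = t ≫ T.L)
        (htu : t ≫ T.R = u ≫ U.L),
        τ'.tmul (τ.tmul s t hst) u (by rw [IntDist.Tensor.tmul_R, htu]) ≫ IntDist.Hom.f φ =
          σ'.tmul s (σ.tmul t u htu) (by rw [IntDist.Tensor.tmul_L, hst]) := by
  let q : (Spans.comp (Spans.comp S.elSpan T.elSpan) U.elSpan).apex.obj ⟶
    (Spans.comp S.elSpan T.elSpan).apex.obj :=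
      (Spans.p₁ (Spans.comp S.elSpan T.elSpan) U.elSpan).f₀
  let r : (Spans.comp (Spans.comp S.elSpan T.elSpan) U.elSpan).apex.obj ⟶ U.S₀ :=
      (Spans.p₂ (Spans.comp S.elSpan T.elSpan) U.elSpan).f₀
  -- The objects of the iterated composite carry the universal triple `(s, t, u)`.
  have hp : IsPullback q r (Tensor.snd₀ S T ≫ T.R) U.L := Spans.isPullback_comp_f₀ _ _
  have h₁ : (q ≫ Tensor.fst₀ S T) ≫ S.R = (q ≫ Tensor.snd₀ S T) ≫ T.L := by
    rw [Category.assoc, Category.assoc, Tensor.isPullback₀.w]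
  have h₂ : (q ≫ Tensor.snd₀ S T) ≫ T.R = r ≫ U.L := by rw [Category.assoc, hp.w]
  have hl : homObj (Spans.whiskerR τ.spanMap U.elSpan ≫ τ'.spanMap ≫ (elements A D).map φ) =
      τ'.tmul (τ.tmul (q ≫ Tensor.fst₀ S T) (q ≫ Tensor.snd₀ S T) h₁) r
        (by rw [IntDist.Tensor.tmul_R, h₂]) ≫ IntDist.Hom.f φ := by
    refine (congrArg homObj (Category.assoc _ _ _).symm).trans
      (congrArg (· ≫ IntDist.Hom.f φ) ((homObj_comp_spanMap τ' (Spans.whiskerR τ.spanMap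
        U.elSpan)).trans (τ'.tmul_congr ((Spans.whiskerR_f₀_p₁ _ _).trans
          (τ.comp_tmul q _ _ Tensor.isPullback₀.w))
          (Spans.whiskerR_f₀_p₂ _ _) _)))
  have hr : homObj ((Spans.assoc S.elSpan T.elSpan U.elSpan).hom ≫
        Spans.whiskerL S.elSpan σ.spanMap ≫ σ'.spanMap) =
      σ'.tmul (q ≫ Tensor.fst₀ S T) (σ.tmul (q ≫ Tensor.snd₀ S T) r h₂)
        (by rw [IntDist.Tensor.tmul_L, h₁]) := by
    refine (congrArg homObj (Category.assoc _ _ _).symm).trans ((homObj_comp_spanMap σ'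
      ((Spans.assoc S.elSpan T.elSpan U.elSpan).hom ≫ Spans.whiskerL S.elSpan σ.spanMap)).trans
        (σ'.tmul_congr ?_ ?_ _))
    · refine (Category.assoc _ _ _).trans ((congrArg (_ ≫ ·)
        (Spans.whiskerL_f₀_p₁ S.elSpan σ.spanMap)).trans ?_)
      exact Spans.assoc_f₀_p₁ _ _ _
    · refine (Category.assoc _ _ _).trans ((congrArg (_ ≫ ·)
        (Spans.whiskerL_f₀_p₂ S.elSpan σ.spanMap)).trans ?_)
      refine (Category.assoc _ _ _).symm.trans
        ((σ.comp_tmul _ _ _ Tensor.isPullback₀.w).trans (σ.tmul_congr ?_ ?_ _))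
      · exact (Category.assoc _ _ _).trans (Spans.assoc_f₀_p₂_p₁ _ _ _)
      · exact (Category.assoc _ _ _).trans (Spans.assoc_f₀_p₂_p₂ _ _ _)
  refine ⟨fun e X s t u hst htu => ?_,
    fun e => hom_elSpan_ext (hl.trans ((e _ _ _ _ _).trans hr.symm))⟩
  have hz : Tensor.isPullback₀.lift s t hst ≫ Tensor.snd₀ S T ≫ T.R = u ≫ U.L := by
    rw [Tensor.isPullback₀.lift_snd_assoc, htu]
  have z₁ : hp.lift _ _ hz ≫ q ≫ Tensor.fst₀ S T = s := by
    rw [hp.lift_fst_assoc, Tensor.isPullback₀.lift_fst]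
  have z₂ : hp.lift _ _ hz ≫ q ≫ Tensor.snd₀ S T = t := by
    rw [hp.lift_fst_assoc, Tensor.isPullback₀.lift_snd]
  have z₃ : hp.lift _ _ hz ≫ r = u := hp.lift_snd _ _ _
  have := congrArg (hp.lift _ _ hz ≫ ·) (hl.symm.trans ((congrArg homObj e).trans hr))
  refine Eq.trans (Eq.trans (congrArg (· ≫ IntDist.Hom.f φ) ?_) (Category.assoc _ _ _))
    (this.trans ?_)
  · exact ((τ'.comp_tmul _ _ _ _).trans
      (τ'.tmul_congr ((τ.comp_tmul _ _ _ _).trans (τ.tmul_congr z₁ z₂ _)) z₃ _)).symm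
  · exact (σ'.comp_tmul _ _ _ _).trans
      (σ'.tmul_congr z₁ ((σ.comp_tmul _ _ _ _).trans (σ.tmul_congr z₂ z₃ _)) _)

/-- The equation of spans only involves the elements `1 ⊗ s`. It determines the value on every `α ⊗
s` because `α ⊗ s = (1 · α) ⊗ s = 1 ⊗ (α · s)`. -/
theorem spanMap_comp_map_iff_leftUnitor {S : IntDist A B} (τ : Tensor (one A) S)
    (φ : τ.obj ⟶ S) :
    Spans.whiskerR (oneMap A) S.elSpan ≫ τ.spanMap ≫ (elements A B).map φ =
        (Spans.leftUnitor S.elSpan).hom ↔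
      ∀ {X : E} (α : X ⟶ A.arr) (s : X ⟶ S.S₀) (h : α ≫ A.d = s ≫ S.L),
        τ.tmul α s h ≫ IntDist.Hom.f φ = S.lact α s h := by
  let q : (Spans.comp (Spans.one A) S.elSpan).apex.obj ⟶ A.obj :=
    (Spans.p₁ (Spans.one A) S.elSpan).f₀
  let r : (Spans.comp (Spans.one A) S.elSpan).apex.obj ⟶ S.S₀ :=
    (Spans.p₂ (Spans.one A) S.elSpan).f₀
  have hp : IsPullback q r (𝟙 A.obj) S.L := Spans.isPullback_comp_f₀ _ _
  have hqr : q = r ≫ S.L := (Category.comp_id q).symm.trans hp.w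
  have h₁ : (q ≫ A.e) ≫ A.d = r ≫ S.L := by rw [Category.assoc, A.e_d, hp.w]
  have hl : homObj (Spans.whiskerR (oneMap A) S.elSpan ≫ τ.spanMap ≫ (elements A B).map φ) =
      τ.tmul (S := one A) (q ≫ A.e) r h₁ ≫ IntDist.Hom.f φ :=
    (congrArg homObj (Category.assoc _ _ _).symm).trans
      (congrArg (· ≫ IntDist.Hom.f φ) ((homObj_comp_spanMap τ (Spans.whiskerR (oneMap A)
        S.elSpan)).trans (τ.tmul_congr (Spans.whiskerR_f₀_p₁ _ _)
          (Spans.whiskerR_f₀_p₂ _ _) _)))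
  have hr : homObj (Spans.leftUnitor S.elSpan).hom = r := rfl
  refine ⟨fun e X α s h => ?_,
    fun e => hom_elSpan_ext (hl.trans ((e _ _ _).trans ((one_lact _ _ hqr).trans hr.symm)))⟩
  have key : ∀ {X : E} (s : X ⟶ S.S₀), τ.tmul (S := one A) ((s ≫ S.L) ≫ A.e) s
      (show ((s ≫ S.L) ≫ A.e) ≫ A.d = s ≫ S.L by simp [A.e_d]) ≫ IntDist.Hom.f φ = s := by
    intro X s
    have hs : (s ≫ S.L) ≫ 𝟙 A.obj = s ≫ S.L := Category.comp_id _
    have := congrArg (hp.lift _ _ hs ≫ ·) (hl.symm.trans ((congrArg homObj e).trans hr))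
    refine Eq.trans (Eq.trans (congrArg (· ≫ IntDist.Hom.f φ) ?_) (Category.assoc _ _ _))
      (this.trans (hp.lift_snd _ _ _))
    refine ((τ.comp_tmul _ _ _ _).trans (τ.tmul_congr ?_ (hp.lift_snd _ _ _) _)).symm
    exact (hp.lift_fst_assoc _ _ _ _)
  have h₂ : ((α ≫ A.c) ≫ A.e) ≫ A.d = α ≫ A.c := by simp [A.e_d]
  refine Eq.trans (congrArg (· ≫ IntDist.Hom.f φ) ?_) (key (S.lact α s h))
  refine (τ.tmul_congr ?_ rfl _).trans ((τ.tmul_ract (S := one A) ((α ≫ A.c) ≫ A.e) α s h₂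
    h).trans (τ.tmul_congr ?_ rfl _))
  · exact ((one_ract_eq A _ _ h₂).trans (A.mul_id _ _ rfl)).symm
  · rw [lact_L]

/-- Here the general case follows from `s ⊗ β = s ⊗ (β · 1) = (s · β) ⊗ 1`. -/
theorem spanMap_comp_map_iff_rightUnitor {S : IntDist A B} (τ : Tensor S (one B))
    (φ : τ.obj ⟶ S) :
    Spans.whiskerL S.elSpan (oneMap B) ≫ τ.spanMap ≫ (elements A B).map φ =
        (Spans.rightUnitor S.elSpan).hom ↔
      ∀ {X : E} (s : X ⟶ S.S₀) (β : X ⟶ B.arr) (h : s ≫ S.R = β ≫ B.c),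
        τ.tmul s β h ≫ IntDist.Hom.f φ = S.ract s β h := by
  let q : (Spans.comp S.elSpan (Spans.one B)).apex.obj ⟶ S.S₀ :=
    (Spans.p₁ S.elSpan (Spans.one B)).f₀
  let r : (Spans.comp S.elSpan (Spans.one B)).apex.obj ⟶ B.obj :=
    (Spans.p₂ S.elSpan (Spans.one B)).f₀
  have hp : IsPullback q r S.R (𝟙 B.obj) := Spans.isPullback_comp_f₀ _ _
  have hqr : r = q ≫ S.R := (Category.comp_id r).symm.trans hp.w.symm
  have h₁ : q ≫ S.R = (r ≫ B.e) ≫ B.c := by rw [Category.assoc, B.e_c, hp.w]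
  have hl : homObj (Spans.whiskerL S.elSpan (oneMap B) ≫ τ.spanMap ≫ (elements A B).map φ) =
      τ.tmul (T := one B) q (r ≫ B.e) h₁ ≫ IntDist.Hom.f φ :=
    (congrArg homObj (Category.assoc _ _ _).symm).trans
      (congrArg (· ≫ IntDist.Hom.f φ) ((homObj_comp_spanMap τ (Spans.whiskerL S.elSpan
        (oneMap B))).trans (τ.tmul_congr (Spans.whiskerL_f₀_p₁ _ _)
          (Spans.whiskerL_f₀_p₂ _ _) _)))
  have hr : homObj (Spans.rightUnitor S.elSpan).hom = q := rfl
  refine ⟨fun e X s β h => ?_,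
    fun e => hom_elSpan_ext (hl.trans ((e _ _ _).trans ((ract_one _ _ hqr).trans hr.symm)))⟩
  have key : ∀ {X : E} (s : X ⟶ S.S₀), τ.tmul (T := one B) s ((s ≫ S.R) ≫ B.e)
      (show s ≫ S.R = ((s ≫ S.R) ≫ B.e) ≫ B.c by simp [B.e_c]) ≫ IntDist.Hom.f φ = s := by
    intro X s
    have hs : s ≫ S.R = (s ≫ S.R) ≫ 𝟙 B.obj := (Category.comp_id _).symm
    have := congrArg (hp.lift _ _ hs ≫ ·) (hl.symm.trans ((congrArg homObj e).trans hr))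
    refine Eq.trans (Eq.trans (congrArg (· ≫ IntDist.Hom.f φ) ?_) (Category.assoc _ _ _))
      (this.trans (hp.lift_fst _ _ _))
    refine ((τ.comp_tmul _ _ _ _).trans (τ.tmul_congr (hp.lift_fst _ _ _) ?_ _)).symm
    exact (hp.lift_snd_assoc _ _ _ _)
  have h₂ : β ≫ B.d = ((β ≫ B.d) ≫ B.e) ≫ B.c := by simp [B.e_c]
  refine Eq.trans (congrArg (· ≫ IntDist.Hom.f φ) ?_) (key (S.ract s β h))
  refine (τ.tmul_congr rfl ?_ _).trans ((τ.tmul_ract (T := one B) s β ((β ≫ B.d) ≫ B.e) h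
    h₂).symm.trans (τ.tmul_congr rfl ?_ _))
  · exact ((one_lact_eq B _ _ h₂).trans (B.id_mul _ _ rfl)).symm
  · rw [ract_R]

end

end IntDist

/-! ### The bicategories of distributors and of relations -/

section

variable (E : Type u) [Category.{v} E] [HasFiniteLimits E]

/-- The bicategory of spans of internal groupoids, as a bicategory in the sense of Mathlib. -/
noncomputable abbrev gpdSpanBicategory : Bicategory (IntGpd E) :=
  (spanBicategory (IntGpd E)).bicategory

attribute [local instance] gpdSpanBicategory

/-- The morphisms of spans that are final functors. -/
def finalSpanMaps (A B : IntGpd E) : MorphismProperty (Spans A B) :=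
  fun _ _ k => final E k.hom

/-- The inclusion of relations in spans. -/
abbrev relInclusion (A B : IntGpd E) : RelSpan (discreteFibration E) A B ⥤ Spans A B :=
  (isRelation (discreteFibration E) A B).ι

/-- The constraints of a lax functor from distributors to spans. -/
abbrev DistConstraints (τ : ∀ {A B C : IntGpd E} (S : IntDist A B) (T : IntDist B C),
    IntDist.Tensor S T) :=
  LaxConstraints (B := IntGpd E) (H := fun A B => IntDist A B) (fun A B => IntDist.elements A B)
    IntDist.one (fun S T => (τ S T).obj)

/-- The constraints of a lax functor from relations to spans. -/
abbrev RelConstraints (ρ : ∀ {A B : IntGpd E} (X : Spans A B),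
    SpanReflection (final E) (discreteFibration E) X) :=
  LaxConstraints (B := IntGpd E) (H := RelSpan (discreteFibration E)) (relInclusion E)
    (fun A => (ρ (Spans.one A)).rel) (fun S T => (ρ (Spans.comp S.obj T.obj)).rel)

end

/-! ### Existence of the two bicategories and their identification -/

section

variable (E : Type u) [Category.{v} E] [BarrExact E]

attribute [local instance] gpdSpanBicategory

instance full_elements (A B : IntGpd E) : @Functor.Full _ _ _
    ((gpdSpanBicategory E).homCategory A B) (IntDist.elements A B) :=
  inferInstanceAs (IntDist.elements A B).Full

instance faithful_elements (A B : IntGpd E) : @Functor.Faithful _ _ _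
    ((gpdSpanBicategory E).homCategory A B) (IntDist.elements A B) :=
  inferInstanceAs (IntDist.elements A B).Faithful

/-- Unique extension is orthogonality. Stability under whiskering uses both directions of the local
description of final functors. -/
theorem isLocallyReflecting_relInclusion :
    IsLocallyReflecting (B := IntGpd E) (relInclusion E) (finalSpanMaps E) where
  bijective hp z := Spans.bijective_precomp _ hp z.property
  whiskerLeft f _ _ p hp := (Spans.isLocallyFullEso_whiskerL ((Spans.isRelation_iff _).1 f.property)
    p (IntGpd.isLocallyFullEso_of_final _ hp)).final
  whiskerRight {_ _ _ _ _} p g hp := (Spans.isLocallyFullEso_whiskerR p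
    (IntGpd.isLocallyFullEso_of_final _ hp) ((Spans.isRelation_iff _).1 g.property)).final

theorem isLocallyReflecting_elements :
    IsLocallyReflecting (B := IntGpd E) (fun A B => IntDist.elements (E := E) A B)
      (finalSpanMaps E) where
  bijective hp z := Spans.bijective_precomp _ hp z.isRelation_elSpan
  whiskerLeft f _ _ p hp := (Spans.isLocallyFullEso_whiskerL f.isBifibration_elSpan
    p (IntGpd.isLocallyFullEso_of_final _ hp)).final
  whiskerRight {_ _ _ _ _} p g hp := (Spans.isLocallyFullEso_whiskerR p
    (IntGpd.isLocallyFullEso_of_final _ hp) g.isBifibration_elSpan).final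

variable {E}

/-- The constraints of the inclusion of distributors in spans. -/
noncomputable def distConstraints
    (τ : ∀ {A B C : IntGpd E} (S : IntDist A B) (T : IntDist B C), IntDist.Tensor S T) :
    DistConstraints E τ where
  unit A := IntDist.oneMap A
  mul S T := (τ S T).spanMap

theorem distConstraints_mem
    (τ : ∀ {A B C : IntGpd E} (S : IntDist A B) (T : IntDist B C), IntDist.Tensor S T) :
    (distConstraints τ).Mem (finalSpanMaps E) where
  unit A := (IntDist.isLocallyFullEso_oneMap A).final
  mul S T := (τ S T).isLocallyFullEso_spanMap.final

/-- The constraints of the inclusion of relations in spans. -/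
noncomputable def relConstraints
    (ρ : ∀ {A B : IntGpd E} (X : Spans A B), SpanReflection (final E) (discreteFibration E) X) :
    RelConstraints E ρ where
  unit A := (ρ (Spans.one A)).unit
  mul S T := (ρ (Spans.comp S.obj T.obj)).unit

theorem relConstraints_mem
    (ρ : ∀ {A B : IntGpd E} (X : Spans A B), SpanReflection (final E) (discreteFibration E) X) :
    (relConstraints ρ).Mem (finalSpanMaps E) where
  unit A := (ρ (Spans.one A)).unit_mem
  mul S T := (ρ (Spans.comp S.obj T.obj)).unit_mem

/-- The relation associated with a span, obtained from its reflection in distributors. -/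
noncomputable def spanReflection {A B : IntGpd E} (X : Spans A B) :
    SpanReflection (final E) (discreteFibration E) X where
  rel := ⟨(IntDist.reflDist X).elSpan, (IntDist.reflDist X).isRelation_elSpan⟩
  unit := IntDist.reflUnit X
  unit_mem := (IntDist.isLocallyFullEso_reflUnit X).final

variable (E) in
/-- The bicategory of distributors. -/
noncomputable def distBicategory : DistBicategory E :=
  let μ := distConstraints (E := E) IntDist.tensor
  let hμ : μ.Mem _ := distConstraints_mem IntDist.tensor
  let hl : μ.IsLax _ := hμ.isLax_bicategory (isLocallyReflecting_elements E)
  { tensor := IntDist.tensor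
    bicat := hμ.bicategory (isLocallyReflecting_elements E)
    whiskerLeft_tmul := fun S _ _ η =>
      (IntDist.spanMap_comp_map_iff_whiskerLeft _ _ η _).1 (hl.mul_whiskerLeft S η)
    whiskerRight_tmul := fun η T =>
      (IntDist.spanMap_comp_map_iff_whiskerRight _ _ η _).1 (hl.mul_whiskerRight η T)
    associator_tmul := fun S T U =>
      (IntDist.spanMap_comp_map_iff_associator _ _ _ _ _).1 (hl.associator S T U)
    leftUnitor_tmul := fun S => (IntDist.spanMap_comp_map_iff_leftUnitor _ _).1 (hl.leftUnitor S)
    rightUnitor_tmul := fun S =>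
      (IntDist.spanMap_comp_map_iff_rightUnitor _ _).1 (hl.rightUnitor S) }

variable (E) in
/-- The bicategory of relations. -/
noncomputable def relBicategory : RelBicategory (final E) (discreteFibration E) :=
  let μ := relConstraints (E := E) spanReflection
  let hμ : μ.Mem _ := relConstraints_mem spanReflection
  let hl : μ.IsLax _ := hμ.isLax_bicategory (isLocallyReflecting_relInclusion E)
  { refl := spanReflection
    bicat := hμ.bicategory (isLocallyReflecting_relInclusion E)
    incl :=
      { mapId := μ.unit
        mapComp := μ.mul
        mapComp_naturality_left := hl.mul_whiskerRight
        mapComp_naturality_right := hl.mul_whiskerLeft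
        map₂_associator := hl.associator
        map₂_leftUnitor := fun {A B} S => (map_inv_eq_iff (relInclusion E A B) _
          (Spans.leftUnitor S.obj) _).2 ((Category.assoc _ _ _).trans (hl.leftUnitor S))
        map₂_rightUnitor := fun {A B} S => (map_inv_eq_iff (relInclusion E A B) _
          (Spans.rightUnitor S.obj) _).2 ((Category.assoc _ _ _).trans (hl.rightUnitor S)) }
    incl_mapId := fun _ => rfl
    incl_mapComp := fun _ _ => rfl }

/-- The formulas on elements demanded of 𝓓 say exactly that its embedding in spans is lax, so the
comparison applies to an arbitrary bicategory of distributors, not only to the one constructed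
above. -/
theorem isLax_distConstraints (𝓓 : DistBicategory E) :
    (distConstraints 𝓓.tensor).IsLax 𝓓.bicat where
  mul_whiskerRight η T :=
    (IntDist.spanMap_comp_map_iff_whiskerRight _ _ η _).2 (𝓓.whiskerRight_tmul η T)
  mul_whiskerLeft S _ _ η :=
    (IntDist.spanMap_comp_map_iff_whiskerLeft _ _ η _).2 (𝓓.whiskerLeft_tmul S η)
  associator S T U :=
    (IntDist.spanMap_comp_map_iff_associator _ _ _ _ _).2 (𝓓.associator_tmul S T U)
  leftUnitor S := (IntDist.spanMap_comp_map_iff_leftUnitor _ _).2 (𝓓.leftUnitor_tmul S)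
  rightUnitor S := (IntDist.spanMap_comp_map_iff_rightUnitor _ _).2 (𝓓.rightUnitor_tmul S)

theorem isLax_relConstraints (𝓡 : RelBicategory (final E) (discreteFibration E)) :
    (relConstraints 𝓡.refl).IsLax 𝓡.bicat := by
  obtain ⟨refl, bicat, incl, h₀, h₁⟩ := 𝓡
  obtain ⟨m₀, m, h₂, h₃, h₄, h₅, h₆⟩ := incl
  -- The constraints of the inclusion are, by assumption, the final parts. After substituting them,
  -- the axioms of `incl` are the required ones up to the form of the unit laws.
  obtain rfl : m₀ = _ := funext h₀
  obtain rfl : @m = fun {A B D : IntGpd E} (S : RelSpan (discreteFibration E) A B)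
      (T : RelSpan (discreteFibration E) B D) => (refl (Spans.comp S.obj T.obj)).unit := by
    funext A B D S T
    exact h₁ S T
  exact
    { mul_whiskerRight := h₂
      mul_whiskerLeft := h₃
      associator := h₄
      leftUnitor := fun {A B} S => (Category.assoc _ _ _).symm.trans
        ((map_inv_eq_iff (relInclusion E A B) _ (Spans.leftUnitor S.obj) _).1 (h₅ S))
      rightUnitor := fun {A B} S => (Category.assoc _ _ _).symm.trans
        ((map_inv_eq_iff (relInclusion E A B) _ (Spans.rightUnitor S.obj) _).1 (h₆ S)) }

/-- The embedding of distributors in spans factors through relations. Its constraints are final, and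
so are those of the inclusion of relations. Hence they factor through each other by unique
invertible cells, which are the constraints of the pseudofunctor. -/
theorem exists_comparison (h : ∀ (A B : IntGpd E) (S : IntDist A B),
      isRelation (discreteFibration E) A B S.elSpan)
    (𝓓 : DistBicategory E) (𝓡 : RelBicategory (final E) (discreteFibration E)) :
    ∃ Φ : HomLaxFunctor 𝓓.bicat 𝓡.bicat (toRel h), Φ.IsPseudo ∧
      (∀ A : IntGpd E, (𝓡.refl (Spans.one A)).unit ≫
        (isRelation (discreteFibration E) A A).ι.map (Φ.mapId A) = IntDist.oneMap A) ∧
      ∀ {A B C : IntGpd E} (S : IntDist A B) (T : IntDist B C),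
        (𝓡.refl (Spans.comp S.elSpan T.elSpan)).unit ≫
          (isRelation (discreteFibration E) A C).ι.map (Φ.mapComp S T) =
            (𝓓.tensor S T).spanMap := by
  let μ₁ : LaxConstraints (B := IntGpd E) (fun A B => toRel h A B ⋙ relInclusion E A B)
    IntDist.one (fun S T => (𝓓.tensor S T).obj) := distConstraints 𝓓.tensor
  have h₁ : μ₁.IsLax 𝓓.bicat := isLax_distConstraints 𝓓
  have hμ₁ : μ₁.Mem (finalSpanMaps E) := distConstraints_mem 𝓓.tensor
  have hW := isLocallyReflecting_relInclusion E
  have hμ₂ := relConstraints_mem 𝓡.refl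
  exact ⟨LaxConstraints.compare hW hμ₂ h₁ (isLax_relConstraints 𝓡),
    LaxConstraints.isPseudo_compare hW hμ₂ h₁ (isLax_relConstraints 𝓡) hμ₁,
    fun A => LaxConstraints.unit_compareUnit (μ₁ := μ₁) hW hμ₂ A,
    fun S T => LaxConstraints.mul_compareMul (μ₁ := μ₁) hW hμ₂ S T⟩

end


theorem theorem5 {E : Type u} [Category.{v} E] [BarrExact E] :
    -- final functors and discrete fibrations form an orthogonal factorization system
    IsOrthogonalFactorizationSystem (final E) (discreteFibration E) ∧
    -- distributors are fully and reflectively embedded in spans, with final functors as units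
    (∀ A B : IntGpd E,
      (IntDist.elements A B).Full ∧ (IntDist.elements A B).Faithful ∧
      ∃ (r : Spans A B ⥤ IntDist A B) (adj : r ⊣ IntDist.elements A B),
        IsIso adj.counit ∧ ∀ X : Spans A B, final E (adj.unit.app X).hom) ∧
    -- the composite of two distributors is the reflection of the composite of their spans
    (∀ {A B C : IntGpd E} (S : IntDist A B) (T : IntDist B C) (τ : IntDist.Tensor S T),
      ∃ Q : Spans.comp S.elSpan T.elSpan ⟶ (IntDist.elements A C).obj τ.obj,
        IntGpd.Hom.f₀ Q.hom = τ.spanObj ∧ final E Q.hom ∧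
        ∀ (r : Spans A C ⥤ IntDist A C) (adj : r ⊣ IntDist.elements A C),
          IsIso ((adj.homEquiv _ _).symm Q)) ∧
    -- both bicategories exist
    Nonempty (DistBicategory E) ∧
    Nonempty (RelBicategory (final E) (discreteFibration E)) ∧
    -- and they are identified by an identity-on-objects biequivalence
    ∃ hrel : ∀ (A B : IntGpd E) (S : IntDist A B),
        isRelation (discreteFibration E) A B S.elSpan,
      (∀ A B : IntGpd E, (toRel hrel A B).IsEquivalence) ∧
      ∀ (𝓓 : DistBicategory E) (𝓡 : RelBicategory (final E) (discreteFibration E)),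
        ∃ Φ : HomLaxFunctor 𝓓.bicat 𝓡.bicat (toRel hrel), Φ.IsPseudo ∧
          (∀ A : IntGpd E,
            IntGpd.Hom.f₀ ((𝓡.refl (Spans.one A)).unit ≫
              (isRelation (discreteFibration E) A A).ι.map (Φ.mapId A)).hom = A.e) ∧
          ∀ {A B C : IntGpd E} (S : IntDist A B) (T : IntDist B C),
            IntGpd.Hom.f₀ ((𝓡.refl (Spans.comp S.elSpan T.elSpan)).unit ≫
              (isRelation (discreteFibration E) A C).ι.map (Φ.mapComp S T)).hom =
              (𝓓.tensor S T).spanObj := by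
  refine ⟨IntGpd.isOrthogonalFactorizationSystem E, fun A B => ⟨inferInstance, inferInstance,
    -- The counit is invertible because the right adjoint is fully faithful.
    IntDist.reflFunctor A B, IntDist.reflAdjunction A B, inferInstance, fun X => ?_⟩,
    fun S T τ => ⟨τ.spanMap, rfl, τ.isLocallyFullEso_spanMap.final, fun r adj =>
      IntDist.isIso_homEquiv_symm τ.spanMap τ.isLocallyFullEso_spanMap.final r adj⟩,
    ⟨distBicategory E⟩, ⟨relBicategory E⟩, fun A B S => S.isRelation_elSpan,
    fun A B => IntDist.isEquivalence_toRel _, fun 𝓓 𝓡 => ?_⟩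
  · rw [IntDist.reflAdjunction_unit_app]
    exact (IntDist.isLocallyFullEso_reflUnit X).final
  · obtain ⟨Φ, hΦ, h₀, h₁⟩ := exists_comparison (fun A B S => S.isRelation_elSpan) 𝓓 𝓡
    refine ⟨Φ, hΦ, fun A => ?_, fun S T => ?_⟩
    · rw [h₀]
      exact IntDist.oneMap_f₀ A
    · rw [h₁]
      exact (𝓓.tensor S T).spanMap_f₀
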